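/- Work over an algebraically closed field $K$ and fix a plane $H\subset\mathbb P^3$. A cross is a union of two distinct lines through a common point, its vertex. A sub-star $P(A,B)$ in $H$ is the set of singular points of a configuration of $A$ distinct lines in $H$, no three of them concurrent, with $B$ of these points omitted in such a way that every line contains at most one omitted point; it has $\binom A2-B$ points. A scheme $B(L,C,(A,B))$ is a union of $L$ lines, $C$ crosses with vertices in $H$, and a sub-star $P(A,B)$ in $H$, all of them pairwise disjoint, where neither the lines nor the lines of the crosses are contained in $H$. For $Y\subset\mathbb P^3$ let $Y_{tr}=Y\cap H$, and let $Y_{res}$ be the scheme with ideal sheaf $\mathcal I_Y:\mathcal I_H$. Let $X$ be a scheme $B(L,C,(A,B))$ with sub-star $Z$, and let $\ell+2s\le L$, $c+h\le C$. A specialization $S(\ell,s,h,c)$ of $X$ to $X'$ is a flat family of closed subschemes of $\mathbb P^3$ over $\mathbb A^1$ with fibre $X$ at $t=1$ and fibre $X'$ at $t=0$, all but finitely many of whose fibres are schemes $B(L,C,(A,B))$ with the same sub-star $Z$, with lines and crosses given by vectors depending polynomially on $t$, and such that at $t=0$ these vectors describe lines and crosses of which: $\ell$ lines lie in $H$; $s$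 pairs of lines meet in a point of $H$; $h$ crosses have one line in $H$; $c$ crosses lie in $H$; the vertices of all crosses lie in $H$. It is further required that * $X'_{tr}$ is the union of the $\ell+2c+h$ lines in $H$, the $s$ double points of $H$ at the intersection points of the pairs, the $C-c-h$ subschemes of length $2$ at the vertices of the remaining crosses (in the direction of the line in which $H$ meets the plane of the cross), the $L-\ell-2s$ points in which the remaining lines meet $H$, and $Z$; * $X'_{res}$ is a scheme $B\big(L-\ell+h-2s,\;C-c+s-h,\;(\ell+2c+h,\,c)\big)$: the union of the remaining lines, the second lines of the $h$ crosses, the $s$ pairs (now crosses), the remaining crosses, and the intersection points of the $\ell+2c+h$ lines in $H$ other than the $c$ vertices of the crosses in $H$. We say that $X$ reduces to type $B(L',C',(A',B'))$ by $S_0,\dots,S_{m-1}$ if there is a sequence $X=X_0\to X_1\to\dots\to X_m$, where $X_{a+1}=(X_a')_{res}$ for a specialization $S_a$ of $X_a$ to $X_a'$, and where $X_m$ is a scheme $B(L',C',(A',B'))$; here, at every step, the lines and crosses at $t=0$ can be chosen general, i.e. in any prescribed non-empty Zariski open subset (which may depend on the previous choices) of the space of lines and crosses in the special position above. For $k\ge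 1$ and $d=3k$ let $Y_d$ denote a scheme $B(L,C,(A,B))$ of type $$B\Big(\tfrac{k(k+5)+4}2,\ \tfrac{k^2-1}2,\ \big(k+1,\tfrac{k+1}2\big)\Big)\ \text{ for } k \text{ odd},\qquad B\Big(\tfrac{k(k+5)+2}2,\ \tfrac{k^2}2,\ \big(k+1,\tfrac k2\big)\Big)\ \text{ for } k \text{ even}.$$ **Reduction Lemma.** 1. For every $k\ge4$ there are three specializations $S_0,S_1,S_2$ (i.e. triples of parameters $(\ell,s,h,c)$) by which every $Y_{3k}$ reduces to the type of $Y_{3k-3}$. 2. Iterating, for every $k\ge 3$ there are $3(k-3)$ specializations by which every $Y_{3k}$ reduces to the type $B(14,4,(4,2))$ of $Y_9$. 3. Emptiness passes upwards through each specialization: for every specialization of $X$ to $X'$ as above and every $n\ge0$, if no nonzero form of degree $n$ vanishes on $X'_{res}$ and no nonzero form of degree $n+1$ on $H$ vanishes on $X'_{tr}$, then no nonzero form of degree $n+1$ vanishes on $X'$, nor on any but finitely many members of the flat family. -/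

import Mathlib

open MvPolynomial

noncomputable section

namespace Postulation

/-! ### Closed subschemes of projective three-space

A closed subscheme of `ℙ³` over `K` is represented by its saturated homogeneous ideal in the
polynomial ring in four variables. A linear subspace of `ℙ³` is represented by the corresponding
linear subspace of `K⁴`, a set of points by the corresponding cone in `K⁴`. -/

section Schemes

variable {K : Type*} [Field K]

/-- The homogeneous coordinate ring of `ℙ³` over a commutative ring `R`. -/
abbrev Coord (R : Type*) [CommRing R] : Type _ := MvPolynomial (Fin 4) R

/-- The saturation of an ideal with respect to the irrelevant ideal `(x₀, x₁, x₂, x₃)`. -/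
def saturation (I : Ideal (Coord K)) : Ideal (Coord K) where
  carrier := {f | ∀ i : Fin 4, ∃ n : ℕ, X i ^ n * f ∈ I}
  zero_mem' := fun _ => ⟨0, by simp⟩
  add_mem' := by
    intro f g hf hg i
    obtain ⟨m, hm⟩ := hf i
    obtain ⟨n, hn⟩ := hg i
    refine ⟨m + n, ?_⟩
    have e : (X i : Coord K) ^ (m + n) * (f + g) =
        X i ^ n * (X i ^ m * f) + X i ^ m * (X i ^ n * g) := by ring
    rw [e]
    exact I.add_mem (I.mul_mem_left _ hm) (I.mul_mem_left _ hn)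
  smul_mem' := by
    intro a f hf i
    obtain ⟨n, hn⟩ := hf i
    refine ⟨n, ?_⟩
    have e : (X i : Coord K) ^ n * (a • f) = a * (X i ^ n * f) := by
      rw [smul_eq_mul]; ring
    rw [e]
    exact I.mul_mem_left _ hn

/-- The linear form with coefficient vector `η`. -/
def planeForm (η : Fin 4 → K) : Coord K := ∑ i, C (η i) * X i

/-- The plane `H` with equation `planeForm η = 0`. -/
def plane (η : Fin 4 → K) : Submodule K (Fin 4 → K) where
  carrier := {x | ∑ i, η i * x i = 0}
  zero_mem' := by simp
  add_mem' := by
    intro x y hx hy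
    simp only [Set.mem_ofPred_eq, Pi.add_apply, mul_add, Finset.sum_add_distrib] at *
    rw [hx, hy, add_zero]
  smul_mem' := by
    intro a x hx
    simp only [Set.mem_ofPred_eq, Pi.smul_apply, smul_eq_mul] at *
    have e : ∀ i, η i * (a * x i) = a * (η i * x i) := fun i => by ring
    simp only [e, ← Finset.mul_sum, hx, mul_zero]

/-- The trace `Y ∩ H`, as a closed subscheme of `ℙ³` contained in the plane `H`. -/
def trace (η : Fin 4 → K) (I : Ideal (Coord K)) : Ideal (Coord K) :=
  saturation (I ⊔ Ideal.span {planeForm η})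

/-- The residual scheme of `Y` with respect to `H`, given by the ideal quotient `I_Y : I_H`. -/
def residual (η : Fin 4 → K) (I : Ideal (Coord K)) : Ideal (Coord K) :=
  Submodule.colon I {planeForm η}

/-- No nonzero form of degree `n` on `ℙ³` vanishes along the subscheme. -/
def IsEmptySystem (n : ℕ) (I : Ideal (Coord K)) : Prop :=
  ∀ f ∈ I, f.IsHomogeneous n → f = 0

/-- No nonzero form of degree `n` on the plane `H` vanishes along the subscheme of `H`. -/
def IsEmptySystemOn (η : Fin 4 → K) (n : ℕ) (I : Ideal (Coord K)) : Prop :=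
  ∀ f ∈ I, f.IsHomogeneous n → f ∈ Ideal.span {planeForm η}

/-- A flat family of closed subschemes of `ℙ³` over the affine line `Spec K[t]`: a homogeneous
ideal of `K[t][x₀, x₁, x₂, x₃]` such that the subscheme of `ℙ³ × 𝔸¹` it defines is flat over `𝔸¹`.
On the chart `xᵢ ≠ 0` the coordinate ring of that subscheme is the degree zero part `A` of the
localization below; the localization is `A[xᵢ, xᵢ⁻¹]`, so one is flat iff the other is. -/
structure FlatFamily (K : Type*) [Field K] where
  /-- the ideal of the total space -/
  ideal : Ideal (Coord (Polynomial K))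
  homogeneous : ∀ f ∈ ideal, ∀ n : ℕ, homogeneousComponent n f ∈ ideal
  flat : ∀ i : Fin 4, Module.Flat (Polynomial K)
    (Localization.Away (Ideal.Quotient.mk ideal (X i)))

/-- The fibre of a family over the point `t = a` of the affine line. -/
def FlatFamily.fiber (𝓕 : FlatFamily K) (a : K) : Ideal (Coord K) :=
  saturation (𝓕.ideal.map (MvPolynomial.map (Polynomial.evalRingHom a)))

end Schemes

/-! ### Configurations of lines, crosses and sub-stars -/

/-- Labels of the vectors that describe lines indexed by `ι` (two spanning vectors each) and
crosses indexed by `κ` (the vertex, labelled `0`, and one further vector on each of the two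
lines). -/
abbrev Label (ι κ : Type) : Type := (ι × Fin 2) ⊕ (κ × Fin 3)

/-- Lines indexed by `ι` and crosses indexed by `κ`, described by vectors. -/
abbrev Config (R : Type*) (ι κ : Type) : Type _ := Label ι κ → Fin 4 → R

section Config

variable {K : Type*} [Field K] {ι κ : Type}

/-- The `i`-th line of a configuration. -/
def Config.line (Y : Config K ι κ) (i : ι) : Submodule K (Fin 4 → K) :=
  Submodule.span K {Y (.inl (i, 0)), Y (.inl (i, 1))}

/-- The vertex of the `j`-th cross. -/
def Config.vertex (Y : Config K ι κ) (j : κ) : Fin 4 → K := Y (.inr (j, 0))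

/-- The further vector on the `e`-th line of the `j`-th cross. -/
def Config.arm (Y : Config K ι κ) (j : κ) (e : Fin 2) : Fin 4 → K := Y (.inr (j, e.succ))

/-- The `e`-th line of the `j`-th cross. -/
def Config.crossLine (Y : Config K ι κ) (j : κ) (e : Fin 2) : Submodule K (Fin 4 → K) :=
  Submodule.span K {Y.vertex j, Y.arm j e}

/-- The reduced scheme that is the union of the lines and crosses of `Y` and of the points in the
cone `Z`. -/
def Config.scheme (Y : Config K ι κ) (Z : Set (Fin 4 → K)) : Ideal (Coord K) :=
  vanishingIdeal K
    ((⋃ i, (Y.line i : Set (Fin 4 → K))) ∪ (⋃ j, ⋃ e, (Y.crossLine j e : Set (Fin 4 → K))) ∪ Z)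

/-- The cone over the singular points of the configuration of the lines `N`, where for each
`b` the intersection point of the lines `N (o b 0)` and `N (o b 1)` is omitted. -/
def subStar {α β : Type} (N : α → Submodule K (Fin 4 → K)) (o : β → Fin 2 → α) :
    Set (Fin 4 → K) :=
  ⋃ (i : α) (j : α) (_ : i ≠ j)
    (_ : ∀ b, ¬ (o b 0 = i ∧ o b 1 = j) ∧ ¬ (o b 0 = j ∧ o b 1 = i)),
    ((N i ⊓ N j : Submodule K (Fin 4 → K)) : Set (Fin 4 → K))

/-- `Z` is (the cone over) a sub-star `P(A, B)` in the plane `H`: the set of singular points of a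
star configuration of `A` lines in `H` (pairwise distinct, no three through a point), with `B`
points omitted such that every line contains at most one omitted point. -/
def IsSubStar (η : Fin 4 → K) (A B : ℕ) (Z : Set (Fin 4 → K)) : Prop :=
  ∃ (N : Fin A → Submodule K (Fin 4 → K)) (o : Fin B → Fin 2 → Fin A),
    (∀ i, N i ≤ plane η ∧ Module.finrank K (N i) = 2) ∧
    (∀ i j, i ≠ j → N i ≠ N j) ∧
    (∀ i j l, i ≠ j → i ≠ l → j ≠ l → N i ⊓ N j ⊓ N l = ⊥) ∧
    Function.Injective (fun p : Fin B × Fin 2 => o p.1 p.2) ∧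
    Z = subStar N o

/-- The lines and crosses of `Y` and the points of `Z` are non-degenerate and pairwise disjoint,
no line is contained in `H`, and the crosses have their vertices in `H`. -/
structure Config.IsNondegenerate (η : Fin 4 → K) (Y : Config K ι κ) (Z : Set (Fin 4 → K)) :
    Prop where
  line_indep : ∀ i, LinearIndependent K ![Y (.inl (i, 0)), Y (.inl (i, 1))]
  line_not_le : ∀ i, ¬ Y.line i ≤ plane η
  vertex_mem : ∀ j, Y.vertex j ∈ plane η
  cross_indep : ∀ j, LinearIndependent K ![Y.vertex j, Y.arm j 0, Y.arm j 1]
  arm_notMem : ∀ j e, Y.arm j e ∉ plane η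
  line_line : ∀ i i', i ≠ i' → Disjoint (Y.line i) (Y.line i')
  line_cross : ∀ i j e, Disjoint (Y.line i) (Y.crossLine j e)
  cross_cross : ∀ j j' e e', j ≠ j' → Disjoint (Y.crossLine j e) (Y.crossLine j' e')
  line_star : ∀ i, ∀ x ∈ Z, x ∈ Y.line i → x = 0
  cross_star : ∀ j e, ∀ x ∈ Z, x ∈ Y.crossLine j e → x = 0

end Config

/-- The numerical type `(L, C, (A, B))` of a scheme. -/
@[ext] structure BType where
  /-- the number of lines -/
  L : ℕ
  /-- the number of crosses -/
  C : ℕ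
  /-- the number of lines of the star configuration -/
  A : ℕ
  /-- the number of omitted points -/
  B : ℕ

/-- `I` is a scheme `B(L, C, (A, B))`: the union of `L` lines, of `C` crosses with vertices in
`H` and of a sub-star `P(A, B)` in `H`, in non-degenerate position. -/
def IsB {K : Type*} [Field K] (η : Fin 4 → K) (b : BType) (I : Ideal (Coord K)) : Prop :=
  ∃ (Y : Config K (Fin b.L) (Fin b.C)) (Z : Set (Fin 4 → K)),
    IsSubStar η b.A b.B Z ∧ Y.IsNondegenerate η Z ∧ I = Y.scheme Z

/-- The numerical type of the scheme `Y_d` with `d = 3k`. -/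
def yType (k : ℕ) : BType :=
  if Even k then ⟨(k * (k + 5) + 2) / 2, k ^ 2 / 2, k + 1, k / 2⟩
  else ⟨(k * (k + 5) + 4) / 2, (k ^ 2 - 1) / 2, k + 1, (k + 1) / 2⟩

/-! ### Specializations to the plane -/

/-- The parameters of a specialization `S(ℓ, s, h, c)`. -/
structure SpecParams where
  /-- the number of lines specialized to `H` -/
  ℓ : ℕ
  /-- the number of pairs of lines specialized to a sundial with singular point in `H` -/
  s : ℕ
  /-- the number of crosses one line of which is specialized to `H` -/
  h : ℕ
  /-- the number of crosses specialized to `H` -/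
  c : ℕ

namespace SpecParams

variable (q : SpecParams) (b : BType)

/-- There are enough lines and crosses for the specialization. -/
def Fits : Prop := q.ℓ + 2 * q.s ≤ b.L ∧ q.c + q.h ≤ b.C

/-- The type `(L - ℓ + h - 2s, C - c + s - h, (ℓ + 2c + h, c))` of the residual scheme. -/
def next : BType :=
  ⟨b.L - (q.ℓ + 2 * q.s) + q.h, b.C - (q.c + q.h) + q.s, q.ℓ + 2 * q.c + q.h, q.c⟩

/-- Labels of the lines: those specialized to `H`, those specialized in pairs to sundials, and the
remaining ones. -/
abbrev LineIdx : Type := Fin q.ℓ ⊕ (Fin q.s × Fin 2) ⊕ Fin (b.L - (q.ℓ + 2 * q.s))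

/-- Labels of the crosses: those with one line specialized to `H`, those specialized to `H`, and
the remaining ones. -/
abbrev CrossIdx : Type := Fin q.h ⊕ Fin q.c ⊕ Fin (b.C - (q.c + q.h))

/-- Labels of the lines of the specialized configuration that lie in `H`. -/
abbrev TraceIdx : Type := Fin q.ℓ ⊕ Fin q.h ⊕ (Fin q.c × Fin 2)

variable {q b} {K : Type*} [Field K]

/-- The position of the lines and crosses after the specialization: the first `ℓ` lines are in
`H`, the next `s` pairs of lines meet in points of `H`, all crosses have their vertex in `H`, one
line of each of the first `h` crosses is in `H`, and the next `c` crosses are in `H`. -/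
structure IsSpecial (η : Fin 4 → K) (W : Config K (q.LineIdx b) (q.CrossIdx b)) : Prop where
  line_mem : ∀ i e, W (.inl (.inl i, e)) ∈ plane η
  sundial_mem : ∀ j, W (.inl (.inr (.inl (j, 0)), 0)) ∈ plane η
  sundial_eq : ∀ j, W (.inl (.inr (.inl (j, 1)), 0)) = W (.inl (.inr (.inl (j, 0)), 0))
  vertex_mem : ∀ j, W.vertex j ∈ plane η
  half_mem : ∀ j, W.arm (.inl j) 0 ∈ plane η
  cross_mem : ∀ j e, W.arm (.inr (.inl j)) e ∈ plane η

/-- The value of a polynomial in the coordinates of all vectors of a configuration. -/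
def value (F : MvPolynomial (Label (q.LineIdx b) (q.CrossIdx b) × Fin 4) K)
    (W : Config K (q.LineIdx b) (q.CrossIdx b)) : K :=
  MvPolynomial.eval (fun p => W p.1 p.2) F

/-- `F ≠ 0` is a condition of generality on specialized configurations: it defines a non-empty
Zariski open subset of the (irreducible) space of specialized configurations. Every non-empty
Zariski open subset contains one of this form. -/
def IsGenerality (η : Fin 4 → K)
    (F : MvPolynomial (Label (q.LineIdx b) (q.CrossIdx b) × Fin 4) K) : Prop :=
  ∃ W : Config K (q.LineIdx b) (q.CrossIdx b), IsSpecial η W ∧ value F W ≠ 0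

/-- The `ℓ + 2c + h` lines of the specialized configuration that lie in `H`. -/
def traceLine (W : Config K (q.LineIdx b) (q.CrossIdx b)) :
    q.TraceIdx → Submodule K (Fin 4 → K)
  | .inl i => W.line (.inl i)
  | .inr (.inl j) => W.crossLine (.inl j) 0
  | .inr (.inr (j, e)) => W.crossLine (.inr (.inl j)) e

/-- The singular point of the `j`-th sundial. -/
def sundialPoint (W : Config K (q.LineIdx b) (q.CrossIdx b)) (j : Fin q.s) : Fin 4 → K :=
  W (.inl (.inr (.inl (j, 0)), 0))

/-- The ideal of the reduced point given by a vector. -/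
def pointIdeal (v : Fin 4 → K) : Ideal (Coord K) :=
  vanishingIdeal K (Submodule.span K {v} : Set (Fin 4 → K))

/-- The scheme `T(ℓ + 2c + h, s, C - c - h, (A, B), L - ℓ - 2s)` in `H` attached to a specialized
configuration and a sub-star `Z`: the union of the lines in `H`, the double points of `H` at the
singular points of the sundials, the subschemes of `H` of length `2` at the vertices of the
remaining crosses (in the direction of the line in which the plane of the cross meets `H`), the
points of intersection of the remaining lines with `H`, and the sub-star. -/
def traceScheme (η : Fin 4 → K) (W : Config K (q.LineIdx b) (q.CrossIdx b))
    (Z : Set (Fin 4 → K)) : Ideal (Coord K) :=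
  (⨅ i, vanishingIdeal K (traceLine W i : Set (Fin 4 → K))) ⊓
    (⨅ j, (pointIdeal (sundialPoint W j) ^ 2 ⊔ Ideal.span {planeForm η})) ⊓
    (⨅ j, (pointIdeal (W.vertex (.inr (.inr j))) ^ 2 ⊔
      vanishingIdeal K ((Submodule.span K {W.vertex (.inr (.inr j)), W.arm (.inr (.inr j)) 0,
        W.arm (.inr (.inr j)) 1} ⊓ plane η : Submodule K (Fin 4 → K)) : Set (Fin 4 → K)))) ⊓
    (⨅ i, vanishingIdeal K ((W.line (.inr (.inr i)) ⊓ plane η : Submodule K (Fin 4 → K)) :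
      Set (Fin 4 → K))) ⊓
    vanishingIdeal K Z

/-- The lines and crosses of the residual scheme: the remaining lines, the second lines of the
crosses that were specialized to half, the crosses of the sundials, and the remaining crosses. -/
def resConfig (W : Config K (q.LineIdx b) (q.CrossIdx b)) :
    Config K (Fin (b.L - (q.ℓ + 2 * q.s)) ⊕ Fin q.h) (Fin (b.C - (q.c + q.h)) ⊕ Fin q.s)
  | .inl (.inl i, e) => W (.inl (.inr (.inr i), e))
  | .inl (.inr j, e) => ![W.vertex (.inl j), W.arm (.inl j) 1] e
  | .inr (.inl j, e) => W (.inr (.inr (.inr j), e))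
  | .inr (.inr j, e) => ![sundialPoint W j, W (.inl (.inr (.inl (j, 0)), 1)),
      W (.inl (.inr (.inl (j, 1)), 1))] e

/-- The points of the residual scheme: the intersection points of the lines in `H`, except for the
vertices of the crosses in `H`. -/
def resStar (W : Config K (q.LineIdx b) (q.CrossIdx b)) : Set (Fin 4 → K) :=
  subStar (traceLine W) (fun (j : Fin q.c) (e : Fin 2) => .inr (.inr (j, e)))

/-- `X'` denotes the fibre of `𝓕` at `t = 0`. The flat family `𝓕` is a specialization
`S(ℓ, s, h, c)` of the scheme `X` of type `b` to `X'`, and `X₁` is the residual scheme of `X'`.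

The fibre at `t = 1` is `X`; all but finitely many fibres are schemes of type `b` with the same
sub-star `Z`, and their lines and crosses are given by vectors that are polynomials in `t`; for
`t = 0` these vectors give lines and crosses in special position, satisfying the condition of
generality `F ≠ 0`. The trace and the residual scheme of `X'` are as prescribed, and the residual
scheme is again a scheme `B(L, C, (A, B))`. -/
def IsSpecialization (η : Fin 4 → K) (b : BType) (q : SpecParams)
    (F : MvPolynomial (Label (q.LineIdx b) (q.CrossIdx b) × Fin 4) K)
    (X : Ideal (Coord K)) (𝓕 : FlatFamily K) (X₁ : Ideal (Coord K)) : Prop :=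
  ∃ (Γ : Config (Polynomial K) (q.LineIdx b) (q.CrossIdx b))
    (Y W : Config K (q.LineIdx b) (q.CrossIdx b)) (Z : Set (Fin 4 → K)),
    (Y = fun p i => (Γ p i).eval 1) ∧
    (W = fun p i => (Γ p i).eval 0) ∧
    IsSubStar η b.A b.B Z ∧
    Y.IsNondegenerate η Z ∧
    X = Y.scheme Z ∧
    𝓕.fiber 1 = X ∧
    {a : K | ¬ (Config.IsNondegenerate η (fun p i => (Γ p i).eval a) Z ∧
      𝓕.fiber a = Config.scheme (fun p i => (Γ p i).eval a) Z)}.Finite ∧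
    IsSpecial η W ∧
    value F W ≠ 0 ∧
    trace η (𝓕.fiber 0) = traceScheme η W Z ∧
    X₁ = residual η (𝓕.fiber 0) ∧
    X₁ = (resConfig W).scheme (resStar W) ∧
    IsB η (q.next b) X₁

end SpecParams

/-- The scheme `X` of type `b` admits a sequence of specializations with the given parameters
`S(ℓ, s, h, c)`, each followed by taking the residual scheme, that ends in a scheme of type `b'`.
At every step the specialization exists for every condition of generality, which may depend on
all the previous choices. -/
def ReducesTo {K : Type*} [Field K] (η : Fin 4 → K) (b' : BType) :
    List SpecParams → BType → Ideal (Coord K) → Prop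
  | [], b, X => b = b' ∧ IsB η b X
  | q :: qs, b, X => q.Fits b ∧ IsB η b X ∧
      ∀ F : MvPolynomial (Label (q.LineIdx b) (q.CrossIdx b) × Fin 4) K,
        SpecParams.IsGenerality η F →
          ∃ (𝓕 : FlatFamily K) (X₁ : Ideal (Coord K)),
            SpecParams.IsSpecialization η b q F X 𝓕 X₁ ∧ ReducesTo η b' qs (q.next b) X₁

end Postulation

end

/-! All specializations are linear. A scheme X is described by a system of vectors Y; a special
system W is chosen in the linear space of systems satisfying the incidence conditions; the family is
the closure over the affine line of the schemes of W + t(Y - W). Its ideal consists of the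
polynomials over K[t] all of whose fibres vanish on the moving scheme (`familyIdeal`). It is stable
under division by nonzero elements of K[t], so the quotient is torsion free, hence flat. What
remains is the fibre at t = 0, which is controlled from two sides.

Lower bound for its ideal: each line and each cross deforms separately, because a linear form
vanishing on one fibre of a family of independent vectors extends to the family. So the ideal of the
limit contains the product of the ideals of the components of W (`prod_compIdeal_le`). Upper bound:
its elements vanish on all of W, and where two components meet at p, two points moving into p
separate with a velocity d; if d and the two lines span everything, every element is singular at p
(`flatDirs_segment_eq_top`). This happens at the singular points of the sundials and at the
intersections of lines in H from different components. The two lines of a cross move together, so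
its vertex yields no such condition. On H the sundials leave double points; dividing by the equation
of H turns them into crosses, and leaves a reduced point at each of the intersections of lines in H.
The inclusions `trace_le`, `le_trace`, `residual_le`, `le_residual` check this, the lower ones
locally at every point.

The position required of W (`SpecParams.IsGood`) is a finite list of open conditions, each shown
non-empty by one example; on a linear space over an infinite field they hold simultaneously,
together with any prescribed condition of generality. Hence every list of parameters that fits
numerically is realised, and the first two statements reduce to arithmetic of types
(`exists_chainFits`).

For the third statement, a form vanishing on the limit vanishes on its trace, so it is divisible by
the equation of H, and the quotient vanishes on the residual scheme. It passes to the other fibres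
by semicontinuity. If infinitely many fibres lay on surfaces of degree n + 1, linear algebra over
K[t] would give one form over K[t], which may be assumed nonzero at t = 0. An arbitrary flat family
with these general fibres contains its value in the ideal at 0, by Nakayama in large degrees and
torsion-freeness (`FlatFamily.specialize_mem_fiber`). -/

namespace Postulation

noncomputable section

/-! ### Ideals of linear subspaces, first order conditions at a point, saturation. -/

section Linear

variable {K : Type*} [Field K]

/-- The ideal of the linear subspace `U`. -/
def linIdeal (U : Submodule K (Fin 4 → K)) : Ideal (Coord K) :=
  vanishingIdeal K (U : Set (Fin 4 → K))

theorem mem_linIdeal {U : Submodule K (Fin 4 → K)} {f : Coord K} :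
    f ∈ linIdeal U ↔ ∀ x ∈ U, eval x f = 0 := by
  simp [linIdeal, mem_vanishingIdeal_iff, aeval_eq_eval]

theorem linIdeal_anti {U V : Submodule K (Fin 4 → K)} (h : U ≤ V) : linIdeal V ≤ linIdeal U :=
  vanishingIdeal_anti_mono h

@[simp] theorem eval_planeForm (ξ x : Fin 4 → K) : eval x (planeForm ξ) = ∑ i, ξ i * x i := by
  simp [planeForm]

theorem planeForm_smul (c : K) (ξ : Fin 4 → K) : planeForm (c • ξ) = C c * planeForm ξ := by
  simp [planeForm, Finset.mul_sum, mul_assoc]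

theorem mem_plane {η x : Fin 4 → K} : x ∈ plane η ↔ ∑ i, η i * x i = 0 := Iff.rfl

theorem planeForm_mem_linIdeal {U : Submodule K (Fin 4 → K)} {ξ : Fin 4 → K} :
    planeForm ξ ∈ linIdeal U ↔ ∀ x ∈ U, ∑ i, ξ i * x i = 0 := by
  simp [mem_linIdeal]

/-- The coordinates of a linear map, as a linear form. -/
def rowVec (Q : (Fin 4 → K) →ₗ[K] (Fin 4 → K)) (i : Fin 4) : Fin 4 → K :=
  fun j => Q (Pi.single j 1) i

theorem rowVec_dot (Q : (Fin 4 → K) →ₗ[K] (Fin 4 → K)) (i : Fin 4) (x : Fin 4 → K) :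
    ∑ j, rowVec Q i j * x j = Q x i := by
  conv_rhs => rw [← Finset.univ_sum_single x, map_sum, Finset.sum_apply]
  refine Finset.sum_congr rfl fun j _ => ?_
  have : Pi.single j (x j) = x j • (Pi.single j 1 : Fin 4 → K) := by
    rw [← Pi.single_smul, smul_eq_mul, mul_one]
  rw [this, map_smul, Pi.smul_apply, smul_eq_mul, mul_comm, rowVec]

/-- Composition of a polynomial with a linear map. -/
def linComp (Q : (Fin 4 → K) →ₗ[K] (Fin 4 → K)) : Coord K →ₐ[K] Coord K :=
  aeval fun i => planeForm (rowVec Q i)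

theorem eval_linComp (Q : (Fin 4 → K) →ₗ[K] (Fin 4 → K)) (x : Fin 4 → K) (f : Coord K) :
    eval x (linComp Q f) = eval (Q x) f := by
  have : (aeval x).comp (linComp Q) = aeval (R := K) (Q x) := by
    refine MvPolynomial.algHom_ext fun i => ?_
    simp [linComp, aeval_eq_eval, rowVec_dot]
  simpa [aeval_eq_eval] using DFunLike.congr_fun this f

/-- A polynomial changes by an element of the ideal of the fixed space under composition with a
linear map. -/
theorem sub_linComp_mem {U : Submodule K (Fin 4 → K)} {Q : (Fin 4 → K) →ₗ[K] (Fin 4 → K)}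
    (hQ : ∀ x ∈ U, Q x = x) (f : Coord K) : f - linComp Q f ∈ linIdeal U := by
  rw [mem_linIdeal]
  intro x hx
  rw [map_sub, eval_linComp, hQ x hx, sub_self]

theorem linComp_mem {U V : Submodule K (Fin 4 → K)} {Q : (Fin 4 → K) →ₗ[K] (Fin 4 → K)}
    (hQ : ∀ x ∈ U, Q x ∈ V) {f : Coord K} (hf : f ∈ linIdeal V) : linComp Q f ∈ linIdeal U := by
  rw [mem_linIdeal] at *
  intro x hx
  rw [eval_linComp, hf _ (hQ x hx)]

/-- A complement A of U ⊓ V in U is disjoint from V, so V has a complement containing A. The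
projection onto V along it kills A and fixes U ⊓ V, hence respects U. Substituting this projection
into polynomials is the tool for splitting ideals of linear subspaces. -/
theorem exists_projection_of_two (U V : Submodule K (Fin 4 → K)) :
    ∃ Q : (Fin 4 → K) →ₗ[K] (Fin 4 → K),
      (∀ x ∈ V, Q x = x) ∧ (∀ x, Q x ∈ V) ∧ ∀ x ∈ U, Q x ∈ U := by
  obtain ⟨A, hA, hAU⟩ := IsModularLattice.exists_disjoint_and_sup_eq (inf_le_left : U ⊓ V ≤ U)
  have hAV : Disjoint A V := by
    rw [disjoint_iff_inf_le] at hA ⊢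
    have : A ≤ U := hAU ▸ le_sup_right
    exact (le_inf (le_inf (inf_le_left.trans this) inf_le_right) inf_le_left).trans hA
  obtain ⟨B, hAB, hB⟩ := hAV.exists_isCompl
  refine ⟨V.subtype ∘ₗ V.projectionOnto B hB.symm, fun x hx => ?_, fun x => by simp,
    fun x hx => ?_⟩
  · exact congrArg Subtype.val (Submodule.projectionOnto_apply_left hB.symm ⟨x, hx⟩)
  · rw [← hAU] at hx
    obtain ⟨d, hd, a, ha, rfl⟩ := Submodule.mem_sup.1 hx
    have h1 : V.projectionOnto B hB.symm a = 0 :=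
      (Submodule.projectionOnto_apply_eq_zero_iff hB.symm).2 (hAB ha)
    have h2 : V.projectionOnto B hB.symm d = ⟨d, hd.2⟩ :=
      Submodule.projectionOnto_apply_left hB.symm ⟨d, hd.2⟩
    simpa [h1, h2] using hd.1

theorem exists_projection (U : Submodule K (Fin 4 → K)) :
    ∃ Q : (Fin 4 → K) →ₗ[K] (Fin 4 → K), (∀ x ∈ U, Q x = x) ∧ ∀ x, Q x ∈ U := by
  obtain ⟨Q, h, h', -⟩ := exists_projection_of_two U U
  exact ⟨Q, h, h'⟩

/-- Write f = f∘Q + (f - f∘Q) with Q a projection onto V preserving U: the first term vanishes on U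
because Q maps U into U ⊓ V, the second on V. Geometrically, the scheme-theoretic intersection of
linear subspaces is reduced. -/
theorem linIdeal_inf_le (U V : Submodule K (Fin 4 → K)) :
    linIdeal (U ⊓ V) ≤ linIdeal U ⊔ linIdeal V := by
  obtain ⟨Q, hQ, hQV, hQU⟩ := exists_projection_of_two U V
  intro f hf
  rw [← add_sub_cancel (linComp Q f) f]
  exact Ideal.add_mem _ (Ideal.mem_sup_left
    (linComp_mem (V := U ⊓ V) (fun x hx => ⟨hQU x hx, hQV x⟩) hf))
    (Ideal.mem_sup_right (sub_linComp_mem hQ f))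

/-! ### Directional derivatives -/

/-- The derivative of `f` at `x` in the direction `h`. -/
def dirDeriv (x h : Fin 4 → K) (f : Coord K) : K := ∑ i, h i * eval x (pderiv i f)

theorem dirDeriv_add (x h : Fin 4 → K) (f g : Coord K) :
    dirDeriv x h (f + g) = dirDeriv x h f + dirDeriv x h g := by
  simp [dirDeriv, mul_add, Finset.sum_add_distrib]

theorem dirDeriv_mul (x h : Fin 4 → K) (f g : Coord K) :
    dirDeriv x h (f * g) = eval x f * dirDeriv x h g + eval x g * dirDeriv x h f := by
  simp only [dirDeriv, Finset.mul_sum, ← Finset.sum_add_distrib]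
  refine Finset.sum_congr rfl fun i _ => ?_
  simp [Derivation.leibniz]
  ring

theorem dirDeriv_planeForm (x h ξ : Fin 4 → K) :
    dirDeriv x h (planeForm ξ) = ∑ i, ξ i * h i := by
  simp [dirDeriv, planeForm, pderiv_X, Pi.single_apply, mul_comm]

theorem dirDeriv_vec_add (x h k : Fin 4 → K) (f : Coord K) :
    dirDeriv x (h + k) f = dirDeriv x h f + dirDeriv x k f := by
  simp [dirDeriv, add_mul, Finset.sum_add_distrib]

theorem dirDeriv_vec_smul (x h : Fin 4 → K) (c : K) (f : Coord K) :
    dirDeriv x (c • h) f = c * dirDeriv x h f := by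
  simp [dirDeriv, mul_assoc, Finset.mul_sum]

/-- The directions along which the derivative of `f` at `x` vanishes. -/
def flatDirs (x : Fin 4 → K) (f : Coord K) : Submodule K (Fin 4 → K) where
  carrier := {h | dirDeriv x h f = 0}
  zero_mem' := by simp [dirDeriv]
  add_mem' := by
    intro h k hh hk
    simp only [Set.mem_ofPred_eq] at *
    rw [dirDeriv_vec_add, hh, hk, add_zero]
  smul_mem' := by
    intro c h hh
    simp only [Set.mem_ofPred_eq] at *
    rw [dirDeriv_vec_smul, hh, mul_zero]

theorem mem_flatDirs {x h : Fin 4 → K} {f : Coord K} :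
    h ∈ flatDirs x f ↔ dirDeriv x h f = 0 := Iff.rfl

/-- The polynomial `x ↦ dirDeriv (P x) (Q x) f`. -/
def formDeriv (P Q : (Fin 4 → K) →ₗ[K] (Fin 4 → K)) (f : Coord K) : Coord K :=
  ∑ i, linComp Q (X i) * linComp P (pderiv i f)

theorem eval_formDeriv (P Q : (Fin 4 → K) →ₗ[K] (Fin 4 → K)) (f : Coord K) (x : Fin 4 → K) :
    eval x (formDeriv P Q f) = dirDeriv (P x) (Q x) f := by
  simp [formDeriv, dirDeriv, eval_linComp]

theorem linIdeal_span_singleton (p : Fin 4 → K) :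
    linIdeal (Submodule.span K {p}) = SpecParams.pointIdeal p := rfl

theorem eval_aeval_polynomial {σ : Type*} (g : σ → Polynomial K) (f : MvPolynomial σ K) (τ : K) :
    (aeval g f).eval τ = eval (fun i => (g i).eval τ) f := by
  rw [← Polynomial.coe_evalRingHom, aeval_def, hom_eval₂, eval₂_eq_eval_map]
  have : (Polynomial.evalRingHom τ).comp (algebraMap K (Polynomial K)) = RingHom.id K := by
    ext; simp
  rw [this, map_id]

theorem flatDirs_mul {x : Fin 4 → K} {f g : Coord K} (hf : eval x f = 0) (hg : eval x g = 0) :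
    flatDirs x (f * g) = ⊤ := by
  refine eq_top_iff.2 fun h _ => ?_
  rw [mem_flatDirs, dirDeriv_mul, hf, hg]
  simp

/-- Conditions of first order are local: a factor that is nonzero at x may be cancelled. -/
theorem flatDirs_le_of_mul {x : Fin 4 → K} {s f : Coord K} (hs : eval x s ≠ 0)
    (h0 : eval x (s * f) = 0) : eval x f = 0 ∧ flatDirs x (s * f) ≤ flatDirs x f := by
  rw [map_mul] at h0
  have hf := (mul_eq_zero.1 h0).resolve_left hs
  refine ⟨hf, fun h hh => ?_⟩
  rw [mem_flatDirs, dirDeriv_mul, hf, zero_mul, add_zero] at hh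
  exact mem_flatDirs.2 ((mul_eq_zero.1 hh).resolve_left hs)

theorem le_saturation (I : Ideal (Coord K)) : I ≤ saturation I :=
  fun _ hf _ => ⟨0, by simpa using hf⟩

theorem saturation_mono {I J : Ideal (Coord K)} (h : I ≤ J) : saturation I ≤ saturation J :=
  fun _ hf i => (hf i).imp fun _ hn => h hn

theorem exists_eval_ne_zero_of_mem_saturation {I : Ideal (Coord K)} {f : Coord K}
    (hf : f ∈ saturation I) {x : Fin 4 → K} (hx : x ≠ 0) :
    ∃ s, eval x s ≠ 0 ∧ s * f ∈ I := by
  obtain ⟨i, hi⟩ := Function.ne_iff.1 hx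
  obtain ⟨n, hn⟩ := hf i
  exact ⟨X i ^ n, by simpa using fun h => absurd h hi, hn⟩

/-- Membership in the saturation can be checked locally at the points of projective space. -/
theorem mem_saturation_of_local [IsAlgClosed K] {J : Ideal (Coord K)} {f : Coord K}
    (h : ∀ x : Fin 4 → K, x ≠ 0 → ∃ s, eval x s ≠ 0 ∧ s * f ∈ J) : f ∈ saturation J := by
  intro i
  -- The conductor of f into J has no zero with nonzero i-th coordinate, so the Nullstellensatz puts
  -- a power of X i into it.
  have hi : (X i : Coord K) ∈ (Submodule.colon J {f}).radical := by
    rw [← vanishingIdeal_zeroLocus_eq_radical (K := K), mem_vanishingIdeal_iff]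
    intro x hx
    by_contra hxi
    obtain ⟨s, hs, hsf⟩ := h x (by rintro rfl; simp at hxi)
    exact hs (by simpa [aeval_eq_eval] using
      mem_zeroLocus_iff.1 hx s (Submodule.mem_colon_singleton.2 hsf))
  obtain ⟨n, hn⟩ := hi
  exact ⟨n, by simpa using Submodule.mem_colon_singleton.1 hn⟩

variable [Infinite K]

theorem linComp_eq_zero {Q : (Fin 4 → K) →ₗ[K] (Fin 4 → K)} {f : Coord K}
    (h : ∀ x, eval (Q x) f = 0) : linComp Q f = 0 :=
  MvPolynomial.funext fun x => by rw [eval_linComp, h, map_zero]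

/-- The ideal of a linear subspace is generated by linear forms. -/
theorem linIdeal_eq_span (U : Submodule K (Fin 4 → K)) :
    linIdeal U = Ideal.span (planeForm '' {ξ | ∀ x ∈ U, ∑ i, ξ i * x i = 0}) := by
  refine le_antisymm (fun f hf => ?_) (Ideal.span_le.2 ?_)
  · obtain ⟨Q, hQ, hQU⟩ := exists_projection U
    set 𝔞 := Ideal.span (planeForm '' {ξ | ∀ x ∈ U, ∑ i, ξ i * x i = 0}) with h𝔞
    -- Modulo the linear forms vanishing on U, substituting the projection Q changes nothing, since
    -- it changes each variable by such a form. But f∘Q is the zero polynomial.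
    have key : (Ideal.Quotient.mkₐ K 𝔞).comp (linComp Q) = Ideal.Quotient.mkₐ K 𝔞 := by
      refine MvPolynomial.algHom_ext fun i => ?_
      simp only [AlgHom.comp_apply, Ideal.Quotient.mkₐ_eq_mk]
      refine (Ideal.Quotient.eq).2 ?_
      have : linComp Q (X i) - X i = planeForm (rowVec Q i - Pi.single i 1) := by
        refine MvPolynomial.funext fun x => ?_
        simp [linComp, sub_mul, Finset.sum_sub_distrib, Pi.single_apply]
      rw [this]
      refine Ideal.subset_span ⟨_, fun x hx => ?_, rfl⟩
      simp [sub_mul, Finset.sum_sub_distrib, rowVec_dot, Pi.single_apply, hQ x hx]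
    have h0 : linComp Q f = 0 := linComp_eq_zero fun x => mem_linIdeal.1 hf _ (hQU x)
    have := DFunLike.congr_fun key f
    simp only [AlgHom.comp_apply, h0, map_zero, Ideal.Quotient.mkₐ_eq_mk] at this
    exact Ideal.Quotient.eq_zero_iff_mem.1 this.symm
  · rintro _ ⟨ξ, hξ, rfl⟩
    exact planeForm_mem_linIdeal.2 hξ

theorem linIdeal_induction {U : Submodule K (Fin 4 → K)} {p : Coord K → Prop}
    (form : ∀ ξ : Fin 4 → K, (∀ x ∈ U, ∑ i, ξ i * x i = 0) → p (planeForm ξ)) (zero : p 0)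
    (add : ∀ f g, f ∈ linIdeal U → g ∈ linIdeal U → p f → p g → p (f + g))
    (mul : ∀ r f, f ∈ linIdeal U → p f → p (r * f)) {f : Coord K} (hf : f ∈ linIdeal U) : p f := by
  have hf' := hf
  rw [linIdeal_eq_span] at hf'
  refine Submodule.span_induction (p := fun f _ => p f) ?_ zero ?_ ?_ hf'
  · rintro _ ⟨ξ, hξ, rfl⟩
    exact form ξ hξ
  · intro f g hf hg
    exact add f g (by rw [linIdeal_eq_span]; exact hf) (by rw [linIdeal_eq_span]; exact hg)
  · intro r f hf
    exact mul r f (by rw [linIdeal_eq_span]; exact hf)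

/-- With Q a projection onto V preserving U, f∘Q = 0 for f in I(V), so f = f - f∘Q. This difference
vanishes on U ⊔ V when f is a linear form of I(U), and the Leibniz-type expansion for r * f adds
only elements of I(U) * I(V). -/
theorem inf_linIdeal_le (U V : Submodule K (Fin 4 → K)) :
    linIdeal U ⊓ linIdeal V ≤ linIdeal (U ⊔ V) ⊔ linIdeal U * linIdeal V := by
  obtain ⟨Q, hQ, hQV, hQU⟩ := exists_projection_of_two U V
  rintro f ⟨hf, hfV⟩
  have h0 : linComp Q f = 0 := linComp_eq_zero fun x => mem_linIdeal.1 hfV _ (hQV x)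
  rw [← sub_zero f, ← h0]
  refine linIdeal_induction (p := fun f => f - linComp Q f ∈ _) (fun ξ hξ => ?_) (by simp)
    (fun f g _ _ hf hg => ?_) (fun r f hfU hf => ?_) hf
  · refine Ideal.mem_sup_left (mem_linIdeal.2 fun x hx => ?_)
    obtain ⟨y, hy, z, hz, rfl⟩ := Submodule.mem_sup.1 hx
    rw [map_sub, eval_linComp, map_add Q, hQ z hz, eval_planeForm, eval_planeForm]
    simp only [Pi.add_apply, mul_add, Finset.sum_add_distrib, hξ y hy, hξ _ (hQU y hy)]
    ring
  · rw [map_add, add_sub_add_comm]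
    exact Ideal.add_mem _ hf hg
  · have e : r * f - linComp Q (r * f) =
        r * (f - linComp Q f) + linComp Q f * (r - linComp Q r) := by
      rw [map_mul]; ring
    rw [e]
    exact Ideal.add_mem _ (Ideal.mul_mem_left _ _ hf) (Ideal.mem_sup_right
      (Ideal.mul_mem_mul (linComp_mem hQU hfU) (sub_linComp_mem hQ r)))

theorem linIdeal_plane {η : Fin 4 → K} (hη : η ≠ 0) :
    linIdeal (plane η) = Ideal.span {planeForm η} := by
  obtain ⟨i, hi⟩ := Function.ne_iff.1 hη
  simp only [Pi.zero_apply] at hi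
  refine le_antisymm ?_ ?_
  · rw [linIdeal_eq_span, Ideal.span_le]
    rintro _ ⟨ξ, hξ, rfl⟩
    have hj : ∀ j, ξ j = ξ i / η i * η j := by
      intro j
      have h := hξ (η i • Pi.single j 1 - η j • Pi.single i 1) (by
        rw [mem_plane]
        simp [mul_sub, Finset.sum_sub_distrib, Pi.single_apply, mul_comm])
      simp [mul_sub, Finset.sum_sub_distrib, Pi.single_apply] at h
      field_simp
      linear_combination h
    have : ξ = (ξ i / η i) • η := by
      ext j
      simpa using hj j
    rw [this, planeForm_smul]
    exact Ideal.mul_mem_left _ _ (Ideal.subset_span rfl)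
  · rw [Ideal.span_singleton_le_iff_mem, planeForm_mem_linIdeal]
    exact fun x hx => hx

theorem le_flatDirs {U : Submodule K (Fin 4 → K)} {f : Coord K} (hf : f ∈ linIdeal U)
    {x : Fin 4 → K} (hx : x ∈ U) : U ≤ flatDirs x f := by
  intro h hh
  rw [mem_flatDirs]
  refine linIdeal_induction (p := fun f => dirDeriv x h f = 0) (fun ξ hξ => ?_) ?_
    (fun f g _ _ hf hg => ?_) (fun r f hfU hf => ?_) hf
  · rw [dirDeriv_planeForm, hξ h hh]
  · simp [dirDeriv]
  · rw [dirDeriv_add, hf, hg, add_zero]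
  · rw [dirDeriv_mul, hf, mem_linIdeal.1 hfU x hx, mul_zero, zero_mul, add_zero]

/-- The origin imposes no condition of its own: on the line through a nonzero y in U the polynomial
vanishes off 0, hence also at 0, K being infinite. -/
theorem mem_linIdeal_of_ne_zero {U : Submodule K (Fin 4 → K)} (hU : U ≠ ⊥) {f : Coord K}
    (hf : ∀ x ∈ U, x ≠ 0 → eval x f = 0) : f ∈ linIdeal U := by
  rw [mem_linIdeal]
  intro x hx
  by_cases hx0 : x = 0
  · obtain ⟨y, hy, hy0⟩ := Submodule.exists_mem_ne_zero_of_ne_bot hU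
    set g : Polynomial K := aeval (fun i => Polynomial.C (y i) * Polynomial.X) f with hg
    have heval : ∀ τ, g.eval τ = eval (τ • y) f := by
      intro τ
      rw [hg, eval_aeval_polynomial]
      congr 2
      funext i
      rw [Polynomial.eval_mul, Polynomial.eval_C, Polynomial.eval_X, Pi.smul_apply, smul_eq_mul,
        mul_comm]
    have h0 : Polynomial.X * g = 0 := by
      refine Polynomial.funext fun τ => ?_
      rcases eq_or_ne τ 0 with rfl | hτ
      · simp
      · rw [Polynomial.eval_mul, heval, hf _ (U.smul_mem _ hy) (smul_ne_zero hτ hy0)]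
        simp
    have hg0 : g = 0 := (mul_eq_zero.1 h0).resolve_left Polynomial.X_ne_zero
    rw [hx0, ← zero_smul K y, ← heval, hg0, Polynomial.eval_zero]
  · exact hf x hx hx0

/-- A polynomial that vanishes at all nonzero points of a cone over a projective point to first
order along `U` lies in `𝔪² + I(U)`. -/
theorem mem_pointIdeal_sq_sup {p : Fin 4 → K} {U : Submodule K (Fin 4 → K)} (hp : p ∈ U)
    (hp0 : p ≠ 0) {f : Coord K}
    (hf : ∀ x ∈ Submodule.span K {p}, x ≠ 0 → eval x f = 0)
    (hd : ∀ x ∈ Submodule.span K {p}, x ≠ 0 → U ≤ flatDirs x f) :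
    f ∈ SpecParams.pointIdeal p ^ 2 ⊔ linIdeal U := by
  have hf' := mem_linIdeal_of_ne_zero (by simpa using hp0) hf
  obtain ⟨P, hP, hP'⟩ := exists_projection (Submodule.span K {p})
  obtain ⟨Q, hQ, hQ'⟩ := exists_projection U
  have hpU : Submodule.span K {p} ≤ U := by simpa using hp
  -- The derivative is known to vanish only at nonzero points of the line of p. Multiplying by a
  -- coordinate of P x, which kills the exceptional x, gives a zero product of polynomials with a
  -- nonzero first factor.
  have h0 : formDeriv P Q f = 0 := by
    obtain ⟨i, hi⟩ := Function.ne_iff.1 hp0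
    have h : linComp P (X i) * formDeriv P Q f = 0 := by
      refine MvPolynomial.funext fun x => ?_
      rw [map_mul, eval_formDeriv, eval_linComp, eval_X, map_zero]
      by_cases hx : P x = 0
      · simp [hx]
      · rw [mem_flatDirs.1 (hd _ (hP' x) hx (hQ' x)), mul_zero]
    refine (mul_eq_zero.1 h).resolve_left fun h => hi ?_
    have := congrArg (eval p) h
    rwa [eval_linComp, hP p (Submodule.mem_span_singleton_self p), eval_X, map_zero] at this
  -- Subtracting the zero polynomial `formDeriv P Q f` makes induction over linear generators
  -- possible: a form ξ becomes ξ - ξ∘Q, which vanishes on U, and the correction for r * f is a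
  -- product of two elements of the point ideal.
  rw [← sub_zero f, ← h0]
  have hle : SpecParams.pointIdeal p ^ 2 ⊔ linIdeal U ≤ linIdeal (Submodule.span K {p}) :=
    sup_le (Ideal.pow_le_self two_ne_zero) (linIdeal_anti hpU)
  refine linIdeal_induction (p := fun f => f - formDeriv P Q f ∈ _) (fun ξ hξ => ?_)
    (by simp [formDeriv]) (fun f g _ _ hf hg => ?_) (fun r f hfU hf => ?_) hf'
  · refine Ideal.mem_sup_right (mem_linIdeal.2 fun x hx => ?_)
    rw [map_sub, eval_formDeriv, dirDeriv_planeForm, hQ x hx, eval_planeForm, sub_self]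
  · have : formDeriv P Q (f + g) = formDeriv P Q f + formDeriv P Q g := by
      simp [formDeriv, mul_add, Finset.sum_add_distrib]
    rw [this, add_sub_add_comm]
    exact Ideal.add_mem _ hf hg
  · have hfP : linComp P f = 0 := linComp_eq_zero fun x => mem_linIdeal.1 hfU _ (hP' x)
    have e1 : formDeriv P Q (r * f) = linComp P r * formDeriv P Q f := by
      refine MvPolynomial.funext fun x => ?_
      rw [map_mul, eval_formDeriv, eval_formDeriv, dirDeriv_mul, eval_linComp,
        mem_linIdeal.1 hfU _ (hP' x), zero_mul, add_zero]
    have e : r * f - formDeriv P Q (r * f) =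
        r * (f - formDeriv P Q f) + (r - linComp P r) * formDeriv P Q f := by
      rw [e1]; ring
    have h1 : formDeriv P Q f ∈ linIdeal (Submodule.span K {p}) := by
      rw [← sub_sub_cancel f (formDeriv P Q f)]
      exact Ideal.sub_mem _ hfU (hle hf)
    rw [e]
    refine Ideal.add_mem _ (Ideal.mul_mem_left _ _ hf) (Ideal.mem_sup_left ?_)
    rw [pow_two]
    exact Ideal.mul_mem_mul (sub_linComp_mem hP r) h1

/-- The converse of `mem_pointIdeal_sq_sup`. -/
theorem le_flatDirs_of_mem {p : Fin 4 → K} {U : Submodule K (Fin 4 → K)} (hp : p ∈ U)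
    {f : Coord K} (hf : f ∈ SpecParams.pointIdeal p ^ 2 ⊔ linIdeal U) {x : Fin 4 → K}
    (hx : x ∈ Submodule.span K {p}) : eval x f = 0 ∧ U ≤ flatDirs x f := by
  have hpU : Submodule.span K {p} ≤ U := by simpa using hp
  have hle : SpecParams.pointIdeal p ^ 2 ⊔ linIdeal U ≤ linIdeal (Submodule.span K {p}) :=
    sup_le (Ideal.pow_le_self two_ne_zero) (linIdeal_anti hpU)
  refine ⟨mem_linIdeal.1 (hle hf) x hx, fun h hh => ?_⟩
  obtain ⟨a, ha, b, hb, rfl⟩ := Submodule.mem_sup.1 hf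
  rw [mem_flatDirs, dirDeriv_add, mem_flatDirs.1 (le_flatDirs hb (hpU hx) hh), add_zero]
  rw [pow_two] at ha
  refine Submodule.mul_induction_on ha (fun f hf g hg => ?_) (fun f g hf hg => ?_)
  · exact mem_flatDirs.1 (flatDirs_mul (mem_linIdeal.1 hf x hx) (mem_linIdeal.1 hg x hx) ▸ trivial)
  · rw [dirDeriv_add, hf, hg, add_zero]

/-! ### Saturation -/

theorem saturation_linIdeal_le {U : Submodule K (Fin 4 → K)} (hU : U ≠ ⊥) :
    saturation (linIdeal U) ≤ linIdeal U := by
  intro f hf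
  refine mem_linIdeal_of_ne_zero hU fun x hx hx0 => ?_
  obtain ⟨s, hs, hsf⟩ := exists_eval_ne_zero_of_mem_saturation hf hx0
  have := mem_linIdeal.1 hsf x hx
  rw [map_mul] at this
  exact (mul_eq_zero.1 this).resolve_left hs

/-- The ideal is characterised by values and derivatives at the nonzero points of the line of p, and
these conditions ignore multipliers that do not vanish there. -/
theorem saturation_pointIdeal_sq_sup_le {p : Fin 4 → K} {U : Submodule K (Fin 4 → K)}
    (hp : p ∈ U) (hp0 : p ≠ 0) :
    saturation (SpecParams.pointIdeal p ^ 2 ⊔ linIdeal U) ≤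
      SpecParams.pointIdeal p ^ 2 ⊔ linIdeal U := by
  intro f hf
  have key : ∀ x ∈ Submodule.span K {p}, x ≠ 0 → eval x f = 0 ∧ U ≤ flatDirs x f := by
    intro x hx hx0
    obtain ⟨s, hs, hsf⟩ := exists_eval_ne_zero_of_mem_saturation hf hx0
    obtain ⟨h0, hd⟩ := le_flatDirs_of_mem hp hsf hx
    obtain ⟨h1, h2⟩ := flatDirs_le_of_mul hs h0
    exact ⟨h1, hd.trans h2⟩
  exact mem_pointIdeal_sq_sup hp hp0 (fun x hx h => (key x hx h).1) fun x hx h => (key x hx h).2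

end Linear

/-! ### Ideals over K[t] of families of configurations, and their flatness. -/

section Family

variable {K : Type*} [Field K]

/-- The fibre over `a` of a polynomial with coefficients in `K[t]`. -/
abbrev specialize (a : K) : Coord (Polynomial K) →+* Coord K :=
  MvPolynomial.map (Polynomial.evalRingHom a)

theorem specialize_surjective (a : K) : Function.Surjective (specialize a) :=
  map_surjective _ fun c => ⟨Polynomial.C c, by simp⟩

theorem eval_specialize (a : K) (P : Fin 4 → Polynomial K) (F : Coord (Polynomial K)) :
    eval (fun i => (P i).eval a) (specialize a F) = (eval P F).eval a := by
  rw [eval_map, ← Polynomial.coe_evalRingHom, eval, coe_eval₂Hom, hom_eval₂, RingHom.comp_id]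

/-- The ideal of the polynomials all of whose fibres lie in the given ideals. -/
def familyIdeal (I : K → Ideal (Coord K)) : Ideal (Coord (Polynomial K)) :=
  ⨅ a, (I a).comap (specialize a)

theorem mem_familyIdeal {I : K → Ideal (Coord K)} {F : Coord (Polynomial K)} :
    F ∈ familyIdeal I ↔ ∀ a, specialize a F ∈ I a := by
  simp [familyIdeal]

theorem familyIdeal_mono {I J : K → Ideal (Coord K)} (h : ∀ a, I a ≤ J a) :
    familyIdeal I ≤ familyIdeal J := fun _ hF =>
  mem_familyIdeal.2 fun a => h a (mem_familyIdeal.1 hF a)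

theorem map_familyIdeal_le (I : K → Ideal (Coord K)) (a : K) :
    (familyIdeal I).map (specialize a) ≤ I a :=
  Ideal.map_le_iff_le_comap.2 (iInf_le _ a)

/-- `Z` is a finite union of nonzero linear subspaces. -/
def IsArrangement (Z : Set (Fin 4 → K)) : Prop :=
  ∃ (τ : Type) (_ : Finite τ) (D : τ → Submodule K (Fin 4 → K)),
    (∀ k, D k ≠ ⊥) ∧ Z = ⋃ k, (D k : Set (Fin 4 → K))

theorem vanishingIdeal_iUnion {τ : Type*} (D : τ → Submodule K (Fin 4 → K)) :
    vanishingIdeal K (⋃ k, (D k : Set (Fin 4 → K))) = ⨅ k, linIdeal (D k) := by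
  ext f
  simp only [Submodule.mem_iInf, mem_linIdeal, mem_vanishingIdeal_iff, Set.mem_iUnion,
    aeval_eq_eval, SetLike.mem_coe]
  exact ⟨fun h k x hx => h x ⟨k, hx⟩, fun h x ⟨k, hx⟩ => h k x hx⟩

theorem IsArrangement.saturation_le [Infinite K] {Z : Set (Fin 4 → K)} (hZ : IsArrangement Z) :
    saturation (vanishingIdeal K Z) ≤ vanishingIdeal K Z := by
  obtain ⟨τ, _, D, hD, rfl⟩ := hZ
  rw [vanishingIdeal_iUnion]
  exact le_iInf fun k => (saturation_mono (iInf_le _ k)).trans (saturation_linIdeal_le (hD k))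

/-- The subscheme of the ideal does not pass through the point `x`. -/
def Avoids (I : Ideal (Coord K)) (x : Fin 4 → K) : Prop := ∃ s ∈ I, eval x s ≠ 0

theorem avoids_linIdeal {U : Submodule K (Fin 4 → K)} {x : Fin 4 → K} (hx : x ∉ U) :
    Avoids (linIdeal U) x := by
  obtain ⟨Q, hQ, hQU⟩ := exists_projection U
  have : Q x - x ≠ 0 := fun h => hx (by rw [← sub_eq_zero.1 h]; exact hQU x)
  obtain ⟨i, hi⟩ := Function.ne_iff.1 this
  refine ⟨_, sub_linComp_mem hQ (X i), fun h => hi ?_⟩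
  rw [map_sub, eval_linComp, eval_X, eval_X] at h
  simpa [sub_eq_zero, eq_comm] using neg_eq_zero.2 h

theorem Avoids.inf {I J : Ideal (Coord K)} {x : Fin 4 → K} (hI : Avoids I x) (hJ : Avoids J x) :
    Avoids (I ⊓ J) x := by
  obtain ⟨s, hs, hsx⟩ := hI
  obtain ⟨t, ht, htx⟩ := hJ
  exact ⟨s * t, ⟨I.mul_mem_right _ hs, J.mul_mem_left _ ht⟩, by simp [hsx, htx]⟩

theorem avoids_iInf {τ : Type*} [Finite τ] {I : τ → Ideal (Coord K)} {x : Fin 4 → K}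
    (h : ∀ k, Avoids (I k) x) : Avoids (⨅ k, I k) x := by
  have := Fintype.ofFinite τ
  choose s hs hsx using h
  refine ⟨∏ k, s k, ?_, by simpa [map_prod, Finset.prod_ne_zero_iff] using hsx⟩
  rw [Submodule.mem_iInf]
  exact fun k => Ideal.mem_of_dvd _ (Finset.dvd_prod_of_mem s (Finset.mem_univ k)) (hs k)

theorem IsArrangement.avoids {Z : Set (Fin 4 → K)} (hZ : IsArrangement Z) {x : Fin 4 → K}
    (hx : x ∉ Z) : Avoids (vanishingIdeal K Z) x := by
  obtain ⟨τ, _, D, hD, rfl⟩ := hZ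
  rw [vanishingIdeal_iUnion]
  exact avoids_iInf fun k => avoids_linIdeal fun h => hx (Set.mem_iUnion_of_mem k h)

/-- Near x only the factors in T matter: each other ideal has an element not vanishing at x, and the
product of these carries the product over T into the full product. -/
theorem exists_mul_mem_prod {τ : Type*} [Fintype τ] {I : τ → Ideal (Coord K)} {x : Fin 4 → K}
    (T : Finset τ) (h : ∀ c ∉ T, Avoids (I c) x) :
    ∃ s, eval x s ≠ 0 ∧ ∀ f ∈ ∏ c ∈ T, I c, s * f ∈ ∏ c, I c := by
  classical
  have h' : ∀ c, ∃ s, eval x s ≠ 0 ∧ (c ∉ T → s ∈ I c) := fun c =>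
    if hc : c ∈ T then ⟨1, by simp, fun h => absurd hc h⟩ else
      let ⟨s, hs, hsx⟩ := h c hc
      ⟨s, hsx, fun _ => hs⟩
  choose s hsx hs using h'
  refine ⟨∏ c ∈ Tᶜ, s c, by simpa [map_prod, Finset.prod_ne_zero_iff] using fun c _ => hsx c,
    fun f hf => ?_⟩
  rw [← Finset.prod_compl_mul_prod T]
  exact Ideal.mul_mem_mul (Ideal.prod_mem_prod fun c hc => hs c (by simpa using hc)) hf

variable {ι κ : Type}

/-- The fibre over `a` of a family of configurations. -/
abbrev Config.evalAt (Γ : Config (Polynomial K) ι κ) (a : K) : Config K ι κ :=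
  fun p i => (Γ p i).eval a

/-- The ideals of the lines, of the crosses and of the points of a configuration. -/
def Config.compIdeal (Y : Config K ι κ) (Z : Set (Fin 4 → K)) : ι ⊕ κ ⊕ Unit → Ideal (Coord K)
  | .inl i => linIdeal (Y.line i)
  | .inr (.inl j) => linIdeal (Y.crossLine j 0) ⊓ linIdeal (Y.crossLine j 1)
  | .inr (.inr _) => vanishingIdeal K Z

theorem Config.mem_scheme {Y : Config K ι κ} {Z : Set (Fin 4 → K)} {f : Coord K} :
    f ∈ Y.scheme Z ↔ (∀ i, f ∈ linIdeal (Y.line i)) ∧ (∀ j e, f ∈ linIdeal (Y.crossLine j e)) ∧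
      f ∈ vanishingIdeal K Z := by
  simp only [Config.scheme, mem_linIdeal, mem_vanishingIdeal_iff, Set.mem_union, Set.mem_iUnion,
    aeval_eq_eval, SetLike.mem_coe]
  constructor
  · intro h
    exact ⟨fun i x hx => h x (.inl (.inl ⟨i, hx⟩)), fun j e x hx => h x (.inl (.inr ⟨j, e, hx⟩)),
      fun x hx => h x (.inr hx)⟩
  · rintro ⟨h1, h2, h3⟩ x ((⟨i, hx⟩ | ⟨j, e, hx⟩) | hx)
    exacts [h1 i x hx, h2 j e x hx, h3 x hx]

theorem Config.scheme_eq_iInf (Y : Config K ι κ) (Z : Set (Fin 4 → K)) :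
    Y.scheme Z = ⨅ c, Y.compIdeal Z c := by
  ext f
  simp [Config.mem_scheme, iInf_sum, Config.compIdeal, Submodule.mem_iInf, Fin.forall_fin_two]

/-- Restricting f to the line through 0 and x sorts its monomials by degree. -/
theorem eval_homogeneousComponent (f : Coord K) (x : Fin 4 → K) (n : ℕ) :
    eval x (homogeneousComponent n f) =
      (aeval (fun i => Polynomial.C (x i) * Polynomial.X) f : Polynomial K).coeff n := by
  induction f using MvPolynomial.induction_on' with
  | add p q hp hq => simp [hp, hq]
  | monomial d c =>
    have h1 : (aeval (fun i => Polynomial.C (x i) * Polynomial.X) (monomial d c) : Polynomial K) =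
        Polynomial.C (c * ∏ i, x i ^ d i) * Polynomial.X ^ d.degree := by
      rw [aeval_monomial, Finsupp.prod_fintype _ _ (by simp)]
      simp only [mul_pow, Finset.prod_mul_distrib, Finset.prod_pow_eq_pow_sum,
        Finsupp.degree_eq_sum, Polynomial.algebraMap_eq, map_mul, map_prod, map_pow]
      ring
    rw [h1, Polynomial.coeff_C_mul, Polynomial.coeff_X_pow]
    have hd : (monomial d c : Coord K).IsHomogeneous d.degree := isHomogeneous_monomial _ rfl
    rw [homogeneousComponent_of_mem hd]
    split_ifs with h
    · simp [eval_monomial, Finsupp.prod_fintype]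
    · simp

/-- The ideal of a cone is homogeneous. -/
theorem homogeneousComponent_mem_vanishingIdeal [Infinite K] {S : Set (Fin 4 → K)}
    (hS : ∀ x ∈ S, ∀ c : K, c • x ∈ S) {f : Coord K} (hf : f ∈ vanishingIdeal K S) (n : ℕ) :
    homogeneousComponent n f ∈ vanishingIdeal K S := by
  rw [mem_vanishingIdeal_iff] at *
  intro x hx
  rw [aeval_eq_eval, eval_homogeneousComponent]
  have : (aeval (fun i => Polynomial.C (x i) * Polynomial.X) f : Polynomial K) = 0 := by
    refine Polynomial.funext fun c => ?_
    rw [eval_aeval_polynomial, Polynomial.eval_zero, ← hf _ (hS x hx c), aeval_eq_eval]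
    congr 2
    funext i
    rw [Polynomial.eval_mul, Polynomial.eval_C, Polynomial.eval_X, Pi.smul_apply, smul_eq_mul,
      mul_comm]
  rw [this, Polynomial.coeff_zero]

theorem IsArrangement.smul_mem {Z : Set (Fin 4 → K)} (hZ : IsArrangement Z) :
    ∀ x ∈ Z, ∀ c : K, c • x ∈ Z := by
  obtain ⟨τ, _, D, hD, rfl⟩ := hZ
  intro x hx c
  obtain ⟨k, hk⟩ := Set.mem_iUnion.1 hx
  exact Set.mem_iUnion_of_mem k ((D k).smul_mem c hk)

theorem homogeneousComponent_mem_scheme [Infinite K] {Y : Config K ι κ} {Z : Set (Fin 4 → K)}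
    (hZ : IsArrangement Z) {f : Coord K} (hf : f ∈ Y.scheme Z) (n : ℕ) :
    homogeneousComponent n f ∈ Y.scheme Z := by
  rw [Config.mem_scheme] at *
  exact ⟨fun i => homogeneousComponent_mem_vanishingIdeal
      (fun x hx c => (Y.line i).smul_mem c hx) (hf.1 i) n,
    fun j e => homogeneousComponent_mem_vanishingIdeal
      (fun x hx c => (Y.crossLine j e).smul_mem c hx) (hf.2.1 j e) n,
    homogeneousComponent_mem_vanishingIdeal hZ.smul_mem hf.2.2 n⟩

theorem specialize_homogeneousComponent (a : K) (n : ℕ) (F : Coord (Polynomial K)) :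
    specialize a (homogeneousComponent n F) = homogeneousComponent n (specialize a F) := by
  ext d
  simp only [coeff_map, coeff_homogeneousComponent]
  split_ifs <;> simp

/-- If almost all fibres of `F` lie in the ideals of the fibres of a family of configurations then
all do. -/
theorem mem_familyIdeal_scheme_of_infinite {Γ : Config (Polynomial K) ι κ}
    {Z : Set (Fin 4 → K)} {F : Coord (Polynomial K)} {S : Set K} (hS : S.Infinite)
    (h : ∀ a ∈ S, specialize a F ∈ (Γ.evalAt a).scheme Z) :
    F ∈ familyIdeal fun a => (Γ.evalAt a).scheme Z := by
  -- Along an arc P(t) the value of F is a polynomial in t; if it vanishes for infinitely many t it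
  -- is zero. Points of lines are reached by arcs with constant coefficients in the spanning
  -- vectors, points of Z by constant arcs.
  have key : ∀ P : Fin 4 → Polynomial K,
      (∀ a ∈ S, eval (fun i => (P i).eval a) (specialize a F) = 0) →
        ∀ a, eval (fun i => (P i).eval a) (specialize a F) = 0 := by
    intro P hP a
    have : eval P F = 0 := Polynomial.eq_zero_of_infinite_isRoot _ (hS.mono fun a ha => by
      have := hP a ha
      rwa [eval_specialize] at this)
    rw [eval_specialize, this, Polynomial.eval_zero]
  have hspan : ∀ u v : Fin 4 → Polynomial K,
      (∀ a ∈ S, specialize a F ∈ linIdeal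
        (Submodule.span K {fun i => (u i).eval a, fun i => (v i).eval a})) →
      ∀ a, specialize a F ∈ linIdeal
        (Submodule.span K {fun i => (u i).eval a, fun i => (v i).eval a}) := by
    intro u v huv a
    rw [mem_linIdeal]
    intro x hx
    obtain ⟨α, β, rfl⟩ := Submodule.mem_span_pair.1 hx
    have h2 : ∀ a, (fun i => (Polynomial.C α * u i + Polynomial.C β * v i).eval a) =
        α • (fun i => (u i).eval a) + β • fun i => (v i).eval a := by
      intro a
      ext i
      simp
    have := key (fun i => Polynomial.C α * u i + Polynomial.C β * v i) (fun a ha => by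
      rw [h2]
      exact mem_linIdeal.1 (huv a ha) _ (Submodule.mem_span_pair.2 ⟨α, β, rfl⟩)) a
    rwa [h2] at this
  refine mem_familyIdeal.2 fun a => Config.mem_scheme.2 ⟨fun i => ?_, fun j e => ?_, ?_⟩
  · exact hspan _ _ (fun a ha => (Config.mem_scheme.1 (h a ha)).1 i) a
  · exact hspan _ _ (fun a ha => (Config.mem_scheme.1 (h a ha)).2.1 j e) a
  · rw [mem_vanishingIdeal_iff]
    intro x hx
    have := key (fun i => Polynomial.C (x i)) (fun a ha => by
      have := mem_vanishingIdeal_iff.1 (Config.mem_scheme.1 (h a ha)).2.2 x hx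
      simpa [aeval_eq_eval] using this) a
    simpa [aeval_eq_eval] using this

theorem specialize_smul (a : K) (g : Polynomial K) (F : Coord (Polynomial K)) :
    specialize a (C g * F) = C (g.eval a) * specialize a F := by
  simp

/-- Away from the finitely many roots of g its value can be inverted in the fibre, and almost all
fibres decide membership. This is torsion-freeness of the quotient over K[t]. -/
theorem mem_familyIdeal_of_C_mul_mem [Infinite K] {Γ : Config (Polynomial K) ι κ}
    {Z : Set (Fin 4 → K)} {F : Coord (Polynomial K)} {g : Polynomial K} (hg : g ≠ 0)
    (h : C g * F ∈ familyIdeal fun a => (Γ.evalAt a).scheme Z) :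
    F ∈ familyIdeal fun a => (Γ.evalAt a).scheme Z := by
  have hfin : {a | g.IsRoot a}.Finite := Polynomial.finite_setOfPred_isRoot hg
  refine mem_familyIdeal_scheme_of_infinite hfin.infinite_compl fun a ha => ?_
  have := mem_familyIdeal.1 h a
  rw [specialize_smul] at this
  have h2 := Ideal.mul_mem_left _ (C (g.eval a)⁻¹) this
  rwa [← mul_assoc, ← C_mul, inv_mul_cancel₀ ha, C_1, one_mul] at h2

/-- Over the Dedekind domain K[t] flat means torsion free, and torsion in the localization becomes
torsion in the quotient after multiplication by a power of x. -/
theorem flat_localization_of_torsionFree {I : Ideal (Coord (Polynomial K))}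
    (h : ∀ g : Polynomial K, g ≠ 0 → ∀ F, C g * F ∈ I → F ∈ I) (x : Coord (Polynomial K)) :
    Module.Flat (Polynomial K) (Localization.Away (Ideal.Quotient.mk I x)) := by
  rw [IsDedekindDomain.flat_iff_torsion_eq_bot, eq_bot_iff]
  intro m hm
  obtain ⟨g, hg⟩ := (Submodule.mem_torsion_iff m).1 hm
  obtain ⟨⟨f, ⟨_, n, rfl⟩⟩, rfl⟩ :=
    IsLocalization.mk'_surjective (Submonoid.powers (Ideal.Quotient.mk I x)) m
  obtain ⟨F, rfl⟩ := Ideal.Quotient.mk_surjective f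
  rw [Submonoid.smul_def, Algebra.smul_def, IsScalarTower.algebraMap_apply (Polynomial K)
    (Coord (Polynomial K) ⧸ I), IsScalarTower.algebraMap_apply (Polynomial K)
    (Coord (Polynomial K)), ← IsLocalization.mk'_one (M := Submonoid.powers (Ideal.Quotient.mk I x)),
    ← IsLocalization.mk'_mul, IsLocalization.mk'_eq_zero_iff] at hg
  obtain ⟨⟨_, k, rfl⟩, hk⟩ := hg
  rw [Submodule.mem_bot, IsLocalization.mk'_eq_zero_iff]
  refine ⟨⟨_, k, rfl⟩, ?_⟩
  have h1 : C (g : Polynomial K) * (x ^ k * F) ∈ I := by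
    rw [← Ideal.Quotient.eq_zero_iff_mem, ← hk]
    simp [MvPolynomial.algebraMap_eq]
    ring
  have := Ideal.Quotient.eq_zero_iff_mem.2 (h _ (nonZeroDivisors.coe_ne_zero g) _ h1)
  simpa using this

/-- The closure of the family of the schemes of a family of configurations. -/
def configFamily [Infinite K] (Γ : Config (Polynomial K) ι κ) (Z : Set (Fin 4 → K))
    (hZ : IsArrangement Z) : FlatFamily K where
  ideal := familyIdeal fun a => (Γ.evalAt a).scheme Z
  homogeneous := by
    intro F hF n
    rw [mem_familyIdeal] at *
    intro a
    rw [specialize_homogeneousComponent]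
    exact homogeneousComponent_mem_scheme hZ (hF a) n
  flat := by
    intro i
    exact flat_localization_of_torsionFree (fun g hg F => mem_familyIdeal_of_C_mul_mem hg) _

end Family

/-! ### Lifting the ideal of a fibre to the family. -/

section Lift

variable {K : Type*} [Field K]

theorem exists_rightInverse_of_linearIndependent {m : ℕ} {x : Fin m → Fin 4 → K}
    (h : LinearIndependent K x) : ∃ R : Matrix (Fin 4) (Fin m) K, Matrix.of x * R = 1 := by
  obtain ⟨g, hg⟩ := (Fintype.linearCombination K x).exists_leftInverse_of_injective
    (LinearMap.ker_eq_bot.2 (linearIndependent_iff_injective_fintypeLinearCombination.1 h))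
  refine ⟨Matrix.of fun i k => g (Pi.single i 1) k, ?_⟩
  ext k l
  have h1 := congrFun (DFunLike.congr_fun hg (Pi.single k 1)) l
  simp only [LinearMap.comp_apply, LinearMap.id_apply, Fintype.linearCombination_apply_single,
    one_smul] at h1
  rw [Matrix.mul_apply, Matrix.one_apply]
  have h2 : g (x k) l = ∑ i, x k i * g (Pi.single i 1) l := by
    conv_lhs => rw [← Finset.univ_sum_single (x k), map_sum, Finset.sum_apply]
    refine Finset.sum_congr rfl fun j _ => ?_
    have : Pi.single j (x k j) = x k j • (Pi.single j 1 : Fin 4 → K) := by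
      rw [← Pi.single_smul, smul_eq_mul, mul_one]
    rw [this, map_smul, Pi.smul_apply, smul_eq_mul]
  simpa [h2, Pi.single_apply, eq_comm] using h1

/-- A linear form that vanishes on the fibre over `a` of a family of linear subspaces extends to a
family of linear forms. -/
theorem exists_lift_form {m : ℕ} (u : Fin m → Fin 4 → Polynomial K) (a : K)
    (h : LinearIndependent K fun k i => (u k i).eval a) (ξ : Fin 4 → K)
    (hξ : ∀ k, ∑ i, ξ i * (u k i).eval a = 0) :
    ∃ Ξ : Fin 4 → Polynomial K, (∀ i, (Ξ i).eval a = ξ i) ∧ ∀ k, ∑ i, Ξ i * u k i = 0 := by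
  obtain ⟨R, hR⟩ := exists_rightInverse_of_linearIndependent h
  let U : Matrix (Fin m) (Fin 4) (Polynomial K) := u
  let ev : Polynomial K →+* K := Polynomial.evalRingHom a
  let S := U * R.map Polynomial.C
  have hS : S.map ev = 1 := by
    rw [Matrix.map_mul, ← hR]
    congr 1
    ext
    simp [ev]
  have hdet : ev S.det = 1 := by
    rw [RingHom.map_det, RingHom.mapMatrix_apply, hS, Matrix.det_one]
  let ρ : Fin m → Polynomial K := U.mulVec fun i => Polynomial.C (ξ i)
  have hρ : ∀ k, ev (ρ k) = 0 := by
    intro k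
    rw [← hξ k]
    simp [ρ, ev, U, Matrix.mulVec, dotProduct, mul_comm]
  -- Cramer's rule corrects ξ: with S = U R one has U Ξ = det(S) Uξ - S adj(S) Uξ = 0. At a the
  -- matrix S is the identity and Uξ vanishes, so Ξ takes the value ξ.
  let Ξ : Fin 4 → Polynomial K := S.det • (fun i => Polynomial.C (ξ i)) -
    (R.map Polynomial.C).mulVec (S.adjugate.mulVec ρ)
  refine ⟨Ξ, fun i => ?_, fun k => ?_⟩
  · change ev (Ξ i) = ξ i
    simp only [Ξ, Pi.sub_apply, Pi.smul_apply, smul_eq_mul, map_sub, map_mul, hdet,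
      Matrix.mulVec, dotProduct, map_sum, hρ, mul_zero, Finset.sum_const_zero, sub_zero, one_mul]
    simp [ev]
  · have : U.mulVec Ξ = 0 := by
      simp only [Ξ, Matrix.mulVec_sub, Matrix.mulVec_smul, Matrix.mulVec_mulVec]
      rw [← Matrix.mul_assoc, Matrix.mul_adjugate, Matrix.smul_mulVec, Matrix.one_mulVec, sub_self]
    simpa [Matrix.mulVec, dotProduct, U, mul_comm] using congrFun this k

variable {ι κ : Type}

theorem Config.line_evalAt (Γ : Config (Polynomial K) ι κ) (a : K) (i : ι) :
    (Γ.evalAt a).line i = Submodule.span K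
      (Set.range fun k j => ((![Γ (.inl (i, 0)), Γ (.inl (i, 1))] : Fin 2 → _) k j).eval a) := by
  rw [Config.line]
  congr 1
  ext x
  simp [Fin.exists_fin_two, eq_comm]

theorem Config.crossLine_evalAt (Γ : Config (Polynomial K) ι κ) (a : K) (j : κ) (e : Fin 2) :
    (Γ.evalAt a).crossLine j e = Submodule.span K
      (Set.range fun k l => ((![Γ (.inr (j, 0)), Γ (.inr (j, e.succ))] : Fin 2 → _) k l).eval a) := by
  rw [Config.crossLine]
  congr 1
  ext x
  simp [Fin.exists_fin_two, eq_comm, Config.vertex, Config.arm]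

theorem Config.crossPlane_evalAt (Γ : Config (Polynomial K) ι κ) (a : K) (j : κ) :
    (Γ.evalAt a).crossLine j 0 ⊔ (Γ.evalAt a).crossLine j 1 = Submodule.span K
      (Set.range fun k l =>
        ((![Γ (.inr (j, 0)), Γ (.inr (j, 1)), Γ (.inr (j, 2))] : Fin 3 → _) k l).eval a) := by
  rw [Config.crossLine, Config.crossLine, ← Submodule.span_union]
  congr 1
  ext x
  simp [Fin.exists_fin_succ, eq_comm, Config.vertex, Config.arm]
  tauto

theorem span_pair_ne_bot {u v : Fin 4 → K} (h : LinearIndependent K ![u, v]) :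
    Submodule.span K {u, v} ≠ ⊥ := by
  intro hb
  have : u ∈ (⊥ : Submodule K (Fin 4 → K)) := hb ▸ Submodule.subset_span (by simp)
  exact h.ne_zero 0 (by simpa using this)

/-- A point lies on at most one component of a nondegenerate configuration. -/
theorem Config.IsNondegenerate.exists_avoids {η : Fin 4 → K} {Y : Config K ι κ}
    {Z : Set (Fin 4 → K)} (hZ : IsArrangement Z) (hY : Y.IsNondegenerate η Z) {x : Fin 4 → K}
    (hx : x ≠ 0) : ∃ c, ∀ c' ≠ c, Avoids (Y.compIdeal Z c') x := by
  classical
  have hnot {U V : Submodule K (Fin 4 → K)} (h : Disjoint U V) (hU : x ∈ U) : x ∉ V :=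
    fun hV => hx (Submodule.disjoint_def.1 h x hU hV)
  by_cases h1 : ∃ i, x ∈ Y.line i
  · obtain ⟨i, hi⟩ := h1
    refine ⟨.inl i, ?_⟩
    rintro (i' | j | _) hc
    · exact avoids_linIdeal (hnot (hY.line_line i i' fun h => hc (h ▸ rfl)) hi)
    · exact (avoids_linIdeal (hnot (hY.line_cross i j 0) hi)).inf
        (avoids_linIdeal (hnot (hY.line_cross i j 1) hi))
    · exact hZ.avoids fun h => hx (hY.line_star i x h hi)
  push Not at h1
  by_cases h2 : ∃ j e, x ∈ Y.crossLine j e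
  · obtain ⟨j, e, hj⟩ := h2
    refine ⟨.inr (.inl j), ?_⟩
    rintro (i' | j' | _) hc
    · exact avoids_linIdeal (h1 i')
    · have hj' : j ≠ j' := fun h => hc (h ▸ rfl)
      exact (avoids_linIdeal (hnot (hY.cross_cross j j' e 0 hj') hj)).inf
        (avoids_linIdeal (hnot (hY.cross_cross j j' e 1 hj') hj))
    · exact hZ.avoids fun h => hx (hY.cross_star j e x h hj)
  push Not at h2
  refine ⟨.inr (.inr ()), ?_⟩
  rintro (i' | j' | _) hc
  · exact avoids_linIdeal (h1 i')
  · exact (avoids_linIdeal (h2 j' 0)).inf (avoids_linIdeal (h2 j' 1))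
  · exact absurd rfl hc

/-- The first order part of the values of a polynomial along arcs through a point. -/
theorem coeff_one_eval (F : Coord (Polynomial K)) (p : Fin 4 → K) (P : Fin 4 → Polynomial K)
    (hP : ∀ i, (P i).coeff 0 = p i) :
    (eval P F).coeff 1 = (eval (fun i => Polynomial.C (p i)) F).coeff 1 +
      dirDeriv p (fun i => (P i).coeff 1) (specialize 0 F) := by
  have h0 : ∀ (Q : Fin 4 → Polynomial K) (_ : ∀ i, (Q i).coeff 0 = p i) (F),
      (eval Q F).coeff 0 = eval p (specialize 0 F) := by
    intro Q hQ F
    rw [Polynomial.coeff_zero_eq_eval_zero, ← eval_specialize]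
    simp [← Polynomial.coeff_zero_eq_eval_zero, hQ]
  induction F using MvPolynomial.induction_on with
  | C g => simp [dirDeriv]
  | add F G hF hG =>
    simp only [map_add, Polynomial.coeff_add, dirDeriv_add, hF, hG]
    ring
  | mul_X F i hF =>
    have h1 := h0 P hP F
    have h2 := h0 (fun i => Polynomial.C (p i)) (by simp) F
    have h3 : dirDeriv p (fun i => (P i).coeff 1) (X i) = (P i).coeff 1 := by
      simp [dirDeriv, pderiv_X, Pi.single_apply]
    simp only [map_mul, eval_X, Polynomial.mul_coeff_one, hF, h1, h2, hP, dirDeriv_mul, map_X, h3]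
    simp
    ring

variable [Infinite K]

/-- The ideal of a linear subspace is generated by linear forms, and these extend by
`exists_lift_form`. Independence is needed only in the fibre over a. -/
theorem linIdeal_le_map_familyIdeal {m : ℕ} (u : Fin m → Fin 4 → Polynomial K) (a : K)
    (h : LinearIndependent K fun k i => (u k i).eval a) :
    linIdeal (Submodule.span K (Set.range fun k i => (u k i).eval a)) ≤
      (familyIdeal fun b => linIdeal
        (Submodule.span K (Set.range fun k i => (u k i).eval b))).map (specialize a) := by
  rw [linIdeal_eq_span, Ideal.span_le]
  rintro _ ⟨ξ, hξ, rfl⟩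
  obtain ⟨Ξ, hΞ, hu⟩ := exists_lift_form u a h ξ fun k => hξ _ (Submodule.subset_span ⟨k, rfl⟩)
  have e : ∀ b, specialize b (∑ i, C (Ξ i) * X i) = planeForm fun i => (Ξ i).eval b := by
    intro b
    simp [planeForm]
  have : planeForm ξ = specialize a (∑ i, C (Ξ i) * X i) := by
    rw [e]
    simp [hΞ]
  rw [SetLike.mem_coe, this]
  refine Ideal.mem_map_of_mem _ (mem_familyIdeal.2 fun b => ?_)
  rw [e, linIdeal_eq_span]
  refine Ideal.subset_span ⟨_, fun x hx => ?_, rfl⟩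
  have hle : Submodule.span K (Set.range fun k i => (u k i).eval b) ≤
      plane fun i => (Ξ i).eval b := by
    rw [Submodule.span_le]
    rintro _ ⟨k, rfl⟩
    have := congrArg (Polynomial.eval b) (hu k)
    rw [SetLike.mem_coe, mem_plane]
    simpa [Polynomial.eval_finsetSum] using this
  exact hle hx

/-- Every line, cross or point of the fibre over `a` deforms. -/
theorem compIdeal_le_map_familyIdeal (Γ : Config (Polynomial K) ι κ) (Z : Set (Fin 4 → K)) (a : K)
    (hline : ∀ i, LinearIndependent K ![(Γ.evalAt a) (.inl (i, 0)), (Γ.evalAt a) (.inl (i, 1))])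
    (hcross : ∀ j, LinearIndependent K
      ![(Γ.evalAt a).vertex j, (Γ.evalAt a).arm j 0, (Γ.evalAt a).arm j 1])
    (c : ι ⊕ κ ⊕ Unit) :
    (Γ.evalAt a).compIdeal Z c ≤
      (familyIdeal fun b => (Γ.evalAt b).compIdeal Z c).map (specialize a) := by
  have harm : ∀ j (e : Fin 2), linIdeal ((Γ.evalAt a).crossLine j e) ≤
      (familyIdeal fun b => linIdeal ((Γ.evalAt b).crossLine j e)).map (specialize a) := by
    intro j e
    simp_rw [Config.crossLine_evalAt]
    refine linIdeal_le_map_familyIdeal _ a ?_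
    have h2 := (hcross j).comp ![0, e.succ] (by
      intro x y
      fin_cases x <;> fin_cases y <;> simp [Fin.succ_ne_zero, (Fin.succ_ne_zero _).symm])
    convert h2 using 1
    ext k l
    fin_cases k
    · rfl
    · fin_cases e <;> rfl
  rcases c with i | j | _
  · simp only [Config.compIdeal, Config.line_evalAt]
    refine linIdeal_le_map_familyIdeal _ a ?_
    convert hline i using 1
    ext k l
    fin_cases k <;> rfl
  · simp only [Config.compIdeal]
    -- The ideal of a cross is that of its plane plus the product of those of its two lines. The
    -- plane deforms because vertex and arms are independent at a, and the two lines deform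
    -- separately.
    refine (inf_linIdeal_le _ _).trans (sup_le ?_ ?_)
    · have h3 := linIdeal_le_map_familyIdeal ![Γ (.inr (j, 0)), Γ (.inr (j, 1)), Γ (.inr (j, 2))] a
        (by
          convert hcross j using 1
          ext k l
          fin_cases k <;> rfl)
      simp_rw [← Config.crossPlane_evalAt] at h3
      exact h3.trans (Ideal.map_mono (familyIdeal_mono fun b =>
        le_inf (linIdeal_anti le_sup_left) (linIdeal_anti le_sup_right)))
    · refine (Ideal.mul_mono (harm j 0) (harm j 1)).trans ?_
      rw [← Ideal.map_mul]
      refine Ideal.map_mono (Ideal.mul_le_inf.trans fun F hF => ?_)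
      rw [mem_familyIdeal]
      exact fun b => ⟨mem_familyIdeal.1 hF.1 b, mem_familyIdeal.1 hF.2 b⟩
  · intro f hf
    have e : ∀ b, specialize b (MvPolynomial.map Polynomial.C f) = f := by
      intro b
      rw [specialize, map_map]
      have : (Polynomial.evalRingHom b).comp Polynomial.C = RingHom.id K := by
        ext
        simp
      rw [this, map_id]
    rw [← e a]
    exact Ideal.mem_map_of_mem _ (mem_familyIdeal.2 fun b => by rw [e]; exact hf)

/-- The components deform one by one, and a product of deformations lies in the intersection for
every b. No disjointness is assumed at a, so the bound also holds where components collide in the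
limit. -/
theorem prod_compIdeal_le [Fintype ι] [Fintype κ] (Γ : Config (Polynomial K) ι κ)
    (Z : Set (Fin 4 → K)) (a : K)
    (hline : ∀ i, LinearIndependent K ![(Γ.evalAt a) (.inl (i, 0)), (Γ.evalAt a) (.inl (i, 1))])
    (hcross : ∀ j, LinearIndependent K
      ![(Γ.evalAt a).vertex j, (Γ.evalAt a).arm j 0, (Γ.evalAt a).arm j 1]) :
    ∏ c, (Γ.evalAt a).compIdeal Z c ≤
      (familyIdeal fun b => (Γ.evalAt b).scheme Z).map (specialize a) := by
  refine (Finset.prod_le_prod' fun c _ =>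
    compIdeal_le_map_familyIdeal Γ Z a hline hcross c).trans ?_
  have : ∏ c, (familyIdeal fun b => (Γ.evalAt b).compIdeal Z c).map (specialize a) =
      (∏ c, (familyIdeal fun b => (Γ.evalAt b).compIdeal Z c)).map (specialize a) :=
    (map_prod (Ideal.mapHom (specialize a)) _ _).symm
  rw [this]
  refine Ideal.map_mono (Ideal.prod_le_inf.trans fun F hF => mem_familyIdeal.2 fun b => ?_)
  rw [Config.scheme_eq_iInf, Submodule.mem_iInf]
  intro c
  rw [Submodule.mem_finsetInf] at hF
  exact mem_familyIdeal.1 (hF c (Finset.mem_univ c)) b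

theorem Config.IsNondegenerate.saturation_scheme_le {η : Fin 4 → K} {Y : Config K ι κ}
    {Z : Set (Fin 4 → K)} (hZ : IsArrangement Z) (hY : Y.IsNondegenerate η Z) :
    saturation (Y.scheme Z) ≤ Y.scheme Z := by
  intro f hf
  have hle : ∀ I, Y.scheme Z ≤ I → saturation I ≤ I → f ∈ I := fun I h1 h2 =>
    h2 (saturation_mono h1 hf)
  refine Config.mem_scheme.2 ⟨fun i => hle _ (fun g hg => (Config.mem_scheme.1 hg).1 i)
      (saturation_linIdeal_le (span_pair_ne_bot (hY.line_indep i))),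
    fun j e => hle _ (fun g hg => (Config.mem_scheme.1 hg).2.1 j e) (saturation_linIdeal_le ?_),
    hle _ (fun g hg => (Config.mem_scheme.1 hg).2.2) hZ.saturation_le⟩
  intro hb
  have : Y.vertex j ∈ (⊥ : Submodule K (Fin 4 → K)) := hb ▸ Submodule.subset_span (by simp)
  exact (hY.cross_indep j).ne_zero 0 (by simpa using this)

/-- Through each point of projective space passes at most one component, so locally the product of
the component ideals contains their intersection; saturation globalises this. -/
theorem configFamily_fiber [IsAlgClosed K] [Fintype ι] [Fintype κ] (Γ : Config (Polynomial K) ι κ)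
    {Z : Set (Fin 4 → K)} (hZ : IsArrangement Z) {η : Fin 4 → K} {a : K}
    (ha : (Γ.evalAt a).IsNondegenerate η Z) :
    (configFamily Γ Z hZ).fiber a = (Γ.evalAt a).scheme Z := by
  refine le_antisymm ((saturation_mono (map_familyIdeal_le _ a)).trans
    (ha.saturation_scheme_le hZ)) fun f hf => mem_saturation_of_local fun x hx => ?_
  obtain ⟨c, hc⟩ := ha.exists_avoids hZ hx
  obtain ⟨s, hs, hsf⟩ := exists_mul_mem_prod {c} fun c' hc' => hc c' (by simpa using hc')
  refine ⟨s, hs, prod_compIdeal_le Γ Z a ha.line_indep ha.cross_indep (hsf f ?_)⟩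
  rw [Config.scheme_eq_iInf, Submodule.mem_iInf] at hf
  simpa using hf c

end Lift

/-! ### From surfaces through infinitely many fibres to one form over K[t]. -/

section Semicontinuity

/-- A submodule of a finite free module over a principal ideal domain is annihilated by a nonzero
functional, or contains a nonzero multiple of the whole module. -/
theorem exists_functional_or_exists_smul_mem {R σ : Type*} [CommRing R] [IsDomain R]
    [IsPrincipalIdealRing R] [Finite σ] (N : Submodule R (σ → R)) :
    (∃ φ : (σ → R) →ₗ[R] R, φ ≠ 0 ∧ ∀ x ∈ N, φ x = 0) ∨
      ∃ r : R, r ≠ 0 ∧ ∀ x, r • x ∈ N := by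
  classical
  have := Fintype.ofFinite σ
  by_cases hT : Submodule.torsion R ((σ → R) ⧸ N) = ⊤
  · right
    have h : ∀ i, ∃ r : R, r ≠ 0 ∧ r • (Pi.single i 1 : σ → R) ∈ N := by
      intro i
      have : N.mkQ (Pi.single i 1) ∈ Submodule.torsion R ((σ → R) ⧸ N) := hT ▸ trivial
      obtain ⟨r, hr⟩ := (Submodule.mem_torsion_iff _).1 this
      refine ⟨r, nonZeroDivisors.coe_ne_zero r, ?_⟩
      rw [Submonoid.smul_def, ← map_smul] at hr
      exact (Submodule.Quotient.mk_eq_zero N).1 hr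
    choose r hr hrN using h
    refine ⟨∏ i, r i, Finset.prod_ne_zero_iff.2 fun i _ => hr i, fun x => ?_⟩
    rw [pi_eq_sum_univ' x, Finset.smul_sum]
    refine Submodule.sum_mem _ fun i _ => ?_
    rw [← Finset.prod_erase_mul _ _ (Finset.mem_univ i), mul_smul, smul_comm (r i)]
    exact N.smul_mem _ (N.smul_mem _ (by convert hrN i using 2))
  -- Modulo its torsion the quotient by N is nonzero, torsion free and finitely generated, hence
  -- free; a coordinate function gives the functional.
  · left
    let Q := ((σ → R) ⧸ N) ⧸ Submodule.torsion R ((σ → R) ⧸ N)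
    have : Nontrivial Q := Submodule.Quotient.nontrivial_iff.2 hT
    have : Module.IsTorsionFree R Q := inferInstance
    have : Module.Free R Q := inferInstance
    let b := Module.Free.chooseBasis R Q
    obtain ⟨i⟩ := b.index_nonempty
    let φ := b.coord i ∘ₗ (Submodule.torsion R ((σ → R) ⧸ N)).mkQ ∘ₗ N.mkQ
    refine ⟨φ, fun h => ?_, fun x hx => ?_⟩
    · obtain ⟨y, hy⟩ := Submodule.mkQ_surjective _ (b i)
      obtain ⟨x, rfl⟩ := Submodule.mkQ_surjective _ y
      have := DFunLike.congr_fun h x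
      simp only [φ, LinearMap.comp_apply, hy] at this
      simp at this
    · have : N.mkQ x = 0 := by simpa using hx
      simp only [φ, LinearMap.comp_apply, this, map_zero]

variable {K : Type*} [Field K] {ι κ : Type}

/-- The arcs in the total space of a family of configurations. -/
def Config.arcs (Γ : Config (Polynomial K) ι κ) (Z : Set (Fin 4 → K)) :
    Set (Fin 4 → Polynomial K) :=
  {P | ∀ a, ∀ f ∈ (Γ.evalAt a).scheme Z, eval (fun i => (P i).eval a) f = 0}

/-- Every point of a line or cross of the fibre, and every point of Z, extends to a polynomial arc.
Vanishing in all fibres thereby becomes a system of K[t]-linear equations in the coefficients of a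
form. -/
theorem mem_scheme_iff_arcs (Γ : Config (Polynomial K) ι κ) (Z : Set (Fin 4 → K)) (a : K)
    (f : Coord K) : f ∈ (Γ.evalAt a).scheme Z ↔
      ∀ P ∈ Γ.arcs Z, eval (fun i => (P i).eval a) f = 0 := by
  refine ⟨fun h P hP => hP a f h, fun h => ?_⟩
  have hspan : ∀ u v : Fin 4 → Polynomial K,
      (∀ b, ∀ g ∈ (Γ.evalAt b).scheme Z, g ∈ linIdeal
        (Submodule.span K {fun i => (u i).eval b, fun i => (v i).eval b})) →
      f ∈ linIdeal (Submodule.span K {fun i => (u i).eval a, fun i => (v i).eval a}) := by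
    intro u v huv
    rw [mem_linIdeal]
    intro x hx
    obtain ⟨α, β, rfl⟩ := Submodule.mem_span_pair.1 hx
    have h2 : ∀ a, (fun i => (Polynomial.C α * u i + Polynomial.C β * v i).eval a) =
        α • (fun i => (u i).eval a) + β • fun i => (v i).eval a := by
      intro a
      ext i
      simp
    rw [← h2]
    refine h (fun i => Polynomial.C α * u i + Polynomial.C β * v i) fun b g hg => ?_
    rw [h2]
    exact mem_linIdeal.1 (huv b g hg) _ (Submodule.mem_span_pair.2 ⟨α, β, rfl⟩)
  refine Config.mem_scheme.2 ⟨fun i => ?_, fun j e => ?_, ?_⟩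
  · exact hspan _ _ fun b g hg => (Config.mem_scheme.1 hg).1 i
  · exact hspan _ _ fun b g hg => (Config.mem_scheme.1 hg).2.1 j e
  · rw [mem_vanishingIdeal_iff]
    intro x hx
    have := h (fun i => Polynomial.C (x i)) fun b g hg => by
      have := mem_vanishingIdeal_iff.1 (Config.mem_scheme.1 hg).2.2 x hx
      simpa [aeval_eq_eval] using this
    simpa [aeval_eq_eval] using this

theorem exists_eq_C_mul_of_specialize_eq_zero {a : K} {F : Coord (Polynomial K)}
    (h : specialize a F = 0) : ∃ H, F = C (Polynomial.X - Polynomial.C a) * H := by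
  refine (C_dvd_iff_dvd_coeff _ _).2 fun m => Polynomial.dvd_iff_isRoot.2 ?_
  have := congrArg (coeff m) h
  simpa [coeff_map] using this

variable [Infinite K]

theorem mem_familyIdeal_iff_arcs (Γ : Config (Polynomial K) ι κ) (Z : Set (Fin 4 → K))
    (F : Coord (Polynomial K)) : F ∈ (familyIdeal fun a => (Γ.evalAt a).scheme Z) ↔
      ∀ P ∈ Γ.arcs Z, eval P F = 0 := by
  simp only [mem_familyIdeal, mem_scheme_iff_arcs, eval_specialize]
  exact ⟨fun h P hP => Polynomial.funext fun a => by rw [h a P hP, Polynomial.eval_zero],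
    fun h a P hP => by rw [h P hP, Polynomial.eval_zero]⟩

/-- If infinitely many fibres lie on a surface of degree `d` then so does the whole family. -/
theorem exists_mem_familyIdeal_of_infinite (Γ : Config (Polynomial K) ι κ) (Z : Set (Fin 4 → K))
    (d : ℕ) (h : {a | ¬ IsEmptySystem d ((Γ.evalAt a).scheme Z)}.Infinite) :
    ∃ F ∈ (familyIdeal fun a => (Γ.evalAt a).scheme Z), F.IsHomogeneous d ∧ F ≠ 0 := by
  classical
  let σ := {m : Fin 4 →₀ ℕ // m ∈ Finset.finsuppAntidiag Finset.univ d}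
  have : Fintype σ := inferInstanceAs (Fintype {m // m ∈ Finset.finsuppAntidiag Finset.univ d})
  have hσ : ∀ m : σ, (m : Fin 4 →₀ ℕ).degree = d := by
    rintro ⟨m, hm⟩
    rw [Finset.mem_finsuppAntidiag] at hm
    rw [Finsupp.degree_eq_sum]
    exact hm.1
  have hσ' : ∀ m : Fin 4 →₀ ℕ, m.degree = d → m ∈ Finset.finsuppAntidiag Finset.univ d := by
    intro m hm
    rw [Finset.mem_finsuppAntidiag]
    rw [Finsupp.degree_eq_sum] at hm
    exact ⟨hm, Finset.subset_univ _⟩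
  -- T lists the values of all monomials of degree d on an arc. Forms of degree d in the family
  -- ideal are the functionals annihilating all these vectors.
  let T : (Fin 4 → Polynomial K) → σ → Polynomial K := fun P m => eval P (monomial m.1 1)
  rcases exists_functional_or_exists_smul_mem (Submodule.span (Polynomial K) (T '' Γ.arcs Z)) with
    ⟨φ, hφ, hφN⟩ | ⟨r, hr, hrN⟩
  · let F : Coord (Polynomial K) := ∑ m : σ, monomial m.1 (φ (Pi.single m 1))
    have hF : ∀ P, eval P F = φ (T P) := by
      intro P
      conv_rhs => rw [← Finset.univ_sum_single (T P), map_sum]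
      rw [map_sum]
      refine Finset.sum_congr rfl fun m _ => ?_
      have : Pi.single m (T P m) = T P m • (Pi.single m 1 : σ → Polynomial K) := by
        rw [← Pi.single_smul, smul_eq_mul, mul_one]
      rw [this, map_smul, smul_eq_mul, eval_monomial]
      simp only [T, eval_monomial, one_mul]
      ring
    refine ⟨F, ?_, IsHomogeneous.sum _ _ _ fun m _ => isHomogeneous_monomial _ (hσ m), fun h0 => hφ ?_⟩
    · rw [mem_familyIdeal_iff_arcs]
      intro P hP
      rw [hF, hφN _ (Submodule.subset_span ⟨P, hP, rfl⟩)]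
    · refine LinearMap.pi_ext' fun m => LinearMap.ext_ring ?_
      have := congrArg (coeff m.1) h0
      rw [coeff_sum, Finset.sum_eq_single m (fun n _ hn => by
        rw [coeff_monomial, if_neg fun h => hn (Subtype.ext h)]) (by simp), coeff_monomial,
        if_pos rfl] at this
      simpa using this
  -- If a is not a root of r, the vectors of monomial values at t = a span the whole space, so the
  -- coefficients of a form vanishing on that fibre are zero: only roots of r could be exceptional.
  · exfalso
    refine h ((Polynomial.finite_setOfPred_isRoot hr).subset fun a ha => ?_)
    by_contra hra
    refine ha fun f hf hfd => ?_
    let ψ : (σ → Polynomial K) → K := fun v => ∑ m : σ, coeff m.1 f * (v m).eval a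
    have hψ : ∀ v ∈ Submodule.span (Polynomial K) (T '' Γ.arcs Z), ψ v = 0 := by
      intro v hv
      induction hv using Submodule.span_induction with
      | mem v hv =>
        obtain ⟨P, hP, rfl⟩ := hv
        rw [← hP a f hf]
        have hs : f = ∑ m : σ, monomial m.1 (coeff m.1 f) := by
          ext m
          by_cases hm : m.degree = d
          · rw [coeff_sum, Finset.sum_eq_single (⟨m, hσ' m hm⟩ : σ)]
            · simp
            · intro n _ hn
              rw [coeff_monomial, if_neg fun h => hn (Subtype.ext h)]
            · simp
          · rw [hfd.coeff_eq_zero hm, coeff_sum]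
            refine (Finset.sum_eq_zero fun n _ => ?_).symm
            rw [coeff_monomial, if_neg fun h : n.1 = m => hm (h ▸ hσ n)]
        conv_rhs => rw [hs]
        simp [ψ, T, eval_monomial, Finsupp.prod_fintype, Polynomial.eval_prod]
      | zero => simp [ψ]
      | add v w _ _ hv hw =>
        simp only [ψ, Pi.add_apply, Polynomial.eval_add, mul_add, Finset.sum_add_distrib] at *
        rw [hv, hw, add_zero]
      | smul c v _ hv =>
        have : ψ (c • v) = c.eval a * ψ v := by
          simp only [ψ, Pi.smul_apply, smul_eq_mul, Polynomial.eval_mul, Finset.mul_sum]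
          exact Finset.sum_congr rfl fun m _ => by ring
        rw [this, hv, mul_zero]
    ext m
    rw [coeff_zero]
    by_cases hm : m.degree = d
    · have := hψ _ (hrN (Pi.single ⟨m, hσ' m hm⟩ 1))
      simp only [ψ, Pi.smul_apply, smul_eq_mul, Polynomial.eval_mul] at this
      rw [Finset.sum_eq_single (⟨m, hσ' m hm⟩ : σ)] at this
      · simpa [show r.eval a ≠ 0 from hra] using this
      · intro n _ hn
        simp [Pi.single_eq_of_ne hn]
      · simp
    · exact hfd.coeff_eq_zero hm

/-- While F vanishes at t = a, divide it by t - a; the family ideal allows this, and the degree of a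
fixed nonzero coefficient drops, so the process ends. -/
theorem exists_specialize_ne_zero {Γ : Config (Polynomial K) ι κ} {Z : Set (Fin 4 → K)} {d : ℕ}
    (a : K) (F : Coord (Polynomial K)) (hF : F ∈ familyIdeal fun a => (Γ.evalAt a).scheme Z)
    (hd : F.IsHomogeneous d) (h0 : F ≠ 0) :
    ∃ G ∈ (familyIdeal fun a => (Γ.evalAt a).scheme Z), G.IsHomogeneous d ∧
      specialize a G ≠ 0 := by
  obtain ⟨m, hm⟩ := ne_zero_iff.1 h0
  induction hn : (coeff m F).natDegree using Nat.strong_induction_on generalizing F with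
  | _ n ih =>
    by_cases hs : specialize a F = 0
    · obtain ⟨H, rfl⟩ := exists_eq_C_mul_of_specialize_eq_zero hs
      have hX := Polynomial.X_sub_C_ne_zero a
      have hmH : coeff m H ≠ 0 := fun h => hm (by rw [coeff_C_mul, h, mul_zero])
      refine ih _ ?_ H (mem_familyIdeal_of_C_mul_mem hX hF) (fun m' hm' => hd ?_)
        (fun h => hmH (by rw [h, coeff_zero])) hmH rfl
      · rw [← hn, coeff_C_mul, Polynomial.natDegree_mul hX hmH, Polynomial.natDegree_X_sub_C]
        omega
      · rw [coeff_C_mul]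
        exact mul_ne_zero hX hm'
    · exact ⟨F, hF, hd, hs⟩

end Semicontinuity

/-! ### Limits of surfaces in an arbitrary flat family, and emptiness from trace and residual. -/

section FlatLimit

variable {K : Type*} [Field K]

/-- Monomials of degree below M multiply S into degrees below d and contribute nothing; the others
are covered by hM. -/
theorem homogeneousComponent_mem_of_monomials {R : Type*} [CommRing R] {L : Ideal (Coord R)}
    {S : Coord R} {M D d : ℕ} (hS : S.totalDegree ≤ D) (hd : M + D ≤ d)
    (hL : ∀ f ∈ L, homogeneousComponent d f ∈ L)
    (hM : ∀ m : Fin 4 →₀ ℕ, M ≤ m.degree → monomial m 1 * S ∈ L) (r : Coord R) :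
    homogeneousComponent d (r * S) ∈ L := by
  induction r using MvPolynomial.induction_on' with
  | add p q hp hq =>
    rw [add_mul, map_add]
    exact L.add_mem hp hq
  | monomial m c =>
    by_cases hm : M ≤ m.degree
    · refine hL _ ?_
      have : (monomial m c : Coord R) = C c * monomial m 1 := by
        rw [C_mul_monomial, mul_one]
      rw [this, mul_assoc]
      exact L.mul_mem_left _ (hM m hm)
    · rw [homogeneousComponent_eq_zero]
      · exact L.zero_mem
      · refine (totalDegree_mul _ _).trans_lt ?_
        have := totalDegree_monomial_le m c
        rw [Finsupp.degree_eq_sum] at hm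
        rw [Finsupp.sum_fintype _ _ (by simp)] at this
        simp only [id] at this
        omega

/-- Let `J ≤ J'` be homogeneous ideals that define the same subscheme over the point `a`. Then in
large degrees `J'` is contained in `J` up to multiples of `t - a`. -/
theorem exists_degree_bound {J J' : Ideal (Coord (Polynomial K))} (a : K)
    (hJ : ∀ f ∈ J, ∀ n, homogeneousComponent n f ∈ J)
    (hJ' : ∀ f ∈ J', ∀ n, homogeneousComponent n f ∈ J')
    (h : ∀ G ∈ J', ∀ i, ∃ n, ∃ j ∈ J, ∃ H ∈ J',
      X i ^ n * G = j + C (Polynomial.X - Polynomial.C a) * H) :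
    ∃ N, ∀ d, N ≤ d → ∀ F ∈ J', F.IsHomogeneous d → ∃ j ∈ J, ∃ H ∈ J',
      H.IsHomogeneous d ∧ F = j + C (Polynomial.X - Polynomial.C a) * H := by
  set τ : Coord (Polynomial K) := C (Polynomial.X - Polynomial.C a) with hτ
  let L : Ideal (Coord (Polynomial K)) := J ⊔ Ideal.span {τ} * J'
  have hmemL : ∀ f, f ∈ L ↔ ∃ j ∈ J, ∃ H ∈ J', f = j + τ * H := by
    intro f
    simp only [L, Submodule.mem_sup, Ideal.mem_span_singleton_mul]
    constructor
    · rintro ⟨j, hj, _, ⟨H, hH, rfl⟩, rfl⟩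
      exact ⟨j, hj, H, hH, rfl⟩
    · rintro ⟨j, hj, H, hH, rfl⟩
      exact ⟨j, hj, _, ⟨H, hH, rfl⟩, rfl⟩
  have hL : ∀ d, ∀ f ∈ L, homogeneousComponent d f ∈ L := by
    intro d f hf
    obtain ⟨j, hj, H, hH, rfl⟩ := (hmemL f).1 hf
    rw [hmemL]
    refine ⟨_, hJ j hj d, _, hJ' H hH d, ?_⟩
    rw [map_add, hτ, homogeneousComponent_C_mul]
  obtain ⟨S, hS⟩ := (inferInstance : IsNoetherian _ (Coord (Polynomial K))).noetherian J'
  have hSJ : ∀ s ∈ S, s ∈ J' := fun s hs => hS ▸ Submodule.subset_span hs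
  have h1 : ∀ s i, ∃ n, s ∈ S → X i ^ n * s ∈ L := by
    intro s i
    by_cases hs : s ∈ S
    · obtain ⟨n, hn⟩ := h s (hSJ s hs) i
      exact ⟨n, fun _ => (hmemL _).2 hn⟩
    · exact ⟨0, fun h => absurd h hs⟩
  choose n hn using h1
  let n₀ := ∑ s ∈ S, ∑ i, n s i
  have hn₀ : ∀ s ∈ S, ∀ i, n s i ≤ n₀ := fun s hs i =>
    (Finset.single_le_sum (f := fun i => n s i) (fun _ _ => Nat.zero_le _) (Finset.mem_univ i)).trans
      (Finset.single_le_sum (f := fun s => ∑ i, n s i) (fun _ _ => Nat.zero_le _) hs)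
  let D := ∑ s ∈ S, s.totalDegree
  have hD : ∀ s ∈ S, s.totalDegree ≤ D := fun s hs =>
    Finset.single_le_sum (f := fun s : Coord (Polynomial K) => s.totalDegree)
      (fun _ _ => Nat.zero_le _) hs
  have hmon : ∀ s ∈ S, ∀ m : Fin 4 →₀ ℕ, 4 * n₀ ≤ m.degree → monomial m 1 * s ∈ L := by
    intro s hs m hm
    have : ∃ i, n₀ ≤ m i := by
      by_contra! hlt
      rw [Finsupp.degree_eq_sum, Fin.sum_univ_four] at hm
      have := hlt 0
      have := hlt 1
      have := hlt 2
      have := hlt 3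
      omega
    obtain ⟨i, hi⟩ := this
    have hdvd : (X i : Coord (Polynomial K)) ^ n s i * s ∣ monomial m 1 * s := by
      refine mul_dvd_mul_right ?_ s
      rw [X_pow_eq_monomial, monomial_dvd_monomial]
      exact ⟨Or.inr (Finsupp.single_le_iff.2 ((hn₀ s hs i).trans hi)), one_dvd _⟩
    exact L.mem_of_dvd hdvd (hn s i hs)
  -- A monomial of degree at least 4 n₀ in four variables is divisible by the n₀-th power of one of
  -- them, and so carries every generator of J' into L; D bounds the degrees of the generators.
  refine ⟨4 * n₀ + D, fun d hd F hF hFd => ?_⟩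
  have hFL : F ∈ L := by
    rw [← homogeneousComponent_eq_self hFd]
    have hF' : F ∈ Submodule.span _ (S : Set (Coord (Polynomial K))) := hS ▸ hF
    obtain ⟨r, -, rfl⟩ := Submodule.mem_span_finset.1 hF'
    rw [map_sum]
    exact L.sum_mem fun s hs => homogeneousComponent_mem_of_monomials (hD s hs) hd (hL d)
      (hmon s hs) (r s)
  obtain ⟨j, hj, H, hH, e⟩ := (hmemL F).1 hFL
  refine ⟨_, hJ j hj d, _, hJ' H hH d, homogeneousComponent_isHomogeneous d H, ?_⟩
  rw [hτ, ← homogeneousComponent_C_mul, ← map_add, ← hτ, ← e, homogeneousComponent_eq_self hFd]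

/-- Nakayama's lemma in every large degree. -/
theorem exists_C_mul_mem {J J' : Ideal (Coord (Polynomial K))} {a : K} {d : ℕ}
    (h : ∀ F ∈ J', F.IsHomogeneous d → ∃ j ∈ J, ∃ H ∈ J',
      H.IsHomogeneous d ∧ F = j + C (Polynomial.X - Polynomial.C a) * H) :
    ∃ r : Polynomial K, r ≠ 0 ∧ ∀ F ∈ J', F.IsHomogeneous d → C r * F ∈ J := by
  let π : Coord (Polynomial K) →ₗ[Polynomial K] (Coord (Polynomial K) ⧸ J) :=
    (Ideal.Quotient.mkₐ (Polynomial K) J).toLinearMap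
  have hπ : ∀ F, π F = 0 ↔ F ∈ J := fun F => Ideal.Quotient.eq_zero_iff_mem
  let N' : Submodule (Polynomial K) (Coord (Polynomial K)) :=
    J'.restrictScalars (Polynomial K) ⊓ homogeneousSubmodule (Fin 4) (Polynomial K) d
  have hfg : N'.FG := by
    have := Module.Finite.iff_fg.2 (homogeneousSubmodule_fg (σ := Fin 4) (R := Polynomial K) d)
    have h2 := isNoetherian_submodule.1 (isNoetherian_of_isNoetherianRing_of_finite (Polynomial K)
      (homogeneousSubmodule (Fin 4) (Polynomial K) d))
    exact h2 N' inf_le_right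
  -- Nakayama, applied to the finitely generated image of J' in degree d, gives an annihilator r
  -- congruent to 1 modulo t - a; in particular r is nonzero.
  obtain ⟨r, hr, hrN⟩ := Submodule.exists_sub_one_mem_and_smul_eq_zero_of_fg_of_le_smul
    (Ideal.span {Polynomial.X - Polynomial.C a}) (N'.map π) (hfg.map π) (by
      rintro _ ⟨F, hF, rfl⟩
      obtain ⟨j, hj, H, hH, hHd, rfl⟩ := h F hF.1 hF.2
      rw [map_add, (hπ j).2 hj, zero_add, ← smul_eq_C_mul, map_smul]
      exact Submodule.smul_mem_smul (Ideal.mem_span_singleton_self _) ⟨H, ⟨hH, hHd⟩, rfl⟩)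
  refine ⟨r, ?_, fun F hF hFd => ?_⟩
  · rintro rfl
    rw [zero_sub, Ideal.mem_span_singleton, dvd_neg] at hr
    exact Polynomial.not_isUnit_X_sub_C a (isUnit_of_dvd_one hr)
  · have := hrN _ ⟨F, ⟨hF, hFd⟩, rfl⟩
    rwa [← map_smul, hπ, smul_eq_C_mul] at this

/-- A flat module over the domain K[t] has no torsion, so r may be cancelled on the chart where X i
is invertible. -/
theorem FlatFamily.exists_pow_mul_mem (𝓕 : FlatFamily K) {r : Polynomial K} (hr : r ≠ 0)
    {F : Coord (Polynomial K)} (h : C r * F ∈ 𝓕.ideal) (i : Fin 4) :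
    ∃ n, X i ^ n * F ∈ 𝓕.ideal := by
  have := 𝓕.flat i
  have h0 : algebraMap _ (Localization.Away (Ideal.Quotient.mk 𝓕.ideal (X i)))
      (Ideal.Quotient.mk 𝓕.ideal F) = 0 := by
    have h1 : r • algebraMap _ (Localization.Away (Ideal.Quotient.mk 𝓕.ideal (X i)))
        (Ideal.Quotient.mk 𝓕.ideal F) = 0 := by
      rw [Algebra.smul_def, IsScalarTower.algebraMap_apply (Polynomial K)
        (Coord (Polynomial K) ⧸ 𝓕.ideal), ← map_mul, IsScalarTower.algebraMap_apply (Polynomial K)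
        (Coord (Polynomial K)), Ideal.Quotient.algebraMap_eq, ← map_mul,
        MvPolynomial.algebraMap_eq, Ideal.Quotient.eq_zero_iff_mem.2 h, map_zero]
    exact (smul_eq_zero.1 h1).resolve_left hr
  rw [IsLocalization.map_eq_zero_iff (Submonoid.powers (Ideal.Quotient.mk 𝓕.ideal (X i)))] at h0
  obtain ⟨⟨_, n, rfl⟩, hn⟩ := h0
  refine ⟨n, Ideal.Quotient.eq_zero_iff_mem.1 ?_⟩
  simpa using hn

theorem planeForm_isHomogeneous (η : Fin 4 → K) : (planeForm η).IsHomogeneous 1 :=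
  IsHomogeneous.sum _ _ _ fun i _ => isHomogeneous_C_mul_X (η i) i

theorem homogeneousComponent_planeForm_mul (η : Fin 4 → K) (g : Coord K) (n : ℕ) :
    homogeneousComponent (n + 1) (planeForm η * g) = planeForm η * homogeneousComponent n g := by
  induction g using MvPolynomial.induction_on' with
  | add p q hp hq => rw [mul_add, map_add, map_add, mul_add, hp, hq]
  | monomial m c =>
    have h1 : (monomial m c : Coord K).IsHomogeneous m.degree := isHomogeneous_monomial _ rfl
    have h2 := (planeForm_isHomogeneous η).mul h1
    rw [homogeneousComponent_of_mem h2, homogeneousComponent_of_mem h1]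
    split_ifs <;> first | rfl | omega | simp

/-- Emptiness of the trace and of the residual system implies emptiness. -/
theorem isEmptySystem_of_residual {η : Fin 4 → K} {I : Ideal (Coord K)} {n : ℕ}
    (h1 : IsEmptySystem n (residual η I)) (h2 : IsEmptySystemOn η (n + 1) (trace η I)) :
    IsEmptySystem (n + 1) I := by
  intro f hf hfd
  obtain ⟨g, rfl⟩ := Ideal.mem_span_singleton.1
    (h2 f (le_saturation _ (Ideal.mem_sup_left hf)) hfd)
  -- The cofactor g of the equation of H need not be given as a form; only its component of degree n
  -- contributes to f, and that component lies in the residual ideal.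
  rw [← homogeneousComponent_eq_self hfd, homogeneousComponent_planeForm_mul]  at hf ⊢
  have := h1 (homogeneousComponent n g) (Submodule.mem_colon_singleton.2 (by
    rw [smul_eq_mul, mul_comm]; exact hf)) (homogeneousComponent_isHomogeneous n g)
  rw [this, mul_zero]

variable [Infinite K] {ι κ : Type}

/-- The flat limit of a family that consists of the schemes of a family of configurations contains
the limits of all surfaces through these schemes. -/
theorem FlatFamily.specialize_mem_fiber (𝓕 : FlatFamily K) {Γ : Config (Polynomial K) ι κ}
    {Z : Set (Fin 4 → K)} (hZ : IsArrangement Z)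
    (h : {a | 𝓕.fiber a ≠ (Γ.evalAt a).scheme Z}.Finite) {d : ℕ}
    {F : Coord (Polynomial K)} (hF : F ∈ familyIdeal fun a => (Γ.evalAt a).scheme Z)
    (hd : F.IsHomogeneous d) (b : K) : specialize b F ∈ 𝓕.fiber b := by
  set J' := familyIdeal fun a => (Γ.evalAt a).scheme Z with hJ'
  have hle : 𝓕.ideal ≤ J' := by
    intro G hG
    refine mem_familyIdeal_scheme_of_infinite h.infinite_compl fun a ha => ?_
    rw [← not_not.1 ha]
    exact le_saturation _ (Ideal.mem_map_of_mem _ hG)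
  have hhom : ∀ f ∈ J', ∀ n, homogeneousComponent n f ∈ J' := (configFamily Γ Z hZ).homogeneous
  -- At a single a where the fibre of the family is the scheme of Γ, the two ideals define the same
  -- subscheme, so in large degrees a nonzero r multiplies J' into the ideal of the family. Flatness
  -- then cancels r on each chart, whatever b is.
  obtain ⟨a, ha⟩ := h.infinite_compl.nonempty
  have ha' : 𝓕.fiber a = (Γ.evalAt a).scheme Z := not_not.1 ha
  obtain ⟨N, hN⟩ := exists_degree_bound a 𝓕.homogeneous hhom (by
    intro G hG i
    have h1 := mem_familyIdeal.1 hG a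
    rw [← ha'] at h1
    obtain ⟨n, hn⟩ := h1 i
    obtain ⟨j, hj, hjn⟩ := (Ideal.mem_map_iff_of_surjective _ (specialize_surjective a)).1 hn
    obtain ⟨H, hH⟩ := exists_eq_C_mul_of_specialize_eq_zero (a := a) (F := X i ^ n * G - j) (by
      rw [map_sub, hjn, map_mul, map_pow, map_X, sub_self])
    refine ⟨n, j, hj, H, mem_familyIdeal_of_C_mul_mem (Polynomial.X_sub_C_ne_zero a) ?_, ?_⟩
    · rw [← hH]
      exact J'.sub_mem (J'.mul_mem_left _ hG) (hle hj)
    · rw [← hH]; ring)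
  intro i
  -- The factor X i ^ N lifts F into the range of degrees where the bound holds and is harmless for
  -- saturation; 1 * N + d is the degree of the product in the form delivered by the lemmas on
  -- powers.
  obtain ⟨r, hr, hrF⟩ := exists_C_mul_mem (hN (1 * N + d) (by omega))
  obtain ⟨n, hn⟩ := 𝓕.exists_pow_mul_mem hr
    (hrF (X i ^ N * F) (J'.mul_mem_left _ hF) (((isHomogeneous_X _ i).pow N).mul hd)) i
  refine ⟨n + N, ?_⟩
  have := Ideal.mem_map_of_mem (specialize b) hn
  simpa [pow_add, mul_assoc] using this

/-- Otherwise the surfaces through infinitely many fibres yield a form over K[t]. Divided so as to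
be nonzero at b, it specializes to a forbidden surface through the fibre over b. -/
theorem FlatFamily.finite_of_isEmptySystem (𝓕 : FlatFamily K) {Γ : Config (Polynomial K) ι κ}
    {Z : Set (Fin 4 → K)} (hZ : IsArrangement Z)
    (h : {a | 𝓕.fiber a ≠ (Γ.evalAt a).scheme Z}.Finite) {d : ℕ} {b : K}
    (hb : IsEmptySystem d (𝓕.fiber b)) : {a | ¬ IsEmptySystem d (𝓕.fiber a)}.Finite := by
  by_contra hinf
  obtain ⟨F, hF, hFd, hF0⟩ := exists_mem_familyIdeal_of_infinite Γ Z d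
    ((Set.Infinite.sdiff hinf h).mono fun a ha => by
      have := not_not.1 ha.2
      have h1 := ha.1
      simp only [Set.mem_ofPred_eq] at h1 ⊢
      rwa [this] at h1)
  obtain ⟨G, hG, hGd, hG0⟩ := exists_specialize_ne_zero b F hF hFd hF0
  exact hG0 (hb _ (𝓕.specialize_mem_fiber hZ h hG hGd b) (hGd.map _))

end FlatLimit

/-! ### Sub-stars as finite unions of nonzero linear subspaces. -/

section Star

variable {K : Type*} [Field K]

theorem finrank_plane_le {η : Fin 4 → K} (hη : η ≠ 0) : Module.finrank K (plane η) ≤ 3 := by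
  have hlt : plane η < ⊤ := by
    rw [lt_top_iff_ne_top]
    rintro h
    refine hη (funext fun i => ?_)
    have : Pi.single i (1 : K) ∈ plane η := h ▸ trivial
    simpa [mem_plane, Pi.single_apply] using this
  have := Submodule.finrank_lt_finrank_of_lt hlt
  simp at this
  omega

theorem inf_ne_bot_of_le_plane {η : Fin 4 → K} (hη : η ≠ 0) {U V : Submodule K (Fin 4 → K)}
    (hU : U ≤ plane η) (hV : V ≤ plane η) (hU2 : Module.finrank K U = 2)
    (hV2 : Module.finrank K V = 2) : U ⊓ V ≠ ⊥ := by
  intro h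
  have h1 := Submodule.finrank_sup_add_finrank_inf_eq U V
  have h2 := (Submodule.finrank_mono (sup_le hU hV)).trans (finrank_plane_le hη)
  rw [h, finrank_bot] at h1
  omega

theorem isArrangement_subStar {α β : Type} [Finite α] {N : α → Submodule K (Fin 4 → K)}
    (o : β → Fin 2 → α) (hN : ∀ i j, i ≠ j → N i ⊓ N j ≠ ⊥) : IsArrangement (subStar N o) := by
  refine ⟨{p : α × α // p.1 ≠ p.2 ∧
    ∀ b, ¬ (o b 0 = p.1 ∧ o b 1 = p.2) ∧ ¬ (o b 0 = p.2 ∧ o b 1 = p.1)}, inferInstance,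
    fun p => N p.1.1 ⊓ N p.1.2, fun p => hN _ _ p.2.1, ?_⟩
  ext x
  simp only [subStar, Set.mem_iUnion, Subtype.exists, Prod.exists, exists_prop]
  exact exists_congr fun i => exists_congr fun j => by tauto

theorem isArrangement_of_isSubStar {η : Fin 4 → K} {A B : ℕ} {Z : Set (Fin 4 → K)}
    (hη : η ≠ 0) (h : IsSubStar η A B Z) : IsArrangement Z := by
  obtain ⟨N, o, hN, -, -, -, rfl⟩ := h
  exact isArrangement_subStar o fun i j _ =>
    inf_ne_bot_of_le_plane hη (hN i).1 (hN j).1 (hN i).2 (hN j).2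

end Star

/-! ### The third assertion: emptiness passes upwards. -/

section Empty

variable {K : Type*} [Field K]

/-- Emptiness passes upwards through a specialization. -/
theorem SpecParams.IsSpecialization.isEmptySystem [Infinite K] {η : Fin 4 → K} (hη : η ≠ 0)
    {b : BType} {q : SpecParams}
    {F : MvPolynomial (Label (q.LineIdx b) (q.CrossIdx b) × Fin 4) K}
    {X X₁ : Ideal (Coord K)} {𝓕 : FlatFamily K}
    (h : SpecParams.IsSpecialization η b q F X 𝓕 X₁) {n : ℕ} (h1 : IsEmptySystem n X₁)
    (h2 : IsEmptySystemOn η (n + 1) (trace η (𝓕.fiber 0))) :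
    IsEmptySystem (n + 1) (𝓕.fiber 0) ∧
      {a : K | ¬ IsEmptySystem (n + 1) (𝓕.fiber a)}.Finite := by
  obtain ⟨Γ, Y, W, Z, -, -, hZ, -, -, -, hfin, -, -, -, rfl, -, -⟩ := h
  have h0 := isEmptySystem_of_residual h1 h2
  exact ⟨h0, 𝓕.finite_of_isEmptySystem (isArrangement_of_isSubStar hη hZ)
    (hfin.subset fun a ha h => ha h.2) h0⟩

end Empty

/-! ### Open conditions and general elements of a linear space. -/

section Generic

variable {K : Type*} [Field K]

/-- Linear independence is an open condition. -/
theorem eventually_linearIndependent {E : Type*} {l : Filter E} (A : Subalgebra K (E → K)) (e₀ : E)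
    (hA : ∀ g ∈ A, g e₀ ≠ 0 → ∀ᶠ e in l, g e ≠ 0) {m : ℕ} (x : Fin m → E → Fin 4 → K)
    (hx : ∀ k i, (fun e => x k e i) ∈ A) (h : LinearIndependent K fun k => x k e₀) :
    ∀ᶠ e in l, LinearIndependent K fun k => x k e := by
  obtain ⟨R, hR⟩ := exists_rightInverse_of_linearIndependent h
  -- R is a right inverse at e₀, so this determinant equals 1 there; wherever it is nonzero the
  -- vectors are independent.
  let g : E → K := fun e => (Matrix.of (fun k => x k e) * R).det
  have hg : g ∈ A := by
    have : g = ∑ σ : Equiv.Perm (Fin m), ((Equiv.Perm.sign σ : ℤ) : E → K) *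
        ∏ k, ∑ i, (fun e => x (σ k) e i) * algebraMap K (E → K) (R i k) := by
      ext e
      simp [g, Matrix.det_apply', Matrix.mul_apply]
    rw [this]
    exact A.sum_mem fun σ _ => A.mul_mem (intCast_mem A _) (A.prod_mem fun k _ =>
      A.sum_mem fun i _ => A.mul_mem (hx _ _) (A.algebraMap_mem _))
  have h0 : g e₀ ≠ 0 := by
    change (Matrix.of (fun k => x k e₀) * R).det ≠ 0
    rw [hR, Matrix.det_one]
    exact one_ne_zero
  filter_upwards [hA g hg h0] with e he
  have h1 : Function.Injective (Matrix.of (fun k => x k e) * R).vecMul :=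
    Matrix.vecMul_injective_iff_isUnit.2
      ((Matrix.isUnit_iff_isUnit_det _).2 (isUnit_iff_ne_zero.2 he))
  refine (Matrix.vecMul_injective_iff (M := Matrix.of fun k => x k e)).1 fun c d hcd => h1 ?_
  change Matrix.vecMul c (_ * R) = Matrix.vecMul d (_ * R)
  rw [← Matrix.vecMul_vecMul, ← Matrix.vecMul_vecMul]
  exact congrArg (fun y => Matrix.vecMul y R) hcd

/-- The functions on the affine line given by polynomials. -/
def polyFun (K : Type*) [Field K] : Subalgebra K (K → K) where
  carrier := {g | ∃ P : Polynomial K, ∀ a, P.eval a = g a}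
  mul_mem' := by
    rintro f g ⟨P, hP⟩ ⟨Q, hQ⟩
    exact ⟨P * Q, fun a => by simp [hP, hQ]⟩
  add_mem' := by
    rintro f g ⟨P, hP⟩ ⟨Q, hQ⟩
    exact ⟨P + Q, fun a => by simp [hP, hQ]⟩
  algebraMap_mem' c := ⟨Polynomial.C c, fun a => by simp⟩

theorem eval_mem_polyFun (P : Polynomial K) : (fun a => P.eval a) ∈ polyFun K := ⟨P, fun _ => rfl⟩

theorem eventually_ne_zero_of_mem_polyFun {a : K} (g : K → K) (hg : g ∈ polyFun K) (ha : g a ≠ 0) :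
    ∀ᶠ b in Filter.cofinite, g b ≠ 0 := by
  obtain ⟨P, hP⟩ := hg
  have hP0 : P ≠ 0 := by
    rintro rfl
    exact ha (by rw [← hP, Polynomial.eval_zero])
  rw [Filter.eventually_cofinite]
  refine (Polynomial.finite_setOfPred_isRoot hP0).subset fun b hb => ?_
  simp only [ne_eq, not_not, Set.mem_ofPred_eq] at hb ⊢
  rw [Polynomial.IsRoot, hP, hb]

/-- Linear independence in a polynomial family of vectors is a cofinite condition. -/
theorem eventually_cofinite_linearIndependent {m : ℕ} (x : Fin m → Fin 4 → Polynomial K) (a : K)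
    (h : LinearIndependent K fun k i => (x k i).eval a) :
    ∀ᶠ b in Filter.cofinite, LinearIndependent K fun k i => (x k i).eval b :=
  eventually_linearIndependent (polyFun K) a eventually_ne_zero_of_mem_polyFun
    (fun k b i => (x k i).eval b) (fun _ _ => eval_mem_polyFun _) h

variable {Λ : Type}

/-- The functions on a space of systems of vectors that are polynomial along lines. -/
def lineRegular (K : Type*) [Field K] (Λ : Type) : Subalgebra K ((Λ → Fin 4 → K) → K) where
  carrier := {g | ∀ w w' : Λ → Fin 4 → K, ∃ P : Polynomial K,
    ∀ s, P.eval s = g (w + s • (w' - w))}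
  mul_mem' := by
    intro f g hf hg w w'
    obtain ⟨P, hP⟩ := hf w w'
    obtain ⟨Q, hQ⟩ := hg w w'
    exact ⟨P * Q, fun a => by simp [hP, hQ]⟩
  add_mem' := by
    intro f g hf hg w w'
    obtain ⟨P, hP⟩ := hf w w'
    obtain ⟨Q, hQ⟩ := hg w w'
    exact ⟨P + Q, fun a => by simp [hP, hQ]⟩
  algebraMap_mem' c := fun _ _ => ⟨Polynomial.C c, fun a => by simp⟩

theorem coord_mem_lineRegular (p : Λ) (i : Fin 4) : (fun w => w p i) ∈ lineRegular K Λ :=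
  fun w w' => ⟨Polynomial.C (w p i) + Polynomial.X * Polynomial.C (w' p i - w p i),
    fun s => by simp⟩

theorem eval_mem_lineRegular (F : MvPolynomial (Λ × Fin 4) K) :
    (fun w => eval (fun p => w p.1 p.2) F) ∈ lineRegular K Λ := by
  induction F using MvPolynomial.induction_on with
  | C c =>
    simp only [eval_C]
    exact (lineRegular K Λ).algebraMap_mem c
  | add p q hp hq =>
    simp only [map_add]
    exact (lineRegular K Λ).add_mem hp hq
  | mul_X p n hp =>
    simp only [map_mul, eval_X]
    exact (lineRegular K Λ).mul_mem hp (coord_mem_lineRegular n.1 n.2)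

variable [Infinite K]

/-- The filter of the general elements of a linear space of systems of vectors. -/
def genericFilter (S : Submodule K (Λ → Fin 4 → K)) : Filter (Λ → Fin 4 → K) where
  sets := {T | ∃ g ∈ lineRegular K Λ, (∃ w ∈ S, g w ≠ 0) ∧ ∀ w ∈ S, g w ≠ 0 → w ∈ T}
  univ_sets := ⟨1, one_mem _, ⟨0, S.zero_mem, one_ne_zero⟩, fun _ _ _ => trivial⟩
  sets_of_superset := by
    rintro T T' ⟨g, hg, h0, h⟩ hT
    exact ⟨g, hg, h0, fun w hw hgw => hT (h w hw hgw)⟩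
  inter_sets := by
    rintro T T' ⟨g, hg, ⟨w, hw, h0⟩, h⟩ ⟨g', hg', ⟨w', hw', h0'⟩, h'⟩
    refine ⟨g * g', mul_mem hg hg', ?_, fun w hw hgw => ?_⟩
    -- On the line joining the two witnesses, which stays in S, both functions are nonzero
    -- polynomials, so over an infinite field some point of it serves for both.
    · obtain ⟨P, hP⟩ := hg w w'
      obtain ⟨Q, hQ⟩ := hg' w w'
      have hPQ : P * Q ≠ 0 := by
        refine mul_ne_zero ?_ ?_
        · rintro rfl
          have := hP 0
          simp only [Polynomial.eval_zero, zero_smul, add_zero] at this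
          exact h0 this.symm
        · rintro rfl
          have := hQ 1
          simp only [Polynomial.eval_zero, one_smul, add_sub_cancel] at this
          exact h0' this.symm
      obtain ⟨s, hs⟩ : ∃ s, (P * Q).eval s ≠ 0 := by
        by_contra! h
        exact hPQ (Polynomial.funext fun s => by rw [h s, Polynomial.eval_zero])
      refine ⟨_, S.add_mem hw (S.smul_mem s (S.sub_mem hw' hw)), ?_⟩
      rwa [Polynomial.eval_mul, hP, hQ] at hs
    · rw [Pi.mul_apply] at hgw
      exact ⟨h w hw (left_ne_zero_of_mul hgw), h' w hw (right_ne_zero_of_mul hgw)⟩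

theorem eventually_mem_genericFilter (S : Submodule K (Λ → Fin 4 → K)) :
    ∀ᶠ w in genericFilter S, w ∈ S :=
  ⟨1, one_mem _, ⟨0, S.zero_mem, one_ne_zero⟩, fun _ hw _ => hw⟩

instance genericFilter_neBot (S : Submodule K (Λ → Fin 4 → K)) : (genericFilter S).NeBot := by
  refine Filter.neBot_iff.2 fun h => ?_
  have : ∀ᶠ _ in genericFilter S, False := by simp [h]
  obtain ⟨g, -, ⟨w, hw, h0⟩, h⟩ := this
  exact h w hw h0

theorem eventually_generic_ne_zero {S : Submodule K (Λ → Fin 4 → K)} {w : Λ → Fin 4 → K}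
    (hw : w ∈ S) (g : (Λ → Fin 4 → K) → K) (hg : g ∈ lineRegular K Λ) (h : g w ≠ 0) :
    ∀ᶠ w in genericFilter S, g w ≠ 0 :=
  ⟨g, hg, ⟨w, hw, h⟩, fun _ _ h => h⟩

theorem eventually_generic_linearIndependent {S : Submodule K (Λ → Fin 4 → K)} {w : Λ → Fin 4 → K}
    (hw : w ∈ S) {m : ℕ} (x : Fin m → (Λ → Fin 4 → K) → Fin 4 → K)
    (hx : ∀ k i, (fun e => x k e i) ∈ lineRegular K Λ) (h : LinearIndependent K fun k => x k w) :
    ∀ᶠ w in genericFilter S, LinearIndependent K fun k => x k w :=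
  eventually_linearIndependent (lineRegular K Λ) w (eventually_generic_ne_zero hw) x hx h

end Generic

/-! ### Bases of H and determinants. -/

section PlaneBasis

variable {K : Type*} [Field K] {η : Fin 4 → K}

theorem exists_notMem_plane (hη : η ≠ 0) : ∃ θ, θ ∉ plane η := by
  obtain ⟨i, hi⟩ := Function.ne_iff.1 hη
  exact ⟨Pi.single i 1, fun h => hi (by simpa [mem_plane, Pi.single_apply] using h)⟩

theorem three_le_finrank_plane (η : Fin 4 → K) : 3 ≤ Module.finrank K (plane η) := by
  let φ : (Fin 4 → K) →ₗ[K] K := ∑ i, η i • LinearMap.proj i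
  have h : plane η = LinearMap.ker φ := by
    ext x
    simp [mem_plane, φ]
  have h1 := LinearMap.finrank_range_add_finrank_ker φ
  have h2 := Submodule.finrank_le (LinearMap.range φ)
  rw [h]
  simp at h1 h2
  omega

theorem exists_mem_plane_notMem (η : Fin 4 → K) {S : Finset (Fin 4 → K)} (hS : S.card ≤ 2) :
    ∃ x ∈ plane η, x ∉ Submodule.span K (S : Set (Fin 4 → K)) := by
  by_contra! h
  have h1 := Submodule.finrank_mono (show plane η ≤ Submodule.span K (S : Set (Fin 4 → K)) from h)
  have h2 : Module.finrank K (Submodule.span K (S : Set (Fin 4 → K))) ≤ S.card :=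
    finrank_span_finset_le_card S
  have h3 := three_le_finrank_plane η
  omega

theorem exists_plane_basis_of_ne_zero (η : Fin 4 → K) {z : Fin 4 → K} (hz : z ≠ 0) :
    ∃ y ∈ plane η, ∃ x ∈ plane η, LinearIndependent K ![x, y, z] := by
  classical
  obtain ⟨y, hy, hy'⟩ := exists_mem_plane_notMem η (S := {z}) (by simp)
  obtain ⟨x, hx, hx'⟩ := exists_mem_plane_notMem η (S := {y, z}) Finset.card_le_two
  refine ⟨y, hy, x, hx, ?_⟩
  have h1 : LinearIndependent K ![y, z] :=
    linearIndependent_finCons.2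
      ⟨by simpa [linearIndependent_unique_iff] using hz, by simpa using hy'⟩
  exact linearIndependent_finCons.2 ⟨h1, by simpa [Set.pair_comm] using hx'⟩

theorem exists_plane_basis (η : Fin 4 → K) :
    ∃ x ∈ plane η, ∃ y ∈ plane η, ∃ z ∈ plane η, LinearIndependent K ![x, y, z] := by
  obtain ⟨z, hz, hz'⟩ := exists_mem_plane_notMem η (S := {0}) (by simp)
  obtain ⟨y, hy, x, hx, h⟩ := exists_plane_basis_of_ne_zero η (z := z) (by
    rintro rfl
    exact hz' (zero_mem _))
  exact ⟨x, hx, y, hy, z, hz, h⟩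

theorem linearIndependent_of_notMem_plane {x y z θ : Fin 4 → K} (hx : x ∈ plane η)
    (hy : y ∈ plane η) (hz : z ∈ plane η) (h : LinearIndependent K ![x, y, z]) (hθ : θ ∉ plane η) :
    LinearIndependent K ![θ, x, y, z] := by
  refine linearIndependent_finCons.2 ⟨h, fun hmem => hθ ?_⟩
  refine (Submodule.span_le.2 ?_ : Submodule.span K (Set.range ![x, y, z]) ≤ plane η) hmem
  rintro _ ⟨i, rfl⟩
  fin_cases i <;> assumption

theorem linearIndependent_four_iff {x y z w : Fin 4 → K} : LinearIndependent K ![x, y, z, w] ↔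
    ∀ a b c d : K, a • x + b • y + c • z + d • w = 0 → a = 0 ∧ b = 0 ∧ c = 0 ∧ d = 0 := by
  rw [Fintype.linearIndependent_iff]
  constructor
  · intro h a b c d habcd
    have := h ![a, b, c, d] (by simpa [Fin.sum_univ_four] using habcd)
    exact ⟨this 0, this 1, this 2, this 3⟩
  · intro h g hg
    rw [Fin.sum_univ_four] at hg
    obtain ⟨h0, h1, h2, h3⟩ := h _ _ _ _ hg
    intro i
    fin_cases i <;> assumption

theorem linearIndependent_three_iff {x y z : Fin 4 → K} : LinearIndependent K ![x, y, z] ↔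
    ∀ a b c : K, a • x + b • y + c • z = 0 → a = 0 ∧ b = 0 ∧ c = 0 := by
  rw [Fintype.linearIndependent_iff]
  constructor
  · intro h a b c habc
    have := h ![a, b, c] (by simpa [Fin.sum_univ_three] using habc)
    exact ⟨this 0, this 1, this 2⟩
  · intro h g hg
    rw [Fin.sum_univ_three] at hg
    obtain ⟨h0, h1, h2⟩ := h _ _ _ hg
    intro i
    fin_cases i <;> assumption

theorem disjoint_span_pair {x y z w : Fin 4 → K} (h : LinearIndependent K ![x, y, z, w]) :
    Disjoint (Submodule.span K {x, y}) (Submodule.span K {z, w}) := by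
  rw [Submodule.disjoint_def]
  intro v hv hv'
  obtain ⟨a, b, rfl⟩ := Submodule.mem_span_pair.1 hv
  obtain ⟨c, d, hcd⟩ := Submodule.mem_span_pair.1 hv'
  obtain ⟨ha, hb, -, -⟩ := linearIndependent_four_iff.1 h a b (-c) (-d) (by
    rw [← hcd]; module)
  simp [ha, hb]

theorem linearIndependent_of_disjoint {x y z w : Fin 4 → K} (h : LinearIndependent K ![x, y])
    (h' : LinearIndependent K ![z, w])
    (hd : Disjoint (Submodule.span K {x, y}) (Submodule.span K {z, w})) :
    LinearIndependent K ![x, y, z, w] := by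
  rw [linearIndependent_four_iff]
  intro a b c d habcd
  have h1 : a • x + b • y = -(c • z + d • w) := by
    rw [eq_neg_iff_add_eq_zero, ← habcd]; module
  have h2 : a • x + b • y = 0 := Submodule.disjoint_def.1 hd _
    (Submodule.mem_span_pair.2 ⟨a, b, rfl⟩)
    (h1 ▸ Submodule.neg_mem _ (Submodule.mem_span_pair.2 ⟨c, d, rfl⟩))
  obtain ⟨ha, hb⟩ := LinearIndependent.pair_iff.1 h a b h2
  obtain ⟨hc, hd⟩ := LinearIndependent.pair_iff.1 h' c d (neg_eq_zero.1 (h1.symm.trans h2))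
  exact ⟨ha, hb, hc, hd⟩

theorem notMem_span_pair {x y z : Fin 4 → K} (h : LinearIndependent K ![z, x, y]) (c : K)
    (hc : c • z ∈ Submodule.span K {x, y}) : c • z = 0 := by
  obtain ⟨a, b, hab⟩ := Submodule.mem_span_pair.1 hc
  obtain ⟨h0, -, -⟩ := linearIndependent_three_iff.1 h c (-a) (-b) (by rw [← hab]; module)
  rw [h0, zero_smul]

/-- The determinant with last row `θ`. -/
def detWith (θ x y z : Fin 4 → K) : K := (Matrix.of ![x, y, z, θ]).det

theorem detWith_lin (θ u v y z : Fin 4 → K) (a b : K) :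
    detWith θ (a • u + b • v) y z = a * detWith θ u y z + b * detWith θ v y z := by
  simp [detWith, Matrix.det_succ_row_zero, Fin.sum_univ_succ, Fin.succAbove]
  ring

theorem detWith_eq_zero {θ x y z : Fin 4 → K} (hx : x ∈ Submodule.span K {y, z}) :
    detWith θ x y z = 0 := by
  obtain ⟨a, b, rfl⟩ := Submodule.mem_span_pair.1 hx
  have h1 : detWith θ y y z = 0 := Matrix.det_zero_of_row_eq (i := 0) (j := 1) (by simp) rfl
  have h2 : detWith θ z y z = 0 := Matrix.det_zero_of_row_eq (i := 0) (j := 2) (by simp) rfl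
  rw [detWith_lin, h1, h2, mul_zero, mul_zero, add_zero]

theorem detWith_ne_zero {θ x y z : Fin 4 → K} (hx : x ∈ plane η)
    (hy : y ∈ plane η) (hz : z ∈ plane η) (h : LinearIndependent K ![x, y, z]) (hθ : θ ∉ plane η) :
    detWith θ x y z ≠ 0 := by
  have h1 : LinearIndependent K (Matrix.of ![x, y, z, θ]).row := by
    refine linearIndependent_four_iff.2 fun a b c d habcd => ?_
    obtain ⟨h0, h1, h2, h3⟩ := linearIndependent_four_iff.1
      (linearIndependent_of_notMem_plane hx hy hz h hθ) d a b c (by rw [← habcd]; module)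
    exact ⟨h1, h2, h3, h0⟩
  exact ((Matrix.isUnit_iff_isUnit_det _).1 (Matrix.linearIndependent_rows_iff_isUnit.1 h1)).ne_zero

theorem det_mem_lineRegular {Λ : Type} {m : ℕ} (M : (Λ → Fin 4 → K) → Matrix (Fin m) (Fin m) K)
    (h : ∀ i j, (fun w => M w i j) ∈ lineRegular K Λ) : (fun w => (M w).det) ∈ lineRegular K Λ := by
  have : (fun w => (M w).det) = ∑ σ : Equiv.Perm (Fin m),
      ((Equiv.Perm.sign σ : ℤ) : (Λ → Fin 4 → K) → K) * ∏ k, fun w => M w (σ k) k := by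
    ext w
    simp [Matrix.det_apply']
  rw [this]
  exact sum_mem fun σ _ => mul_mem (intCast_mem _ _) (prod_mem fun k _ => h _ _)

theorem detWith_mem_lineRegular {Λ : Type} (θ : Fin 4 → K) {x y z : (Λ → Fin 4 → K) → Fin 4 → K}
    (hx : ∀ i, (fun w => x w i) ∈ lineRegular K Λ) (hy : ∀ i, (fun w => y w i) ∈ lineRegular K Λ)
    (hz : ∀ i, (fun w => z w i) ∈ lineRegular K Λ) :
    (fun w => detWith θ (x w) (y w) (z w)) ∈ lineRegular K Λ := by
  refine det_mem_lineRegular _ fun i j => ?_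
  fin_cases i
  · exact hx j
  · exact hy j
  · exact hz j
  · exact (lineRegular K Λ).algebraMap_mem (θ j)

end PlaneBasis

/-! ### The linear space of special configurations. -/

section Labels

variable {ι κ : Type}

/-- The label of the first vector on a line. -/
def baseLabel : ι ⊕ κ × Fin 2 → Label ι κ
  | .inl i => .inl (i, 0)
  | .inr (j, _) => .inr (j, 0)

/-- The label of the second vector on a line. -/
def dirLabel : ι ⊕ κ × Fin 2 → Label ι κ
  | .inl i => .inl (i, 1)
  | .inr (j, e) => .inr (j, e.succ)

/-- The component that contains a line. -/
def compOf : ι ⊕ κ × Fin 2 → ι ⊕ κ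
  | .inl i => .inl i
  | .inr (j, _) => .inr j

/-- The lines of a configuration, including those of the crosses. -/
def Config.ln {K : Type*} [Field K] (Y : Config K ι κ) (a : ι ⊕ κ × Fin 2) :
    Submodule K (Fin 4 → K) :=
  Submodule.span K {Y (baseLabel a), Y (dirLabel a)}

namespace SpecParams

variable {q : SpecParams} {b : BType}

/-- The vectors that lie in `H` after the specialization. -/
def InPlane : Label (q.LineIdx b) (q.CrossIdx b) → Prop
  | .inl (.inl _, _) => True
  | .inl (.inr (.inl _), e) => e = 0
  | .inl (.inr (.inr _), _) => False
  | .inr (.inl _, e) => e ≠ 2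
  | .inr (.inr (.inl _), _) => True
  | .inr (.inr (.inr _), e) => e = 0

/-- A common label for the singular points of the sundials. -/
def root : Label (q.LineIdx b) (q.CrossIdx b) → Label (q.LineIdx b) (q.CrossIdx b)
  | .inl (.inr (.inl (j, f)), e) => if e = 0 then .inl (.inr (.inl (j, 0)), 0) else
      .inl (.inr (.inl (j, f)), e)
  | p => p

theorem root_root (p : Label (q.LineIdx b) (q.CrossIdx b)) : root (root p) = root p := by
  rcases p with ⟨i | ⟨j, f⟩ | i, e⟩ | ⟨j, e⟩
  · rfl
  · by_cases h : e = 0 <;> simp [root, h]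
  · rfl
  · rfl

theorem inPlane_root (p : Label (q.LineIdx b) (q.CrossIdx b)) : InPlane (root p) ↔ InPlane p := by
  rcases p with ⟨i | ⟨j, f⟩ | i, e⟩ | ⟨j, e⟩
  · rfl
  · by_cases h : e = 0 <;> simp [root, h, InPlane]
  · rfl
  · rfl

theorem root_baseLabel_ne_root_dirLabel (a a' : q.LineIdx b ⊕ q.CrossIdx b × Fin 2) :
    root (baseLabel a) ≠ root (dirLabel a') := by
  rcases a with (i | ⟨j, f⟩ | i) | ⟨j | j | j, e⟩ <;>
    rcases a' with (i' | ⟨j', f'⟩ | i') | ⟨j' | j' | j', e'⟩ <;>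
    simp [baseLabel, dirLabel, root, (Fin.succ_ne_zero _).symm]

theorem root_dirLabel (a : q.LineIdx b ⊕ q.CrossIdx b × Fin 2) :
    root (dirLabel a) = dirLabel a := by
  rcases a with (i | ⟨j, f⟩ | i) | ⟨j | j | j, e⟩ <;> simp [dirLabel, root]

theorem dirLabel_injective {ι κ : Type} :
    Function.Injective (dirLabel : ι ⊕ κ × Fin 2 → Label ι κ) := by
  rintro (i | ⟨j, e⟩) (i' | ⟨j', e'⟩) h <;> simp_all [dirLabel]

theorem inPlane_baseLabel {a : q.LineIdx b ⊕ q.CrossIdx b × Fin 2} (h : InPlane (dirLabel a)) :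
    InPlane (baseLabel a) := by
  rcases a with (i | ⟨j, f⟩ | i) | ⟨j | j | j, e⟩ <;> simp_all [dirLabel, baseLabel, InPlane]

/-- Two lines of different components share a base point only if they form a sundial. -/
theorem sundial_of_root_eq {a a' : q.LineIdx b ⊕ q.CrossIdx b × Fin 2} (h : compOf a ≠ compOf a')
    (hr : root (baseLabel a) = root (baseLabel a')) :
    ∃ j f f', f ≠ f' ∧ a = .inl (.inr (.inl (j, f))) ∧ a' = .inl (.inr (.inl (j, f'))) := by
  by_cases hs : ∃ j f j' f', a = .inl (.inr (.inl (j, f))) ∧ a' = .inl (.inr (.inl (j', f')))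
  · obtain ⟨j, f, j', f', rfl, rfl⟩ := hs
    have hj : j = j' := by simpa [baseLabel, root] using hr
    subst hj
    refine ⟨j, f, f', fun hf => h (by rw [hf]), rfl, rfl⟩
  · exfalso
    rcases a with (i | ⟨j, f⟩ | i) | ⟨j | j | j, e⟩ <;>
      rcases a' with (i' | ⟨j', f'⟩ | i') | ⟨j' | j' | j', e'⟩ <;>
      first
      | exact hs ⟨_, _, _, _, rfl, rfl⟩
      | (clear hs; simp_all [baseLabel, compOf, root])

/-- The linear space of specialized configurations. -/
def specialSpace {K : Type*} [Field K] (η : Fin 4 → K) :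
    Submodule K (Config K (q.LineIdx b) (q.CrossIdx b)) where
  carrier := {W | (∀ p, InPlane p → W p ∈ plane η) ∧ ∀ p, W (root p) = W p}
  zero_mem' := ⟨fun _ _ => zero_mem _, fun _ => rfl⟩
  add_mem' := fun h h' => ⟨fun p hp => add_mem (h.1 p hp) (h'.1 p hp), fun p => by
    rw [Pi.add_apply, Pi.add_apply, h.2, h'.2]⟩
  smul_mem' := fun c _ h => ⟨fun p hp => Submodule.smul_mem _ c (h.1 p hp), fun p => by
    rw [Pi.smul_apply, Pi.smul_apply, h.2]⟩

variable {K : Type*} [Field K] {η : Fin 4 → K}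

/-- Special position is a linear condition, because the two lines of a sundial share a base vector.
Hence general special configurations make sense as general points of a linear space. -/
theorem isSpecial_iff {W : Config K (q.LineIdx b) (q.CrossIdx b)} :
    IsSpecial η W ↔ W ∈ specialSpace η := by
  constructor
  · intro h
    refine ⟨?_, ?_⟩
    · rintro (⟨i | ⟨j, f⟩ | i, e⟩ | ⟨j | j | j, e⟩) hp
      · exact h.line_mem i e
      · obtain rfl : e = 0 := hp
        fin_cases f
        · exact h.sundial_mem j
        · exact (h.sundial_eq j) ▸ h.sundial_mem j
      · exact hp.elim
      · fin_cases e
        · exact h.vertex_mem _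
        · exact h.half_mem j
        · exact absurd rfl hp
      · fin_cases e
        · exact h.vertex_mem _
        · exact h.cross_mem j 0
        · exact h.cross_mem j 1
      · obtain rfl : e = 0 := hp
        exact h.vertex_mem _
    · rintro (⟨i | ⟨j, f⟩ | i, e⟩ | ⟨j, e⟩)
      · rfl
      · by_cases he : e = 0
        · subst he
          fin_cases f
          · rfl
          · exact (h.sundial_eq j).symm
        · simp [root, he]
      · rfl
      · rfl
  · intro h
    exact ⟨fun i e => h.1 _ trivial, fun j => h.1 _ rfl,
      fun j => (h.2 (.inl (.inr (.inl (j, 1)), 0))).symm,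
      fun j => h.1 _ (by rcases j with j | j | j <;> simp [InPlane]),
      fun j => h.1 _ (by simp [InPlane]), fun j e => h.1 _ trivial⟩

/-- Specialized configurations with prescribed vectors. -/
theorem exists_mem_specialSpace {n : ℕ} (f : Fin n → Label (q.LineIdx b) (q.CrossIdx b))
    (e : Fin n → Fin 4 → K) (hf : ∀ i j, i ≠ j → root (f i) = root (f j) → e i = e j)
    (he : ∀ i, InPlane (f i) → e i ∈ plane η) :
    ∃ W ∈ specialSpace (q := q) (b := b) η, ∀ i, W (f i) = e i := by
  classical
  have hf' : ∀ i j, root (f i) = root (f j) → e i = e j := fun i j h =>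
    if hij : i = j then hij ▸ rfl else hf i j hij h
  -- Each prescribed vector is spread over all labels with the same root, and every other label
  -- receives 0, which lies in H.
  refine ⟨fun p => if h : ∃ i, root (f i) = root p then e h.choose else 0, ⟨fun p hp => ?_,
    fun p => ?_⟩, fun i => ?_⟩
  · dsimp only
    split_ifs with h
    · refine he _ ?_
      rw [← inPlane_root, h.choose_spec, inPlane_root]
      exact hp
    · exact zero_mem _
  · simp only [root_root]
  · have h : ∃ j, root (f j) = root (f i) := ⟨i, rfl⟩
    dsimp only
    rw [dif_pos h]
    exact hf' _ _ h.choose_spec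

end SpecParams

end Labels

/-! ### A general special configuration is in general position. -/

namespace SpecParams

variable {q : SpecParams} {b : BType} {K : Type*} [Field K]

/-- A specialized configuration in general position with respect to the points `Z` and the
configuration `Y` that is deformed to it. -/
structure IsGood (η : Fin 4 → K) (Y : Config K (q.LineIdx b) (q.CrossIdx b)) (Z : Set (Fin 4 → K))
    (W : Config K (q.LineIdx b) (q.CrossIdx b)) : Prop where
  special : W ∈ specialSpace η
  line_indep : ∀ a, LinearIndependent K ![W (baseLabel a), W (dirLabel a)]
  cross_indep : ∀ j, LinearIndependent K ![W.vertex j, W.arm j 0, W.arm j 1]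
  dir_notMem : ∀ a, ¬ InPlane (dirLabel a) → W (dirLabel a) ∉ plane η
  disjoint : ∀ a a', compOf a ≠ compOf a' → root (baseLabel a) ≠ root (baseLabel a') →
    ¬ (InPlane (dirLabel a) ∧ InPlane (dirLabel a')) → Disjoint (W.ln a) (W.ln a')
  meet_indep : ∀ a a', compOf a ≠ compOf a' → InPlane (dirLabel a) → InPlane (dirLabel a') →
    LinearIndependent K ![W (baseLabel a), W (baseLabel a'), W (dirLabel a') - W (dirLabel a)]
  triple : ∀ a₁ a₂ a₃, InPlane (dirLabel a₁) → InPlane (dirLabel a₂) → InPlane (dirLabel a₃) →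
    compOf a₂ ≠ compOf a₁ → compOf a₂ ≠ compOf a₃ → a₁ ≠ a₃ →
    ∀ x, x ∈ W.ln a₁ → x ∈ W.ln a₂ → x ∈ W.ln a₃ → x = 0
  star : ∀ a, ∀ x ∈ Z, x ∈ W.ln a → x = 0
  sundial_indep : ∀ j, LinearIndependent K ![W (.inl (.inr (.inl (j, 0)), 0)),
    W (.inl (.inr (.inl (j, 0)), 1)), W (.inl (.inr (.inl (j, 1)), 1)),
    Y (.inl (.inr (.inl (j, 0)), 0)) - Y (.inl (.inr (.inl (j, 1)), 0))]

variable {η : Fin 4 → K}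

theorem root_dirLabel_ne_root_baseLabel (a a' : q.LineIdx b ⊕ q.CrossIdx b × Fin 2) :
    root (dirLabel a) ≠ root (baseLabel a') := (root_baseLabel_ne_root_dirLabel a' a).symm

theorem root_dirLabel_inj (a a' : q.LineIdx b ⊕ q.CrossIdx b × Fin 2) :
    root (dirLabel a) = root (dirLabel a') ↔ a = a' := by
  rw [root_dirLabel, root_dirLabel]
  exact dirLabel_injective.eq_iff

theorem root_baseLabel_ne {a a' : q.LineIdx b ⊕ q.CrossIdx b × Fin 2} (h : compOf a ≠ compOf a')
    (ha : InPlane (dirLabel a)) : root (baseLabel a) ≠ root (baseLabel a') := by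
  intro hr
  obtain ⟨j, f, f', -, rfl, -⟩ := sundial_of_root_eq h hr
  simp [dirLabel, InPlane] at ha

variable [Infinite K]

/-- Independence is open, so one special configuration suffices; prescribed vectors extend to one as
soon as they respect H and the shared base vectors. -/
theorem eventually_generic_comp_linearIndependent {m : ℕ}
    (f : Fin m → Label (q.LineIdx b) (q.CrossIdx b))
    (e : Fin m → Fin 4 → K) (hf : ∀ i j, i ≠ j → root (f i) = root (f j) → e i = e j)
    (he : ∀ i, InPlane (f i) → e i ∈ plane η) (h : LinearIndependent K e) :
    ∀ᶠ W : Config K (q.LineIdx b) (q.CrossIdx b) in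
      genericFilter (specialSpace (q := q) (b := b) η),
      LinearIndependent K (fun k => W (f k)) := by
  obtain ⟨W, hW, hWe⟩ := exists_mem_specialSpace f e hf he
  refine eventually_generic_linearIndependent hW (fun k W => W (f k))
    (fun k i => coord_mem_lineRegular _ _) ?_
  simpa only [hWe] using h

theorem eventually_line_indep (a : q.LineIdx b ⊕ q.CrossIdx b × Fin 2) :
    ∀ᶠ W : Config K (q.LineIdx b) (q.CrossIdx b) in
      genericFilter (specialSpace (q := q) (b := b) η),
      LinearIndependent K ![W (baseLabel a), W (dirLabel a)] := by
  obtain ⟨x, hx, y, hy, z, hz, h⟩ := exists_plane_basis η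
  filter_upwards [eventually_generic_comp_linearIndependent (η := η)
    ![baseLabel a, dirLabel a] ![x, y] (by simp [Fin.forall_fin_succ,
      root_baseLabel_ne_root_dirLabel, root_dirLabel_ne_root_baseLabel])
    (by simp [Fin.forall_fin_succ, hx, hy]) (LinearIndependent.pair_iff.2 fun c d hcd => by
      have := linearIndependent_three_iff.1 h c d 0 (by simpa using hcd)
      exact ⟨this.1, this.2.1⟩)] with W hW
  convert hW using 1
  ext k
  fin_cases k <;> rfl

theorem eventually_cross_indep (j : q.CrossIdx b) :
    ∀ᶠ W : Config K (q.LineIdx b) (q.CrossIdx b) in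
      genericFilter (specialSpace (q := q) (b := b) η),
      LinearIndependent K ![W.vertex j, W.arm j 0, W.arm j 1] := by
  obtain ⟨x, hx, y, hy, z, hz, h⟩ := exists_plane_basis η
  filter_upwards [eventually_generic_comp_linearIndependent (η := η) (q := q) (b := b)
    ![.inr (j, 0), .inr (j, 1), .inr (j, 2)] ![x, y, z]
    (by simp [Fin.forall_fin_succ, root]) (by simp [Fin.forall_fin_succ, hx, hy, hz]) h] with W hW
  convert hW using 1
  ext k
  fin_cases k <;> rfl

theorem eventually_dir_notMem (hη : η ≠ 0) (a : q.LineIdx b ⊕ q.CrossIdx b × Fin 2)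
    (ha : ¬ InPlane (dirLabel a)) :
    ∀ᶠ W : Config K (q.LineIdx b) (q.CrossIdx b) in
      genericFilter (specialSpace (q := q) (b := b) η),
      W (dirLabel a) ∉ plane η := by
  obtain ⟨θ, hθ⟩ := exists_notMem_plane hη
  obtain ⟨W, hW, hWe⟩ := exists_mem_specialSpace (η := η) ![dirLabel a] ![θ]
    (fun i j hij => absurd (Subsingleton.elim i j) hij)
    (by simpa [Fin.forall_fin_succ] using fun h => absurd h ha)
  refine eventually_generic_ne_zero hW (fun W => ∑ i, η i * W (dirLabel a) i) ?_ ?_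
  · have : (fun W : Config K (q.LineIdx b) (q.CrossIdx b) => ∑ i, η i * W (dirLabel a) i) =
        ∑ i, η i • fun W => W (dirLabel a) i := by
      ext W
      simp
    rw [this]
    exact sum_mem fun i _ => Subalgebra.smul_mem _ (coord_mem_lineRegular _ _) _
  · rw [show W (dirLabel a) = θ from hWe 0]
    exact hθ

/-- Example: a basis of H for the other three vectors and a vector off H for the one free direction.
-/
theorem eventually_disjoint_of_not_inPlane (hη : η ≠ 0) (a a' : q.LineIdx b ⊕ q.CrossIdx b × Fin 2)
    (hc : compOf a ≠ compOf a') (hr : root (baseLabel a) ≠ root (baseLabel a'))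
    (ha : ¬ InPlane (dirLabel a')) :
    ∀ᶠ W : Config K (q.LineIdx b) (q.CrossIdx b) in
      genericFilter (specialSpace (q := q) (b := b) η),
      Disjoint (W.ln a) (W.ln a') := by
  obtain ⟨θ, hθ⟩ := exists_notMem_plane hη
  obtain ⟨x, hx, y, hy, z, hz, h⟩ := exists_plane_basis η
  have hne : a ≠ a' := fun h => hc (h ▸ rfl)
  filter_upwards [eventually_generic_comp_linearIndependent (η := η)
    ![baseLabel a, dirLabel a, baseLabel a', dirLabel a'] ![x, y, z, θ]
    (by simp [Fin.forall_fin_succ, root_baseLabel_ne_root_dirLabel, root_dirLabel_inj,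
          root_dirLabel_ne_root_baseLabel, hr, hr.symm, hne, hne.symm])
    (by simp [Fin.forall_fin_succ, hx, hy, hz, ha])
    (linearIndependent_four_iff.2 fun c₁ c₂ c₃ c₄ hc => by
      have := linearIndependent_four_iff.1 (linearIndependent_of_notMem_plane hx hy hz h hθ)
        c₄ c₁ c₂ c₃ (by rw [← hc]; module)
      tauto)] with W hW
  refine disjoint_span_pair ?_
  convert hW using 1
  ext k
  fin_cases k <;> rfl

theorem eventually_disjoint (hη : η ≠ 0) (a a' : q.LineIdx b ⊕ q.CrossIdx b × Fin 2)
    (hc : compOf a ≠ compOf a') (hr : root (baseLabel a) ≠ root (baseLabel a'))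
    (ha : ¬ (InPlane (dirLabel a) ∧ InPlane (dirLabel a'))) :
    ∀ᶠ W : Config K (q.LineIdx b) (q.CrossIdx b) in
      genericFilter (specialSpace (q := q) (b := b) η), Disjoint (W.ln a) (W.ln a') := by
  by_cases ha' : InPlane (dirLabel a')
  · filter_upwards [eventually_disjoint_of_not_inPlane hη a' a hc.symm hr.symm
      fun h => ha ⟨h, ha'⟩] with W hW
    exact hW.symm
  · exact eventually_disjoint_of_not_inPlane hη a a' hc hr ha'

/-- This independence excludes a common nonzero point of the two lines having the same coefficient
at both direction vectors. That is what makes the two points moving into the intersection separate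
transversally to H. Example: base vectors x and y, directions 0 and z, for a basis x, y, z of H. -/
theorem eventually_meet_indep (a a' : q.LineIdx b ⊕ q.CrossIdx b × Fin 2)
    (hc : compOf a ≠ compOf a') (ha : InPlane (dirLabel a)) :
    ∀ᶠ W : Config K (q.LineIdx b) (q.CrossIdx b) in
      genericFilter (specialSpace (q := q) (b := b) η), LinearIndependent K
      ![W (baseLabel a), W (baseLabel a'), W (dirLabel a') - W (dirLabel a)] := by
  obtain ⟨x, hx, y, hy, z, hz, h⟩ := exists_plane_basis η
  have hne : a ≠ a' := fun h => hc (h ▸ rfl)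
  have hr := root_baseLabel_ne hc ha
  obtain ⟨W, hW, hWe⟩ := exists_mem_specialSpace (η := η)
    ![baseLabel a, baseLabel a', dirLabel a, dirLabel a'] ![x, y, 0, z]
    (by simp [Fin.forall_fin_succ, root_baseLabel_ne_root_dirLabel, root_dirLabel_inj,
          root_dirLabel_ne_root_baseLabel, hr, hr.symm, hne, hne.symm])
    (by simp [Fin.forall_fin_succ, hx, hy, hz])
  have h0 : W (baseLabel a) = x := hWe 0
  have h1 : W (baseLabel a') = y := hWe 1
  have h2 : W (dirLabel a) = 0 := hWe 2
  have h3 : W (dirLabel a') = z := hWe 3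
  filter_upwards [eventually_generic_linearIndependent hW ![fun W => W (baseLabel a),
    fun W => W (baseLabel a'), fun W => W (dirLabel a') - W (dirLabel a)] (by
      intro k i
      fin_cases k
      · exact coord_mem_lineRegular _ _
      · exact coord_mem_lineRegular _ _
      · exact sub_mem (coord_mem_lineRegular (dirLabel a') i) (coord_mem_lineRegular _ _)) (by
      convert h using 1
      ext k
      fin_cases k <;> simp [h0, h1, h2, h3])] with W hW
  convert hW using 1
  ext k
  fin_cases k <;> rfl

/-- Example: the three sides of a triangle in H. The lines a₁ and a₃ may belong to one cross or one
sundial and share a base vector, so both receive the base vector z. -/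
theorem eventually_triple (hη : η ≠ 0) (a₁ a₂ a₃ : q.LineIdx b ⊕ q.CrossIdx b × Fin 2)
    (h₂ : InPlane (dirLabel a₂))
    (h₂₁ : compOf a₂ ≠ compOf a₁) (h₂₃ : compOf a₂ ≠ compOf a₃) (h₁₃ : a₁ ≠ a₃) :
    ∀ᶠ W : Config K (q.LineIdx b) (q.CrossIdx b) in
      genericFilter (specialSpace (q := q) (b := b) η),
      ∀ x, x ∈ W.ln a₁ → x ∈ W.ln a₂ → x ∈ W.ln a₃ → x = 0 := by
  obtain ⟨θ, hθ⟩ := exists_notMem_plane hη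
  obtain ⟨x, hx, y, hy, z, hz, h⟩ := exists_plane_basis η
  have hne₁ : a₂ ≠ a₁ := fun h => h₂₁ (h ▸ rfl)
  have hne₃ : a₂ ≠ a₃ := fun h => h₂₃ (h ▸ rfl)
  have hr₁ := root_baseLabel_ne h₂₁ h₂
  have hr₃ := root_baseLabel_ne h₂₃ h₂
  obtain ⟨W, hW, hWe⟩ := exists_mem_specialSpace (η := η)
    ![baseLabel a₂, dirLabel a₂, baseLabel a₃, dirLabel a₃, baseLabel a₁, dirLabel a₁]
    ![x, y, z, y, z, x]
    (by simp [Fin.forall_fin_succ, root_baseLabel_ne_root_dirLabel, root_dirLabel_inj,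
          root_dirLabel_ne_root_baseLabel, hr₁, hr₁.symm, hr₃, hr₃.symm, hne₁, hne₁.symm, hne₃,
          hne₃.symm, h₁₃, h₁₃.symm])
    (by simp [Fin.forall_fin_succ, hx, hy, hz])
  have e0 : W (baseLabel a₂) = x := hWe 0
  have e1 : W (dirLabel a₂) = y := hWe 1
  have e2 : W (baseLabel a₃) = z := hWe 2
  have e3 : W (dirLabel a₃) = y := hWe 3
  have e4 : W (baseLabel a₁) = z := hWe 4
  have e5 : W (dirLabel a₁) = x := hWe 5
  have hxzy : LinearIndependent K ![x, z, y] := linearIndependent_three_iff.2 fun c₁ c₂ c₃ hc => by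
    have := linearIndependent_three_iff.1 h c₁ c₃ c₂ (by rw [← hc]; module)
    tauto
  have hyzx : LinearIndependent K ![y, z, x] := linearIndependent_three_iff.2 fun c₁ c₂ c₃ hc => by
    have := linearIndependent_three_iff.1 h c₃ c₁ c₂ (by rw [← hc]; module)
    tauto
  let D (p₁ p₂ p₃ : Label (q.LineIdx b) (q.CrossIdx b))
    (W : Config K (q.LineIdx b) (q.CrossIdx b)) : K := detWith θ (W p₁) (W p₂) (W p₃)
  have hD : ∀ p₁ p₂ p₃, D p₁ p₂ p₃ ∈ lineRegular K _ := fun p₁ p₂ p₃ =>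
    detWith_mem_lineRegular θ (fun i => coord_mem_lineRegular p₁ i)
      (fun i => coord_mem_lineRegular p₂ i) (fun i => coord_mem_lineRegular p₃ i)
  -- A point of a₂ with coefficients β and γ that lies on a₃ and on a₁ satisfies two linear
  -- equations in β and γ. The function required to be nonzero is the determinant of this system.
  filter_upwards [eventually_generic_ne_zero hW
    (D (baseLabel a₂) (baseLabel a₃) (dirLabel a₃) * D (dirLabel a₂) (baseLabel a₁) (dirLabel a₁) -
      D (dirLabel a₂) (baseLabel a₃) (dirLabel a₃) * D (baseLabel a₂) (baseLabel a₁) (dirLabel a₁))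
    (sub_mem (mul_mem (hD _ _ _) (hD _ _ _)) (mul_mem (hD _ _ _) (hD _ _ _))) (by
      simp only [Pi.sub_apply, Pi.mul_apply, D, e0, e1, e2, e3, e4, e5]
      rw [show detWith θ y z y = 0 from detWith_eq_zero (Submodule.subset_span (by simp)), zero_mul,
        sub_zero]
      exact mul_ne_zero (detWith_ne_zero hx hz hy hxzy hθ) (detWith_ne_zero hy hz hx hyzx hθ))]
    with W hW v hv₁ hv₂ hv₃
  obtain ⟨β, γ, rfl⟩ := Submodule.mem_span_pair.1 hv₂
  have h1 := detWith_eq_zero (θ := θ) hv₁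
  have h3 := detWith_eq_zero (θ := θ) hv₃
  rw [detWith_lin] at h1 h3
  simp only [Pi.sub_apply, Pi.mul_apply, D] at hW
  have hβ : β = 0 := by
    refine (mul_eq_zero.1 ?_).resolve_right hW
    linear_combination detWith θ (W (dirLabel a₂)) (W (baseLabel a₁)) (W (dirLabel a₁)) * h3 -
      detWith θ (W (dirLabel a₂)) (W (baseLabel a₃)) (W (dirLabel a₃)) * h1
  have hγ : γ = 0 := by
    refine (mul_eq_zero.1 ?_).resolve_right hW
    linear_combination detWith θ (W (baseLabel a₂)) (W (baseLabel a₃)) (W (dirLabel a₃)) * h1 -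
      detWith θ (W (baseLabel a₂)) (W (baseLabel a₁)) (W (dirLabel a₁)) * h3
  rw [hβ, hγ, zero_smul, zero_smul, add_zero]

theorem eventually_star (a : q.LineIdx b ⊕ q.CrossIdx b × Fin 2) {z : Fin 4 → K} (hz : z ≠ 0) :
    ∀ᶠ W : Config K (q.LineIdx b) (q.CrossIdx b) in
      genericFilter (specialSpace (q := q) (b := b) η),
      LinearIndependent K ![z, W (baseLabel a), W (dirLabel a)] := by
  obtain ⟨y, hy, x, hx, h⟩ := exists_plane_basis_of_ne_zero η hz
  obtain ⟨W, hW, hWe⟩ := exists_mem_specialSpace (η := η)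
    ![baseLabel a, dirLabel a] ![x, y] (by simp [Fin.forall_fin_succ,
      root_baseLabel_ne_root_dirLabel, root_dirLabel_ne_root_baseLabel])
    (by simp [Fin.forall_fin_succ, hx, hy])
  have h0 : W (baseLabel a) = x := hWe 0
  have h1 : W (dirLabel a) = y := hWe 1
  filter_upwards [eventually_generic_linearIndependent hW ![fun _ => z, fun W => W (baseLabel a),
    fun W => W (dirLabel a)] (by
      intro k i
      fin_cases k
      · exact (lineRegular K _).algebraMap_mem (z i)
      · exact coord_mem_lineRegular _ _
      · exact coord_mem_lineRegular _ _) (by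
      have : LinearIndependent K ![z, x, y] := linearIndependent_three_iff.2 fun c₁ c₂ c₃ hc => by
        have := linearIndependent_three_iff.1 h c₂ c₃ c₁ (by rw [← hc]; module)
        tauto
      convert this using 1
      ext k
      fin_cases k <;> simp [h0, h1])] with W hW
  convert hW using 1
  ext k
  fin_cases k <;> rfl

/-- Example: complete w to a basis x, y, w of H, and take x as singular point, y on one line and a
vector off H on the other. The vector w will be the difference of the base vectors of the two lines
before the specialization. -/
theorem eventually_sundial_indep (hη : η ≠ 0) (j : Fin q.s) {w : Fin 4 → K} (hw : w ∈ plane η)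
    (hw0 : w ≠ 0) :
    ∀ᶠ W : Config K (q.LineIdx b) (q.CrossIdx b) in
      genericFilter (specialSpace (q := q) (b := b) η),
      LinearIndependent K ![W (.inl (.inr (.inl (j, 0)), 0)),
        W (.inl (.inr (.inl (j, 0)), 1)), W (.inl (.inr (.inl (j, 1)), 1)), w] := by
  obtain ⟨θ, hθ⟩ := exists_notMem_plane hη
  obtain ⟨y, hy, x, hx, h⟩ := exists_plane_basis_of_ne_zero η hw0
  obtain ⟨W, hW, hWe⟩ := exists_mem_specialSpace (η := η) (q := q) (b := b)
    ![.inl (.inr (.inl (j, 0)), 0), .inl (.inr (.inl (j, 0)), 1), .inl (.inr (.inl (j, 1)), 1)]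
    ![x, y, θ] (by simp [Fin.forall_fin_succ, root])
    (by simp [Fin.forall_fin_succ, hx, hy, InPlane])
  have h0 : W (.inl (.inr (.inl (j, 0)), 0)) = x := hWe 0
  have h1 : W (.inl (.inr (.inl (j, 0)), 1)) = y := hWe 1
  have h2 : W (.inl (.inr (.inl (j, 1)), 1)) = θ := hWe 2
  filter_upwards [eventually_generic_linearIndependent hW
    ![fun W => W (.inl (.inr (.inl (j, 0)), 0)), fun W => W (.inl (.inr (.inl (j, 0)), 1)),
      fun W => W (.inl (.inr (.inl (j, 1)), 1)), fun _ => w] (by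
      intro k i
      fin_cases k
      · exact coord_mem_lineRegular _ _
      · exact coord_mem_lineRegular _ _
      · exact coord_mem_lineRegular _ _
      · exact (lineRegular K _).algebraMap_mem (w i)) (by
      have : LinearIndependent K ![x, y, θ, w] :=
        linearIndependent_four_iff.2 fun c₁ c₂ c₃ c₄ hc => by
          have := linearIndependent_four_iff.1 (linearIndependent_of_notMem_plane hx hy hw h hθ)
            c₃ c₁ c₂ c₄ (by rw [← hc]; module)
          tauto
      convert this using 1
      ext k
      fin_cases k <;> simp [h0, h1, h2])] with W hW
  convert hW using 1
  ext k
  fin_cases k <;> rfl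

/-- A general specialized configuration is in general position. -/
theorem eventually_isGood (hη : η ≠ 0) (Y : Config K (q.LineIdx b) (q.CrossIdx b))
    (hY : ∀ j, Y (.inl (.inr (.inl (j, 0)), 0)) - Y (.inl (.inr (.inl (j, 1)), 0)) ∈ plane η)
    (hY0 : ∀ j, Y (.inl (.inr (.inl (j, 0)), 0)) - Y (.inl (.inr (.inl (j, 1)), 0)) ≠ 0)
    {Z : Set (Fin 4 → K)} {τ : Type} [Finite τ] (z : τ → Fin 4 → K) (hz : ∀ k, z k ≠ 0)
    (hZ : ∀ x ∈ Z, ∃ k, ∃ c : K, c • z k = x) :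
    ∀ᶠ W : Config K (q.LineIdx b) (q.CrossIdx b) in
      genericFilter (specialSpace (q := q) (b := b) η), IsGood η Y Z W := by
  have h2 := Filter.eventually_all.2 fun a => eventually_line_indep (η := η) (q := q) (b := b) a
  have h3 := Filter.eventually_all.2 fun a => eventually_cross_indep (η := η) (q := q) (b := b) a
  have h4 := Filter.eventually_all.2 fun a => Filter.eventually_all.2 fun ha =>
    eventually_dir_notMem (q := q) (b := b) hη a ha
  have h5 := Filter.eventually_all.2 fun a => Filter.eventually_all.2 fun a' =>
    Filter.eventually_all.2 fun hc => Filter.eventually_all.2 fun hr =>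
    Filter.eventually_all.2 fun ha => eventually_disjoint (q := q) (b := b) hη a a' hc hr ha
  have h6 := Filter.eventually_all.2 fun a => Filter.eventually_all.2 fun a' =>
    Filter.eventually_all.2 fun hc => Filter.eventually_all.2 fun ha =>
    eventually_meet_indep (q := q) (b := b) (η := η) a a' hc ha
  have h7 := Filter.eventually_all.2 fun a₁ => Filter.eventually_all.2 fun a₂ =>
    Filter.eventually_all.2 fun a₃ => Filter.eventually_all.2 fun h₂ =>
    Filter.eventually_all.2 fun h₂₁ => Filter.eventually_all.2 fun h₂₃ =>
    Filter.eventually_all.2 fun h₁₃ =>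
    eventually_triple (q := q) (b := b) hη a₁ a₂ a₃ h₂ h₂₁ h₂₃ h₁₃
  have h8 := Filter.eventually_all.2 fun a => Filter.eventually_all.2 fun k =>
    eventually_star (η := η) (q := q) (b := b) a (hz k)
  have h9 := Filter.eventually_all.2 fun j =>
    eventually_sundial_indep (q := q) (b := b) hη j (hY j) (hY0 j)
  filter_upwards [eventually_mem_genericFilter _, h2, h3, h4, h5, h6, h7, h8, h9] with
    W h1 h2 h3 h4 h5 h6 h7 h8 h9
  refine ⟨h1, h2, h3, h4, h5, fun a a' hc ha _ => h6 a a' hc ha,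
    fun a₁ a₂ a₃ _ ha₂ _ h₂₁ h₂₃ h₁₃ => h7 a₁ a₂ a₃ ha₂ h₂₁ h₂₃ h₁₃, fun a x hx hxa => ?_, h9⟩
  obtain ⟨k, c, rfl⟩ := hZ x hx
  exact notMem_span_pair (h8 a k) c hxa

end SpecParams

/-! ### Normalized descriptions of nondegenerate configurations. -/

section Nondegenerate

variable {K : Type*} [Field K] {η : Fin 4 → K} {ι κ : Type} {Y : Config K ι κ}
  {Z : Set (Fin 4 → K)}

theorem mem_plane_iff_dotProduct {x : Fin 4 → K} : x ∈ plane η ↔ η ⬝ᵥ x = 0 := Iff.rfl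

/-- Every line is described by a vector in `H` and a vector on which the equation of `H` has the
value `1`. -/
def Config.IsNormalized (η : Fin 4 → K) (Y : Config K ι κ) : Prop :=
  ∀ a, Y (baseLabel a) ∈ plane η ∧ η ⬝ᵥ Y (dirLabel a) = 1

/-- After exchanging the vectors if necessary, v is off H: rescale it to value 1 and subtract from u
the multiple of v that moves it into H. -/
theorem exists_normalized_pair {u v : Fin 4 → K} (h : LinearIndependent K ![u, v])
    (hn : ¬ Submodule.span K {u, v} ≤ plane η) : ∃ u' v', Submodule.span K {u', v'} =
      Submodule.span K {u, v} ∧ LinearIndependent K ![u', v'] ∧ u' ∈ plane η ∧ η ⬝ᵥ v' = 1 := by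
  wlog hv : η ⬝ᵥ v ≠ 0 generalizing u v
  · push Not at hv
    have hu : η ⬝ᵥ u ≠ 0 := fun hu => hn (Submodule.span_le.2 (by
      rintro _ (rfl | rfl)
      exacts [hu, hv]))
    obtain ⟨u', v', h1, h2⟩ := this (LinearIndependent.pair_symm_iff.1 h)
      (by rwa [Set.pair_comm]) hu
    exact ⟨u', v', by rw [h1, Set.pair_comm], h2⟩
  set c := (η ⬝ᵥ v)⁻¹ with hc
  have hc0 : c ≠ 0 := inv_ne_zero hv
  have hcv : c * (η ⬝ᵥ v) = 1 := inv_mul_cancel₀ hv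
  refine ⟨u - (c * (η ⬝ᵥ u)) • v, c • v, le_antisymm ?_ ?_, ?_, ?_, ?_⟩
  · rw [Submodule.span_le, Set.insert_subset_iff, Set.singleton_subset_iff]
    exact ⟨Submodule.mem_span_pair.2 ⟨1, -(c * (η ⬝ᵥ u)), by module⟩,
      Submodule.mem_span_pair.2 ⟨0, c, by module⟩⟩
  · rw [Submodule.span_le, Set.insert_subset_iff, Set.singleton_subset_iff]
    refine ⟨Submodule.mem_span_pair.2 ⟨1, η ⬝ᵥ u, ?_⟩, Submodule.mem_span_pair.2 ⟨0, η ⬝ᵥ v, ?_⟩⟩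
    · rw [smul_smul, mul_comm (η ⬝ᵥ u) c]
      module
    · rw [smul_smul, mul_comm (η ⬝ᵥ v) c, hcv]
      module
  · rw [LinearIndependent.pair_iff] at h ⊢
    intro s t hst
    obtain ⟨h1, h2⟩ := h s (t * c - s * (c * (η ⬝ᵥ u))) (by rw [← hst]; module)
    rw [h1] at h2
    simpa [h1, hc0] using h2
  · rw [mem_plane_iff_dotProduct, dotProduct_sub, dotProduct_smul, smul_eq_mul]
    linear_combination (-(η ⬝ᵥ u)) * hcv
  · rw [dotProduct_smul, smul_eq_mul, hcv]

namespace Config.IsNondegenerate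

theorem transfer {ι' κ' : Type} (hY : Y.IsNondegenerate η Z) {Y' : Config K ι' κ'} {g : ι' → ι}
    {k : κ' → κ} (hg : Function.Injective g) (hk : Function.Injective k)
    (hl : ∀ i, Y'.line i = Y.line (g i)) (hc : ∀ j e, Y'.crossLine j e = Y.crossLine (k j) e)
    (h1 : ∀ i, LinearIndependent K ![Y' (.inl (i, 0)), Y' (.inl (i, 1))])
    (h2 : ∀ j, Y'.vertex j ∈ plane η)
    (h3 : ∀ j, LinearIndependent K ![Y'.vertex j, Y'.arm j 0, Y'.arm j 1])
    (h4 : ∀ j e, Y'.arm j e ∉ plane η) : Y'.IsNondegenerate η Z where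
  line_indep := h1
  line_not_le i := by rw [hl]; exact hY.line_not_le _
  vertex_mem := h2
  cross_indep := h3
  arm_notMem := h4
  line_line i i' h := by rw [hl, hl]; exact hY.line_line _ _ (hg.ne h)
  line_cross i j e := by rw [hl, hc]; exact hY.line_cross _ _ _
  cross_cross j j' e e' h := by rw [hc, hc]; exact hY.cross_cross _ _ _ _ (hk.ne h)
  line_star i := by rw [hl]; exact hY.line_star _
  cross_star j e := by rw [hc]; exact hY.cross_star _ _

/-- Only the spanning vectors and the labels change, not the set of lines. With value 1 on every
direction vector, the equation of H reads off the direction coefficient of a point, which later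
shows that colliding points separate out of H. -/
theorem exists_normalized {ι' κ' : Type} (hY : Y.IsNondegenerate η Z) (g : ι' ≃ ι) (k : κ' ≃ κ) :
    ∃ Y' : Config K ι' κ', Y'.IsNondegenerate η Z ∧ Y'.scheme Z = Y.scheme Z ∧
      Y'.IsNormalized η := by
  choose u v huv hi hu hv using fun i => exists_normalized_pair (hY.line_indep i) (hY.line_not_le i)
  let d (j : κ) (e : Fin 2) : K := (η ⬝ᵥ Y.arm j e)⁻¹
  have hd0 : ∀ j e, d j e ≠ 0 := fun j e => inv_ne_zero (hY.arm_notMem j e)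
  have hd : ∀ j e, η ⬝ᵥ (d j e • Y.arm j e) = 1 := fun j e => by
    rw [dotProduct_smul, smul_eq_mul]
    exact inv_mul_cancel₀ (hY.arm_notMem j e)
  let Y' : Config K ι' κ' := Sum.elim (fun p => ![u (g p.1), v (g p.1)] p.2)
    fun p => ![Y.vertex (k p.1), d (k p.1) 0 • Y.arm (k p.1) 0, d (k p.1) 1 • Y.arm (k p.1) 1] p.2
  have harm : ∀ j e, Y'.arm j e = d (k j) e • Y.arm (k j) e := fun j e => by
    fin_cases e <;> rfl
  have hl : ∀ i, Y'.line i = Y.line (g i) := fun i => huv (g i)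
  have hc : ∀ j e, Y'.crossLine j e = Y.crossLine (k j) e := fun j e => by
    rw [Config.crossLine, Config.crossLine, harm, Submodule.span_insert,
      Submodule.span_singleton_smul_eq (hd0 _ _).isUnit, ← Submodule.span_insert]
    rfl
  refine ⟨Y', hY.transfer g.injective k.injective hl hc (fun i => hi _) (fun j => hY.vertex_mem _)
    (fun j => ?_) (fun j e h => ?_), ?_, ?_⟩
  · rw [harm, harm]
    have := linearIndependent_three_iff.1 (hY.cross_indep (k j))
    refine linearIndependent_three_iff.2 fun x y z h => ?_
    obtain ⟨h1, h2, h3⟩ := this x (y * d (k j) 0) (z * d (k j) 1) (by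
      rw [← h]
      show _ = x • Y.vertex (k j) + _ + _
      module)
    exact ⟨h1, (mul_eq_zero.1 h2).resolve_right (hd0 _ _),
      (mul_eq_zero.1 h3).resolve_right (hd0 _ _)⟩
  · rw [harm, mem_plane_iff_dotProduct, hd] at h
    exact one_ne_zero h
  · ext f
    simp only [Config.mem_scheme, hl, hc]
    rw [g.forall_congr_left, k.forall_congr_left]
    simp
  · rintro (i | ⟨j, e⟩)
    · exact ⟨hu _, hv _⟩
    · exact ⟨hY.vertex_mem _, by rw [← hd (k j) e, ← harm]; rfl⟩

theorem ln_indep (hY : Y.IsNondegenerate η Z) (a : ι ⊕ κ × Fin 2) :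
    LinearIndependent K ![Y (baseLabel a), Y (dirLabel a)] := by
  rcases a with i | ⟨j, e⟩
  · exact hY.line_indep i
  · have h := linearIndependent_three_iff.1 (hY.cross_indep j)
    rw [LinearIndependent.pair_iff]
    intro s t hst
    fin_cases e
    · have := h s t 0 (by rw [zero_smul, add_zero]; exact hst)
      exact ⟨this.1, this.2.1⟩
    · have := h s 0 t (by rw [zero_smul, add_zero]; exact hst)
      exact ⟨this.1, this.2.2⟩

theorem disjoint_ln (hY : Y.IsNondegenerate η Z) {a a' : ι ⊕ κ × Fin 2}
    (h : compOf a ≠ compOf a') : Disjoint (Y.ln a) (Y.ln a') := by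
  rcases a with i | ⟨j, e⟩ <;> rcases a' with i' | ⟨j', e'⟩
  · exact hY.line_line _ _ fun h' => h (by rw [h'])
  · exact hY.line_cross _ _ _
  · exact (hY.line_cross _ _ _).symm
  · exact hY.cross_cross _ _ _ _ fun h' => h (by simp [compOf, h'])

theorem eq_zero_of_mem_ln (hY : Y.IsNondegenerate η Z) (a : ι ⊕ κ × Fin 2) {x : Fin 4 → K}
    (hx : x ∈ Z) (hxa : x ∈ Y.ln a) : x = 0 := by
  rcases a with i | ⟨j, e⟩
  · exact hY.line_star _ _ hx hxa
  · exact hY.cross_star _ _ _ hx hxa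

theorem of_ln (h1 : ∀ i, LinearIndependent K ![Y (.inl (i, 0)), Y (.inl (i, 1))])
    (h2 : ∀ a, Y (dirLabel a) ∉ plane η) (h3 : ∀ j, Y.vertex j ∈ plane η)
    (h4 : ∀ j, LinearIndependent K ![Y.vertex j, Y.arm j 0, Y.arm j 1])
    (h5 : ∀ a a', compOf a ≠ compOf a' → Disjoint (Y.ln a) (Y.ln a'))
    (h6 : ∀ a, ∀ x ∈ Z, x ∈ Y.ln a → x = 0) : Y.IsNondegenerate η Z where
  line_indep := h1
  line_not_le i h := h2 (.inl i) (h (Submodule.subset_span (by simp [dirLabel])))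
  vertex_mem := h3
  cross_indep := h4
  arm_notMem j e := h2 (.inr (j, e))
  line_line i i' h := h5 (.inl i) (.inl i') (by simpa [compOf] using h)
  line_cross i j e := h5 (.inl i) (.inr (j, e)) (by simp [compOf])
  cross_cross j j' e e' h := h5 (.inr (j, e)) (.inr (j', e')) (by simpa [compOf] using h)
  line_star i := h6 (.inl i)
  cross_star j e := h6 (.inr (j, e))

end Config.IsNondegenerate

theorem finrank_inf_eq_one (hη : η ≠ 0) {U V : Submodule K (Fin 4 → K)}
    (hU : U ≤ plane η) (hV : V ≤ plane η) (hU2 : Module.finrank K U = 2)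
    (hV2 : Module.finrank K V = 2) (hUV : U ≠ V) : Module.finrank K ↥(U ⊓ V) = 1 := by
  have h0 := inf_ne_bot_of_le_plane hη hU hV hU2 hV2
  have h1 : U ⊓ V < U := lt_of_le_of_ne inf_le_left fun h => hUV
    (Submodule.eq_of_le_of_finrank_eq (inf_eq_left.1 h) (hU2.trans hV2.symm))
  have h2 := Submodule.finrank_lt_finrank_of_lt h1
  have h3 : Module.finrank K ↥(U ⊓ V) ≠ 0 := fun h => h0 (Submodule.finrank_eq_zero.1 h)
  omega

/-- Nonzero vectors that represent the points of a sub-star. -/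
theorem IsSubStar.exists_points (hη : η ≠ 0) {A B : ℕ} (h : IsSubStar η A B Z) :
    ∃ (τ : Type) (_ : Finite τ) (z : τ → Fin 4 → K), (∀ k, z k ≠ 0) ∧ (∀ k, z k ∈ Z) ∧
      ∀ x ∈ Z, ∃ k, ∃ c : K, c • z k = x := by
  obtain ⟨N, o, hN, hne, -, -, rfl⟩ := h
  have h1 : ∀ p : {p : Fin A × Fin A // p.1 ≠ p.2 ∧
      ∀ b, ¬ (o b 0 = p.1 ∧ o b 1 = p.2) ∧ ¬ (o b 0 = p.2 ∧ o b 1 = p.1)}, ∃ z : Fin 4 → K,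
      z ≠ 0 ∧ z ∈ subStar N o ∧ ∀ x ∈ N p.1.1 ⊓ N p.1.2, ∃ c : K, c • z = x := by
    rintro ⟨⟨i, j⟩, hij, ho⟩
    obtain ⟨⟨z, hz⟩, hz0, hz'⟩ := finrank_eq_one_iff'.1
      (finrank_inf_eq_one hη (hN i).1 (hN j).1 (hN i).2 (hN j).2 (hne i j hij))
    refine ⟨z, fun h => hz0 (by simpa using h), ?_, fun x hx => ?_⟩
    · simp only [subStar, Set.mem_iUnion]
      exact ⟨i, j, hij, ho, hz⟩
    · obtain ⟨c, hc⟩ := hz' ⟨x, hx⟩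
      exact ⟨c, congrArg Subtype.val hc⟩
  choose z hz hzZ hz' using h1
  refine ⟨_, inferInstance, z, hz, hzZ, fun x hx => ?_⟩
  simp only [subStar, Set.mem_iUnion] at hx
  obtain ⟨i, j, hij, ho, hx⟩ := hx
  exact ⟨⟨(i, j), hij, ho⟩, hz' ⟨(i, j), hij, ho⟩ x hx⟩

theorem IsB.exists_normalized {q : SpecParams} {b : BType} (hq : q.Fits b) {X : Ideal (Coord K)}
    (h : IsB η b X) : ∃ (Y : Config K (q.LineIdx b) (q.CrossIdx b)) (Z : Set (Fin 4 → K)),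
      IsSubStar η b.A b.B Z ∧ Y.IsNondegenerate η Z ∧ X = Y.scheme Z ∧ Y.IsNormalized η := by
  obtain ⟨Y, Z, hZ, hY, rfl⟩ := h
  obtain ⟨hL, hC⟩ := hq
  have e₁ : q.LineIdx b ≃ Fin b.L := Fintype.equivFinOfCardEq (by simp; omega)
  have e₂ : q.CrossIdx b ≃ Fin b.C := Fintype.equivFinOfCardEq (by simp; omega)
  obtain ⟨Y', h1, h2, h3⟩ := hY.exists_normalized e₁ e₂
  exact ⟨Y', Z, hZ, h1, h2.symm, h3⟩

end Nondegenerate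

/-! ### Nearby members of a family, and first order conditions where lines collide. -/

section Family

variable {K : Type*} [Field K] {η : Fin 4 → K} {ι κ : Type} {Z : Set (Fin 4 → K)}

theorem eventually_notMem_plane [Infinite K] (x : Fin 4 → Polynomial K) {a₀ : K}
    (h : (fun i => (x i).eval a₀) ∉ plane η) :
    ∀ᶠ a in Filter.cofinite, (fun i => (x i).eval a) ∉ plane η := by
  let P : Polynomial K := ∑ i, Polynomial.C (η i) * x i
  have hP : ∀ a, P.eval a = ∑ i, η i * (x i).eval a := fun a => by
    simp [P, Polynomial.eval_finsetSum]
  have hP0 : P ≠ 0 := fun h0 => h (by rw [mem_plane, ← hP, h0, Polynomial.eval_zero])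
  filter_upwards [(Polynomial.finite_setOfPred_isRoot hP0).compl_mem_cofinite] with a ha h
  exact ha (by rwa [mem_plane, ← hP] at h)

/-- All but finitely many members of a family of configurations with vertices in `H` are
non-degenerate if one of them is. -/
theorem eventually_isNondegenerate [Infinite K] [Finite ι] [Finite κ]
    (Γ : Config (Polynomial K) ι κ)
    (hv : ∀ j a, (Γ.evalAt a).vertex j ∈ plane η) {a₀ : K}
    (h : (Γ.evalAt a₀).IsNondegenerate η Z) (h' : ∀ a, (Γ.evalAt a₀) (dirLabel a) ∉ plane η)
    {τ : Type} [Finite τ] (z : τ → Fin 4 → K) (hz : ∀ k, z k ≠ 0) (hzZ : ∀ k, z k ∈ Z)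
    (hZ : ∀ x ∈ Z, ∃ k, ∃ c : K, c • z k = x) :
    ∀ᶠ a in Filter.cofinite, (Γ.evalAt a).IsNondegenerate η Z := by
  -- Each clause is put as independence of polynomial vectors, or as not lying in H, and so spreads
  -- from a₀ to almost all parameters; disjointness of two lines becomes independence of four
  -- vectors.
  have h1 := Filter.eventually_all.2 fun i => eventually_cofinite_linearIndependent
    ![Γ (.inl (i, 0)), Γ (.inl (i, 1))] a₀ (by
      convert h.line_indep i using 1
      ext k; fin_cases k <;> rfl)
  have h2 := Filter.eventually_all.2 fun a => eventually_notMem_plane _ (h' a)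
  have h4 := Filter.eventually_all.2 fun j => eventually_cofinite_linearIndependent
    ![Γ (.inr (j, 0)), Γ (.inr (j, 1)), Γ (.inr (j, 2))] a₀ (by
      convert h.cross_indep j using 1
      ext k; fin_cases k <;> rfl)
  have h5 := Filter.eventually_all.2 fun a => Filter.eventually_all.2 fun a' =>
    Filter.eventually_all.2 fun hc : compOf a ≠ compOf a' => eventually_cofinite_linearIndependent
    ![Γ (baseLabel a), Γ (dirLabel a), Γ (baseLabel a'), Γ (dirLabel a')] a₀ (by
      convert linearIndependent_of_disjoint (h.ln_indep a) (h.ln_indep a') (h.disjoint_ln hc)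
        using 1
      ext k; fin_cases k <;> rfl)
  have h6 := Filter.eventually_all.2 fun a => Filter.eventually_all.2 fun k =>
    eventually_cofinite_linearIndependent
    ![fun i => Polynomial.C (z k i), Γ (baseLabel a), Γ (dirLabel a)] a₀ (by
      have : LinearIndependent K ![z k, (Γ.evalAt a₀) (baseLabel a), (Γ.evalAt a₀) (dirLabel a)] :=
        linearIndependent_finCons.2 ⟨h.ln_indep a, fun hm => hz k
          (h.eq_zero_of_mem_ln a (hzZ k) (by simpa [Config.ln, Set.pair_comm] using hm))⟩
      convert this using 1
      ext k; fin_cases k <;> simp)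
  filter_upwards [h1, h2, h4, h5, h6] with a h1 h2 h4 h5 h6
  refine .of_ln (fun i => ?_) h2 (fun j => hv j a) (fun j => ?_) (fun b b' hb => ?_)
    fun b x hx hxb => ?_
  · convert h1 i using 1
    ext k; fin_cases k <;> rfl
  · convert h4 j using 1
    ext k; fin_cases k <;> rfl
  · refine disjoint_span_pair ?_
    convert h5 b b' hb using 1
    ext k; fin_cases k <;> rfl
  · obtain ⟨k, c, rfl⟩ := hZ x hx
    refine notMem_span_pair ?_ c hxb
    convert h6 b k using 1
    ext k; fin_cases k <;> simp

theorem Config.scheme_le_linIdeal_ln (Y : Config K ι κ) (Z : Set (Fin 4 → K))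
    (a : ι ⊕ κ × Fin 2) : Y.scheme Z ≤ linIdeal (Y.ln a) := fun f hf => by
  rcases a with i | ⟨j, e⟩
  · exact (Config.mem_scheme.1 hf).1 i
  · exact (Config.mem_scheme.1 hf).2.1 j e

/-- A polynomial that vanishes on a family of lines vanishes along the arcs traced by the points
with constant coordinates on them. -/
theorem eval_arc [Infinite K] {Γ : Config (Polynomial K) ι κ} {F : Coord (Polynomial K)}
    (hF : F ∈ familyIdeal fun a => (Γ.evalAt a).scheme Z) (a : ι ⊕ κ × Fin 2) (α β : K) :
    eval (fun i => Polynomial.C α * Γ (baseLabel a) i + Polynomial.C β * Γ (dirLabel a) i) F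
      = 0 := by
  refine Polynomial.funext fun t => ?_
  rw [← eval_specialize, Polynomial.eval_zero]
  refine mem_linIdeal.1 (Config.scheme_le_linIdeal_ln _ Z a (mem_familyIdeal.1 hF t)) _ ?_
  refine Submodule.mem_span_pair.2 ⟨α, β, ?_⟩
  ext i
  simp

/-- The first order condition on the members of a family of configurations at a point in which two
lines meet in the limit. -/
theorem flatDirs_specialize_eq_top [Infinite K] {Γ : Config (Polynomial K) ι κ}
    {F : Coord (Polynomial K)}
    (hF : F ∈ familyIdeal fun a => (Γ.evalAt a).scheme Z) {a a' : ι ⊕ κ × Fin 2} {α β γ δ : K}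
    {p d : Fin 4 → K}
    (hp : p = α • (Γ.evalAt 0) (baseLabel a) + β • (Γ.evalAt 0) (dirLabel a))
    (hp' : p = γ • (Γ.evalAt 0) (baseLabel a') + δ • (Γ.evalAt 0) (dirLabel a'))
    (hd : d = fun i => α * (Γ (baseLabel a) i).coeff 1 + β * (Γ (dirLabel a) i).coeff 1 -
      (γ * (Γ (baseLabel a') i).coeff 1 + δ * (Γ (dirLabel a') i).coeff 1))
    (htop : (Γ.evalAt 0).ln a ⊔ (Γ.evalAt 0).ln a' ⊔ Submodule.span K {d} = ⊤) :
    eval p (specialize 0 F) = 0 ∧ flatDirs p (specialize 0 F) = ⊤ := by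
  have hF0 := mem_familyIdeal.1 hF 0
  have hpa : p ∈ (Γ.evalAt 0).ln a := Submodule.mem_span_pair.2 ⟨α, β, hp.symm⟩
  have hpa' : p ∈ (Γ.evalAt 0).ln a' := Submodule.mem_span_pair.2 ⟨γ, δ, hp'.symm⟩
  have h1 := Config.scheme_le_linIdeal_ln _ Z a hF0
  have h2 := Config.scheme_le_linIdeal_ln _ Z a' hF0
  refine ⟨mem_linIdeal.1 h1 p hpa, top_le_iff.1 (htop ▸ sup_le (sup_le (le_flatDirs h1 hpa)
    (le_flatDirs h2 hpa')) ?_)⟩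
  rw [Submodule.span_singleton_le_iff_mem, mem_flatDirs]
  -- F vanishes identically along two arcs through p. Their first order coefficients contain the
  -- same term from the t-dependence of F, so the difference leaves the derivative of the fibre
  -- along the difference d of the velocities.
  have e1 := coeff_one_eval F p _ (fun i => by
    rw [hp]; simp [Polynomial.coeff_zero_eq_eval_zero] :
    ∀ i, (Polynomial.C α * Γ (baseLabel a) i + Polynomial.C β * Γ (dirLabel a) i).coeff 0 = p i)
  have e2 := coeff_one_eval F p _ (fun i => by
    rw [hp']; simp [Polynomial.coeff_zero_eq_eval_zero] :
    ∀ i, (Polynomial.C γ * Γ (baseLabel a') i + Polynomial.C δ * Γ (dirLabel a') i).coeff 0 = p i)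
  rw [eval_arc hF, Polynomial.coeff_zero] at e1 e2
  have e3 : d = (fun i => (Polynomial.C α * Γ (baseLabel a) i +
      Polynomial.C β * Γ (dirLabel a) i).coeff 1) + (-1 : K) • fun i =>
      (Polynomial.C γ * Γ (baseLabel a') i + Polynomial.C δ * Γ (dirLabel a') i).coeff 1 := by
    rw [hd]
    ext i
    simp
    ring
  rw [e3, dirDeriv_vec_add, dirDeriv_vec_smul]
  linear_combination e2 - e1

theorem mem_fiber_local {𝓕 : FlatFamily K} {a : K} {f : Coord K} (hf : f ∈ 𝓕.fiber a)
    {p : Fin 4 → K} (hp : p ≠ 0) :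
    ∃ s, eval p s ≠ 0 ∧ ∃ F ∈ 𝓕.ideal, specialize a F = s * f := by
  obtain ⟨s, hs, hsf⟩ := exists_eval_ne_zero_of_mem_saturation hf hp
  exact ⟨s, hs, (Ideal.mem_map_iff_of_surjective _ (specialize_surjective a)).1 hsf⟩

theorem configFamily_fiber_le_linIdeal [Infinite K] (Γ : Config (Polynomial K) ι κ)
    (hZ : IsArrangement Z) (a : K) {U : Submodule K (Fin 4 → K)} (hU : U ≠ ⊥)
    (h : (Γ.evalAt a).scheme Z ≤ linIdeal U) : (configFamily Γ Z hZ).fiber a ≤ linIdeal U :=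
  (saturation_mono ((map_familyIdeal_le _ a).trans h)).trans (saturation_linIdeal_le hU)

theorem configFamily_fiber_le_vanishingIdeal [Infinite K] (Γ : Config (Polynomial K) ι κ)
    (hZ : IsArrangement Z) (a : K) : (configFamily Γ Z hZ).fiber a ≤ vanishingIdeal K Z :=
  (saturation_mono ((map_familyIdeal_le _ a).trans fun _ hf =>
    (Config.mem_scheme.1 hf).2.2)).trans hZ.saturation_le

/-- Up to a factor not vanishing at p, an element of the fibre is the specialization of an element
of the family ideal, and such a factor does not affect first order vanishing. -/
theorem flatDirs_fiber_eq_top [Infinite K] {Γ : Config (Polynomial K) ι κ} (hZ : IsArrangement Z)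
    {f : Coord K} (hf : f ∈ (configFamily Γ Z hZ).fiber 0)
    {a a' : ι ⊕ κ × Fin 2} {α β γ δ : K} {p d : Fin 4 → K} (hp0 : p ≠ 0)
    (hp : p = α • (Γ.evalAt 0) (baseLabel a) + β • (Γ.evalAt 0) (dirLabel a))
    (hp' : p = γ • (Γ.evalAt 0) (baseLabel a') + δ • (Γ.evalAt 0) (dirLabel a'))
    (hd : d = fun i => α * (Γ (baseLabel a) i).coeff 1 + β * (Γ (dirLabel a) i).coeff 1 -
      (γ * (Γ (baseLabel a') i).coeff 1 + δ * (Γ (dirLabel a') i).coeff 1))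
    (htop : (Γ.evalAt 0).ln a ⊔ (Γ.evalAt 0).ln a' ⊔ Submodule.span K {d} = ⊤) :
    eval p f = 0 ∧ flatDirs p f = ⊤ := by
  obtain ⟨s, hs, F, hF, hFs⟩ := mem_fiber_local hf hp0
  obtain ⟨h1, h2⟩ := flatDirs_specialize_eq_top hF hp hp' hd htop
  rw [hFs] at h1 h2
  obtain ⟨h3, h4⟩ := flatDirs_le_of_mul hs h1
  exact ⟨h3, top_le_iff.1 (h2 ▸ h4)⟩

/-- The family that joins two configurations linearly. -/
def Config.segment (W Y : Config K ι κ) : Config (Polynomial K) ι κ :=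
  fun p i => Polynomial.C (W p i) + Polynomial.X * Polynomial.C (Y p i - W p i)

theorem Config.segment_evalAt (W Y : Config K ι κ) (a : K) :
    (W.segment Y).evalAt a = W + a • (Y - W) := by
  ext p i
  show (Polynomial.C (W p i) + Polynomial.X * Polynomial.C (Y p i - W p i)).eval a = _
  simp

@[simp] theorem Config.segment_evalAt_zero (W Y : Config K ι κ) : (W.segment Y).evalAt 0 = W := by
  rw [Config.segment_evalAt, zero_smul, add_zero]

@[simp] theorem Config.segment_evalAt_one (W Y : Config K ι κ) : (W.segment Y).evalAt 1 = Y := by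
  rw [Config.segment_evalAt, one_smul, add_sub_cancel]

@[simp] theorem Config.segment_coeff_one (W Y : Config K ι κ) (p : Label ι κ) (i : Fin 4) :
    (W.segment Y p i).coeff 1 = Y p i - W p i := by
  simp only [Config.segment, Polynomial.coeff_add, Polynomial.coeff_C_succ, zero_add]
  rw [Polynomial.coeff_X_mul, Polynomial.coeff_C_zero]

/-- The velocities on a segment are Y - W, and the contributions of W cancel because both
combinations equal p. So d involves Y alone. -/
theorem flatDirs_segment_eq_top [Infinite K] {W Y : Config K ι κ} (hZ : IsArrangement Z)
    {f : Coord K} (hf : f ∈ (configFamily (W.segment Y) Z hZ).fiber 0)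
    {a a' : ι ⊕ κ × Fin 2} {α β γ δ : K} {p d : Fin 4 → K} (hp0 : p ≠ 0)
    (hp : p = α • W (baseLabel a) + β • W (dirLabel a))
    (hp' : p = γ • W (baseLabel a') + δ • W (dirLabel a'))
    (hd : d = α • Y (baseLabel a) + β • Y (dirLabel a) -
      (γ • Y (baseLabel a') + δ • Y (dirLabel a')))
    (htop : W.ln a ⊔ W.ln a' ⊔ Submodule.span K {d} = ⊤) :
    eval p f = 0 ∧ flatDirs p f = ⊤ := by
  refine flatDirs_fiber_eq_top hZ hf (α := α) (β := β) (γ := γ) (δ := δ) (a := a) (a' := a')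
    (d := d) hp0 (by simpa using hp) (by simpa using hp') ?_ (by simpa using htop)
  ext i
  have := congrFun (hp.symm.trans hp') i
  simp only [hd, Config.segment_coeff_one, Pi.add_apply, Pi.sub_apply, Pi.smul_apply,
    smul_eq_mul] at this ⊢
  linear_combination this

end Family

/-! ### Localization of ideals at a point. -/

section LocalIdeal

variable {K : Type*} [Field K]

/-- The polynomials that belong to an ideal locally at a point. -/
def localIdeal (p : Fin 4 → K) (I : Ideal (Coord K)) : Ideal (Coord K) where
  carrier := {f | ∃ s, eval p s ≠ 0 ∧ s * f ∈ I}
  zero_mem' := ⟨1, by simp, by simp⟩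
  add_mem' := by
    rintro f g ⟨s, hs, hf⟩ ⟨t, ht, hg⟩
    refine ⟨s * t, by simp [hs, ht], ?_⟩
    rw [show s * t * (f + g) = t * (s * f) + s * (t * g) by ring]
    exact I.add_mem (I.mul_mem_left _ hf) (I.mul_mem_left _ hg)
  smul_mem' := by
    rintro r f ⟨s, hs, hf⟩
    refine ⟨s, hs, ?_⟩
    rw [smul_eq_mul, mul_left_comm]
    exact I.mul_mem_left _ hf

variable {p : Fin 4 → K} {I J : Ideal (Coord K)}

theorem le_localIdeal : I ≤ localIdeal p I := fun _ hf => ⟨1, by simp, by simpa using hf⟩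

theorem localIdeal_mono (h : I ≤ J) : localIdeal p I ≤ localIdeal p J := fun _ ⟨s, hs, hf⟩ =>
  ⟨s, hs, h hf⟩

theorem localIdeal_mul_le : localIdeal p I * localIdeal p J ≤ localIdeal p (I * J) := by
  rw [Ideal.mul_le]
  rintro f ⟨s, hs, hf⟩ g ⟨t, ht, hg⟩
  refine ⟨s * t, by simp [hs, ht], ?_⟩
  rw [show s * t * (f * g) = (s * f) * (t * g) by ring]
  exact Ideal.mul_mem_mul hf hg

theorem localIdeal_le_of_le (h : I ≤ localIdeal p J) : localIdeal p I ≤ localIdeal p J := by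
  rintro f ⟨s, hs, hf⟩
  obtain ⟨t, ht, htf⟩ := h hf
  exact ⟨t * s, by simp [hs, ht], by rwa [mul_assoc]⟩

theorem le_saturation_of_localIdeal [IsAlgClosed K]
    (h : ∀ p : Fin 4 → K, p ≠ 0 → I ≤ localIdeal p J) : I ≤ saturation J := fun _ hf =>
  mem_saturation_of_local fun p hp => h p hp hf

theorem prod_le_localIdeal {τ : Type*} [Fintype τ] {I : τ → Ideal (Coord K)} (T : Finset τ)
    (h : ∀ c ∉ T, Avoids (I c) p) : ∏ c ∈ T, I c ≤ localIdeal p (∏ c, I c) := fun f hf =>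
  let ⟨s, hs, hsf⟩ := exists_mul_mem_prod T h
  ⟨s, hs, hsf f hf⟩

variable {ι κ : Type}

/-- The index of the component that contains a line. -/
def compIdx : ι ⊕ κ × Fin 2 → ι ⊕ κ ⊕ Unit
  | .inl i => .inl i
  | .inr (j, _) => .inr (.inl j)

theorem compIdx_eq_iff {a a' : ι ⊕ κ × Fin 2} : compIdx a = compIdx a' ↔ compOf a = compOf a' := by
  rcases a with i | ⟨j, e⟩ <;> rcases a' with i' | ⟨j', e'⟩ <;> simp [compIdx, compOf]

theorem Config.avoids_compIdeal {Y : Config K ι κ} {Z : Set (Fin 4 → K)} {c : ι ⊕ κ ⊕ Unit}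
    (hZ : IsArrangement Z) (hc : c = .inr (.inr ()) → p ∉ Z)
    (h : ∀ a, compIdx a = c → p ∉ Y.ln a) : Avoids (Y.compIdeal Z c) p := by
  rcases c with i | j | _
  · exact avoids_linIdeal (h (.inl i) rfl)
  · exact (avoids_linIdeal (h (.inr (j, 0)) rfl)).inf (avoids_linIdeal (h (.inr (j, 1)) rfl))
  · exact hZ.avoids (hc rfl)

/-- Where only one line of a cross passes, the cross is locally that line: a form vanishing on the
other line but not at p is a local unit. -/
theorem Config.linIdeal_ln_le_localIdeal {Y : Config K ι κ} {Z : Set (Fin 4 → K)}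
    {a : ι ⊕ κ × Fin 2} (h : ∀ a', compOf a' = compOf a → p ∈ Y.ln a' → a' = a) :
    linIdeal (Y.ln a) ≤ localIdeal p (Y.compIdeal Z (compIdx a)) := by
  rcases a with i | ⟨j, e⟩
  · exact le_localIdeal
  · intro f hf
    obtain ⟨e', he'⟩ : ∃ e' : Fin 2, e' ≠ e := exists_ne e
    obtain ⟨s, hs, hsp⟩ := avoids_linIdeal fun hp : p ∈ Y.ln (.inr (j, e')) =>
      he' (by simpa using h (.inr (j, e')) rfl hp)
    refine ⟨s, hsp, ?_⟩
    have h1 := (linIdeal (Y.ln (.inr (j, e)))).mul_mem_left s hf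
    have h2 := (linIdeal (Y.ln (.inr (j, e')))).mul_mem_right f hs
    fin_cases e <;> fin_cases e'
    · exact absurd rfl he'
    · exact ⟨h1, h2⟩
    · exact ⟨h2, h1⟩
    · exact absurd rfl he'

end LocalIdeal

/-! ### Local structure of a special configuration. -/

namespace SpecParams

variable {q : SpecParams} {b : BType} {K : Type*} [Field K] {η : Fin 4 → K}
  {Y W : Config K (q.LineIdx b) (q.CrossIdx b)} {Z : Set (Fin 4 → K)}

/-- The label of the `e`-th line of the `j`-th sundial. -/
abbrev sundialLabel (j : Fin q.s) (f : Fin 2) : q.LineIdx b ⊕ q.CrossIdx b × Fin 2 :=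
  .inl (.inr (.inl (j, f)))

theorem not_inPlane_sundialLabel (j : Fin q.s) (f : Fin 2) :
    ¬ InPlane (dirLabel (sundialLabel (b := b) j f)) := by
  simp [dirLabel, InPlane]

namespace IsGood

theorem ln_le_plane (hW : IsGood η Y Z W) {a : q.LineIdx b ⊕ q.CrossIdx b × Fin 2}
    (ha : InPlane (dirLabel a)) :
    W.ln a ≤ plane η := by
  rw [Config.ln, Submodule.span_le, Set.insert_subset_iff, Set.singleton_subset_iff]
  exact ⟨hW.special.1 _ (inPlane_baseLabel ha), hW.special.1 _ ha⟩

theorem finrank_ln (hW : IsGood η Y Z W) (a : q.LineIdx b ⊕ q.CrossIdx b × Fin 2) :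
    Module.finrank K (W.ln a) = 2 := by
  have := finrank_span_eq_card (hW.line_indep a)
  rwa [Matrix.range_cons_cons_empty, Fintype.card_fin] at this

theorem ln_ne_bot (hW : IsGood η Y Z W) (a : q.LineIdx b ⊕ q.CrossIdx b × Fin 2) : W.ln a ≠ ⊥ :=
  span_pair_ne_bot (hW.line_indep a)

theorem ln_sup_ln (hW : IsGood η Y Z W) (hη : η ≠ 0) {a a' : q.LineIdx b ⊕ q.CrossIdx b × Fin 2}
    (h : compOf a ≠ compOf a') (ha : InPlane (dirLabel a)) (ha' : InPlane (dirLabel a')) :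
    W.ln a ⊔ W.ln a' = plane η := by
  refine Submodule.eq_of_le_of_finrank_le (sup_le (hW.ln_le_plane ha) (hW.ln_le_plane ha'))
    ((finrank_plane_le hη).trans ?_)
  have h1 := finrank_span_eq_card (hW.meet_indep a a' h ha ha')
  rw [Fintype.card_fin] at h1
  refine (show 3 = _ from h1.symm).le.trans (Submodule.finrank_mono ?_)
  refine (Submodule.span_le.2 ?_)
  have hm : ∀ x ∈ ({W (baseLabel a), W (dirLabel a)} : Set (Fin 4 → K)), x ∈ W.ln a ⊔ W.ln a' :=
    fun x hx => Submodule.mem_sup_left (Submodule.subset_span hx)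
  have hm' : ∀ x ∈ ({W (baseLabel a'), W (dirLabel a')} : Set (Fin 4 → K)),
      x ∈ W.ln a ⊔ W.ln a' := fun x hx => Submodule.mem_sup_right (Submodule.subset_span hx)
  rintro _ ⟨k, rfl⟩
  fin_cases k
  · exact hm _ (by simp)
  · exact hm' _ (by simp)
  · exact sub_mem (hm' _ (by simp)) (hm _ (by simp))

/-- Two lines of different components meet only if they form a sundial or lie in `H`. -/
theorem sundial_or_inPlane (hW : IsGood η Y Z W) {a a' : q.LineIdx b ⊕ q.CrossIdx b × Fin 2}
    {p : Fin 4 → K} (hp : p ≠ 0) (h : compOf a ≠ compOf a') (ha : p ∈ W.ln a) (ha' : p ∈ W.ln a') :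
    (∃ j f f', f ≠ f' ∧ a = sundialLabel j f ∧ a' = sundialLabel j f') ∨
      (InPlane (dirLabel a) ∧ InPlane (dirLabel a')) := by
  by_contra! hn
  refine hp (Submodule.disjoint_def.1 (hW.disjoint a a' h (fun hr => ?_) fun h => hn.2 h.1 h.2)
    p ha ha')
  obtain ⟨j, f, f', hff, h1, h2⟩ := sundial_of_root_eq h hr
  exact hn.1 j f f' hff h1 h2

/-- No other line passes through the intersection of two lines of different components. -/
theorem eq_or_eq_of_mem_ln (hW : IsGood η Y Z W) {a a' a'' : q.LineIdx b ⊕ q.CrossIdx b × Fin 2}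
    {p : Fin 4 → K} (hp : p ≠ 0) (h : compOf a ≠ compOf a') (ha : p ∈ W.ln a) (ha' : p ∈ W.ln a')
    (ha'' : p ∈ W.ln a'') : a'' = a ∨ a'' = a' := by
  by_contra! hn
  wlog hc : compOf a'' ≠ compOf a generalizing a a'
  · push Not at hc
    exact this h.symm ha' ha hn.symm (hc ▸ h)
  rcases hW.sundial_or_inPlane hp hc ha'' ha with ⟨j, f, f', hff, rfl, rfl⟩ | ⟨h1, h2⟩
  · rcases hW.sundial_or_inPlane hp h ha ha' with ⟨j', f₁, f₁', hff', h1, rfl⟩ | ⟨h1, -⟩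
    · obtain ⟨rfl, rfl⟩ : j = j' ∧ f' = f₁ := by simpa [sundialLabel] using h1
      exact hn.2 (by rw [show f = f₁' by omega])
    · exact not_inPlane_sundialLabel _ _ h1
  · rcases hW.sundial_or_inPlane hp h ha ha' with ⟨j', f₁, f₁', hff', rfl, rfl⟩ | ⟨-, h3⟩
    · exact not_inPlane_sundialLabel _ _ h2
    · exact hp (hW.triple a'' a a' h1 h2 h3 hc.symm h hn.2 p ha'' ha ha')

/-- If two components meet at p, no third line passes through p and p is not in Z. In particular p
is not a vertex of a cross, so the product of all components is locally a product of two line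
ideals. The two lines form a sundial or lie in H. Otherwise at most one factor of the product
matters at p. -/
theorem local_cases (hW : IsGood η Y Z W) (hZ : IsArrangement Z) {p : Fin 4 → K} (hp : p ≠ 0) :
    (∃ c, W.compIdeal Z c ≤ localIdeal p (∏ c, W.compIdeal Z c)) ∨
    (∃ j, linIdeal (W.ln (sundialLabel j 0)) * linIdeal (W.ln (sundialLabel j 1)) ≤
      localIdeal p (∏ c, W.compIdeal Z c)) ∨
    (∃ a a', compOf a ≠ compOf a' ∧ InPlane (dirLabel a) ∧ InPlane (dirLabel a') ∧
      linIdeal (W.ln a) * linIdeal (W.ln a') ≤ localIdeal p (∏ c, W.compIdeal Z c)) := by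
  classical
  by_cases h : ∃ a a', compOf a ≠ compOf a' ∧ p ∈ W.ln a ∧ p ∈ W.ln a'
  · obtain ⟨a, a', hc, ha, ha'⟩ := h
    have key : linIdeal (W.ln a) * linIdeal (W.ln a') ≤
        localIdeal p (∏ c, W.compIdeal Z c) := by
      have h1 : linIdeal (W.ln a) ≤ localIdeal p (W.compIdeal Z (compIdx a)) :=
        Config.linIdeal_ln_le_localIdeal fun a'' h1 h2 =>
          (hW.eq_or_eq_of_mem_ln hp hc ha ha' h2).resolve_right fun h3 => hc (h3 ▸ h1.symm)
      have h2 : linIdeal (W.ln a') ≤ localIdeal p (W.compIdeal Z (compIdx a')) :=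
        Config.linIdeal_ln_le_localIdeal fun a'' h1 h2 =>
          (hW.eq_or_eq_of_mem_ln hp hc ha ha' h2).resolve_left fun h3 => hc (h3 ▸ h1)
      refine (Ideal.mul_mono h1 h2).trans (localIdeal_mul_le.trans (localIdeal_le_of_le ?_))
      rw [← Finset.prod_pair (f := W.compIdeal Z) (fun h => hc (compIdx_eq_iff.1 h))]
      refine prod_le_localIdeal _ fun c hcT => Config.avoids_compIdeal hZ
        (fun _ hpZ => hp (hW.star a p hpZ ha)) fun a'' h1 h2 => hcT ?_
      rw [Finset.mem_insert, Finset.mem_singleton, ← h1]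
      exact (hW.eq_or_eq_of_mem_ln hp hc ha ha' h2).imp (congrArg _) (congrArg _)
    rcases hW.sundial_or_inPlane hp hc ha ha' with ⟨j, f, f', hff, rfl, rfl⟩ | ⟨h1, h2⟩
    · refine .inr (.inl ⟨j, ?_⟩)
      fin_cases f <;> fin_cases f'
      · exact absurd rfl hff
      · exact key
      · rwa [mul_comm]
      · exact absurd rfl hff
    · exact .inr (.inr ⟨a, a', hc, h1, h2, key⟩)
  · push Not at h
    refine .inl ?_
    suffices ∃ c, ∀ c' ≠ c, Avoids (W.compIdeal Z c') p by
      obtain ⟨c, hc⟩ := this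
      refine ⟨c, ?_⟩
      conv_lhs => rw [← Finset.prod_singleton (W.compIdeal Z) c]
      exact prod_le_localIdeal _ fun c' hc' => hc c' (by simpa using hc')
    by_cases ha : ∃ a, p ∈ W.ln a
    · obtain ⟨a, ha⟩ := ha
      refine ⟨compIdx a, fun c' hc' => Config.avoids_compIdeal hZ
        (fun _ hpZ => hp (hW.star a p hpZ ha)) fun a' h1 h2 => hc' ?_⟩
      rw [← h1, compIdx_eq_iff]
      by_contra hc
      exact h a' a hc h2 ha
    · push Not at ha
      exact ⟨.inr (.inr ()), fun c' hc' => Config.avoids_compIdeal hZ (fun h => absurd h hc')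
        fun a' _ => ha a'⟩

end IsGood

end SpecParams

/-! ### Intersections with H, and primality of linear ideals. -/

section Planes

variable {K : Type*} [Field K] {η : Fin 4 → K} {ι κ : Type}

theorem sup_span_inf_plane {U : Submodule K (Fin 4 → K)} {v : Fin 4 → K} (hU : U ≤ plane η)
    (hv : v ∉ plane η) : (U ⊔ Submodule.span K {v}) ⊓ plane η = U := by
  refine le_antisymm ?_ (le_inf le_sup_left hU)
  rintro x ⟨hx, hxη⟩
  obtain ⟨u, hu, w, hw, rfl⟩ := Submodule.mem_sup.1 hx
  obtain ⟨c, rfl⟩ := Submodule.mem_span_singleton.1 hw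
  have h1 : c • v ∈ plane η := by simpa using sub_mem hxη (hU hu)
  rcases eq_or_ne c 0 with rfl | hc
  · simpa using hu
  · exact absurd ((Submodule.smul_mem_iff _ hc).1 h1) hv

theorem plane_sup_span {v : Fin 4 → K} (hv : v ∉ plane η) :
    plane η ⊔ Submodule.span K {v} = ⊤ := by
  refine eq_top_iff.2 fun x _ => Submodule.mem_sup.2
    ⟨x - (η ⬝ᵥ x / η ⬝ᵥ v) • v, ?_, _,
      Submodule.mem_span_singleton.2 ⟨η ⬝ᵥ x / η ⬝ᵥ v, rfl⟩, by simp⟩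
  have hv' : η ⬝ᵥ v ≠ 0 := hv
  rw [mem_plane_iff_dotProduct, dotProduct_sub, dotProduct_smul, smul_eq_mul,
    div_mul_cancel₀ _ hv', sub_self]

/-- The ideal of U is the kernel of substitution of a projection onto U, a ring homomorphism into a
domain; hence it is prime. -/
theorem mem_linIdeal_of_mul_mem [Infinite K] {U : Submodule K (Fin 4 → K)} {f g : Coord K}
    (h : f * g ∈ linIdeal U) (hg : g ∉ linIdeal U) : f ∈ linIdeal U := by
  obtain ⟨Q, hQ, hQU⟩ := exists_projection U
  have key : ∀ k : Coord K, k ∈ linIdeal U ↔ linComp Q k = 0 := fun k => by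
    refine ⟨fun hk => linComp_eq_zero fun x => mem_linIdeal.1 hk _ (hQU x), fun hk => ?_⟩
    rw [mem_linIdeal]
    intro x hx
    rw [← hQ x hx, ← eval_linComp, hk, map_zero]
  rw [key, map_mul] at h
  exact (key f).2 ((mul_eq_zero.1 h).resolve_right fun h' => hg ((key g).2 h'))

theorem Config.mem_scheme_iff_ln {Y : Config K ι κ} {Z : Set (Fin 4 → K)} {f : Coord K} :
    f ∈ Y.scheme Z ↔ (∀ a, f ∈ linIdeal (Y.ln a)) ∧ f ∈ vanishingIdeal K Z := by
  rw [Config.mem_scheme, Sum.forall, Prod.forall, and_assoc]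
  rfl

end Planes

/-! ### Lines of the trace and of the residual scheme; bounds for the limit. -/

namespace SpecParams

variable {q : SpecParams} {b : BType}

/-- The labels of the lines in `H`. -/
def traceLabel : q.TraceIdx → q.LineIdx b ⊕ q.CrossIdx b × Fin 2
  | .inl i => .inl (.inl i)
  | .inr (.inl j) => .inr (.inl j, 0)
  | .inr (.inr (j, e)) => .inr (.inr (.inl j), e)

theorem inPlane_traceLabel (i : q.TraceIdx) : InPlane (dirLabel (traceLabel (b := b) i)) := by
  rcases i with i | j | ⟨j, e⟩
  · trivial
  · simp [traceLabel, dirLabel, InPlane]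
  · trivial

theorem exists_traceLabel {a : q.LineIdx b ⊕ q.CrossIdx b × Fin 2} (ha : InPlane (dirLabel a)) :
    ∃ i, traceLabel i = a := by
  rcases a with (i | ⟨j, f⟩ | i) | ⟨j | j | j, e⟩
  · exact ⟨.inl i, rfl⟩
  · exact absurd ha (not_inPlane_sundialLabel j f)
  · exact ha.elim
  · fin_cases e
    · exact ⟨.inr (.inl j), rfl⟩
    · simp [dirLabel, InPlane] at ha
  · exact ⟨.inr (.inr (j, e)), rfl⟩
  · exact absurd ha (Fin.succ_ne_zero e)

theorem traceLabel_injective : Function.Injective (traceLabel (q := q) (b := b)) := by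
  rintro (i | j | ⟨j, e⟩) (i' | j' | ⟨j', e'⟩) h <;> simp_all [traceLabel]

/-- Lines in `H` of the same cross meet in a point that is omitted from the residual star. -/
theorem compOf_traceLabel_ne {i i' : q.TraceIdx} (h : i ≠ i')
    (ho : ∀ j : Fin q.c, ¬ ((.inr (.inr (j, 0)) : q.TraceIdx) = i ∧ .inr (.inr (j, 1)) = i') ∧
      ¬ ((.inr (.inr (j, 0)) : q.TraceIdx) = i' ∧ .inr (.inr (j, 1)) = i)) :
    compOf (traceLabel (b := b) i) ≠ compOf (traceLabel i') := by
  intro hc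
  rcases i with i | j | ⟨j, e⟩ <;> rcases i' with i' | j' | ⟨j', e'⟩ <;>
    simp [traceLabel, compOf] at hc
  · exact h (by rw [hc])
  · exact h (by rw [hc])
  · subst hc
    have := ho j
    fin_cases e <;> fin_cases e' <;> simp_all

/-- The labels of the lines of the residual configuration. -/
def resLabel : (Fin (b.L - (q.ℓ + 2 * q.s)) ⊕ Fin q.h) ⊕ (Fin (b.C - (q.c + q.h)) ⊕ Fin q.s) × Fin 2
    → q.LineIdx b ⊕ q.CrossIdx b × Fin 2
  | .inl (.inl i) => .inl (.inr (.inr i))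
  | .inl (.inr j) => .inr (.inl j, 1)
  | .inr (.inl j, e) => .inr (.inr (.inr j), e)
  | .inr (.inr j, e) => .inl (.inr (.inl (j, e)))

theorem not_inPlane_resLabel (a) : ¬ InPlane (dirLabel (resLabel (q := q) (b := b) a)) := by
  rcases a with (i | j) | ⟨j | j, e⟩
  · exact id
  · simp [resLabel, dirLabel, InPlane]
  · exact Fin.succ_ne_zero e
  · simp [resLabel, dirLabel, InPlane]

variable {K : Type*} [Field K] {η : Fin 4 → K}
  {Y W : Config K (q.LineIdx b) (q.CrossIdx b)} {Z : Set (Fin 4 → K)}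

theorem traceLine_eq (W : Config K (q.LineIdx b) (q.CrossIdx b)) (i : q.TraceIdx) :
    traceLine W i = W.ln (traceLabel i) := by
  rcases i with i | j | ⟨j, e⟩ <;> rfl

namespace IsGood

theorem sundialLabel_base (hW : IsGood η Y Z W) (j : Fin q.s) (f : Fin 2) :
    W (baseLabel (sundialLabel j f)) = sundialPoint W j :=
  (hW.special.2 (baseLabel (sundialLabel j f))).symm

theorem resConfig_ln (hW : IsGood η Y Z W) (a) : (resConfig W).ln a = W.ln (resLabel a) := by
  rcases a with (i | j) | ⟨j | j, e⟩
  · rfl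
  · rfl
  · rfl
  · rw [Config.ln, Config.ln, show W (baseLabel (resLabel (.inr (.inr j, e)))) = _ from
      hW.sundialLabel_base j e]
    fin_cases e <;> rfl

theorem base_mem_of_sundial (hW : IsGood η Y Z W) (j : Fin q.s) : sundialPoint W j ∈ plane η :=
  hW.special.1 _ rfl

theorem sundialPoint_ne_zero (hW : IsGood η Y Z W) (j : Fin q.s) : sundialPoint W j ≠ 0 :=
  (hW.sundial_indep j).ne_zero 0

theorem ln_sundialLabel (hW : IsGood η Y Z W) (j : Fin q.s) (f : Fin 2) :
    W.ln (sundialLabel j f) = Submodule.span K {sundialPoint W j} ⊔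
      Submodule.span K {W (dirLabel (sundialLabel j f))} := by
  rw [Config.ln, hW.sundialLabel_base, Submodule.span_insert]

theorem ln_sundialLabel_inf_plane (hW : IsGood η Y Z W) (j : Fin q.s) (f : Fin 2) :
    W.ln (sundialLabel j f) ⊓ plane η = Submodule.span K {sundialPoint W j} := by
  rw [hW.ln_sundialLabel, sup_span_inf_plane (by simpa using hW.base_mem_of_sundial j)
    (hW.dir_notMem _ (not_inPlane_sundialLabel j f))]

theorem ln_sundialLabel_inf (hW : IsGood η Y Z W) (j : Fin q.s) :
    W.ln (sundialLabel j 0) ⊓ W.ln (sundialLabel j 1) ≤ Submodule.span K {sundialPoint W j} := by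
  rintro x ⟨h0, h1⟩
  rw [Config.ln, hW.sundialLabel_base] at h0 h1
  obtain ⟨α, β, rfl⟩ := Submodule.mem_span_pair.1 h0
  obtain ⟨γ, δ, h⟩ := Submodule.mem_span_pair.1 h1
  obtain ⟨-, h2, -⟩ := linearIndependent_four_iff.1 (hW.sundial_indep j) (α - γ) β (-δ) 0 (by
    change (α - γ) • sundialPoint W j + β • W (dirLabel (sundialLabel j 0)) +
      (-δ) • W (dirLabel (sundialLabel j 1)) + (0 : K) • _ = 0
    rw [zero_smul, add_zero]
    linear_combination (norm := module) -h)
  rw [h2, zero_smul, add_zero]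
  exact Submodule.smul_mem _ _ (Submodule.mem_span_singleton_self _)

variable [Infinite K]

/-- The two lines span H, so it suffices that the relative velocity d leaves H. By normalization the
equation of H takes on d the difference of the two direction coefficients of p; if these agreed,
`meet_indep` would force p = 0. -/
theorem flatDirs_fiber_of_inPlane (hη : η ≠ 0) (hW : IsGood η Y Z W) (hY : Y.IsNormalized η)
    (hZ : IsArrangement Z)
    {f : Coord K} (hf : f ∈ (configFamily (W.segment Y) Z hZ).fiber 0)
    {a a' : q.LineIdx b ⊕ q.CrossIdx b × Fin 2} (h : compOf a ≠ compOf a')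
    (ha : InPlane (dirLabel a)) (ha' : InPlane (dirLabel a')) {p : Fin 4 → K} (hp : p ≠ 0)
    (hpa : p ∈ W.ln a) (hpa' : p ∈ W.ln a') : eval p f = 0 ∧ flatDirs p f = ⊤ := by
  obtain ⟨α, β, h1⟩ := Submodule.mem_span_pair.1 hpa
  obtain ⟨γ, δ, h2⟩ := Submodule.mem_span_pair.1 hpa'
  refine flatDirs_segment_eq_top hZ hf hp h1.symm h2.symm rfl ?_
  rw [hW.ln_sup_ln hη h ha ha']
  refine plane_sup_span fun hd => hp ?_
  rw [mem_plane_iff_dotProduct] at hd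
  simp only [dotProduct_sub, dotProduct_add, dotProduct_smul, smul_eq_mul, (hY a).2, (hY a').2,
    mem_plane_iff_dotProduct.1 (hY a).1, mem_plane_iff_dotProduct.1 (hY a').1] at hd
  have hβδ : β = δ := by linear_combination hd
  subst hβδ
  obtain ⟨hα, -, hβ⟩ := linearIndependent_three_iff.1 (hW.meet_indep a a' h ha ha') α (-γ) (-β) (by
    linear_combination (norm := module) h1 - h2)
  rw [neg_eq_zero] at hβ
  rw [← h1, hα, hβ, zero_smul, zero_smul, add_zero]

/-- The two base points come together with relative velocity proportional to the difference of the
base vectors of Y, and `sundial_indep` says that this leaves the plane of the sundial. -/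
theorem flatDirs_fiber_of_sundial (hW : IsGood η Y Z W) (hZ : IsArrangement Z)
    {f : Coord K} (hf : f ∈ (configFamily (W.segment Y) Z hZ).fiber 0) (j : Fin q.s)
    {p : Fin 4 → K} (hp : p ≠ 0)
    (hpj : p ∈ Submodule.span K {sundialPoint W j}) : eval p f = 0 ∧ flatDirs p f = ⊤ := by
  obtain ⟨α, rfl⟩ := Submodule.mem_span_singleton.1 hpj
  have hα : α ≠ 0 := by
    rintro rfl
    exact hp (zero_smul _ _)
  refine flatDirs_segment_eq_top hZ hf (a := sundialLabel j 0) (a' := sundialLabel j 1)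
    (α := α) (β := 0) (γ := α) (δ := 0)
    (d := α • (Y (baseLabel (sundialLabel j 0)) - Y (baseLabel (sundialLabel j 1)))) hp
    (by rw [hW.sundialLabel_base, zero_smul, add_zero])
    (by rw [hW.sundialLabel_base, zero_smul, add_zero]) (by module) ?_
  rw [Submodule.span_singleton_smul_eq hα.isUnit]
  have h1 : Submodule.span K (Set.range _) = ⊤ :=
    (hW.sundial_indep j).span_eq_top_of_card_eq_finrank (by simp)
  rw [eq_top_iff, ← h1, Submodule.span_le]
  rintro _ ⟨k, rfl⟩
  fin_cases k
  · exact Submodule.mem_sup_left (Submodule.mem_sup_left (Submodule.subset_span (.inl rfl)))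
  · exact Submodule.mem_sup_left (Submodule.mem_sup_left (Submodule.subset_span (.inr rfl)))
  · exact Submodule.mem_sup_left (Submodule.mem_sup_right (Submodule.subset_span (.inr rfl)))
  · exact Submodule.mem_sup_right (Submodule.subset_span rfl)

theorem saturation_prod_compIdeal_le_fiber (hW : IsGood η Y Z W) (hZ : IsArrangement Z) :
    saturation (∏ c, W.compIdeal Z c) ≤ (configFamily (W.segment Y) Z hZ).fiber 0 := by
  have := prod_compIdeal_le (W.segment Y) Z 0
    (by rw [Config.segment_evalAt_zero]; exact fun i => hW.line_indep (.inl i))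
    (by rw [Config.segment_evalAt_zero]; exact hW.cross_indep)
  rw [Config.segment_evalAt_zero] at this
  exact saturation_mono this

theorem fiber_le_ln (hW : IsGood η Y Z W) (hZ : IsArrangement Z)
    (a : q.LineIdx b ⊕ q.CrossIdx b × Fin 2) :
    (configFamily (W.segment Y) Z hZ).fiber 0 ≤ linIdeal (W.ln a) :=
  configFamily_fiber_le_linIdeal _ hZ 0 (hW.ln_ne_bot a) (by
    rw [Config.segment_evalAt_zero]
    exact Config.scheme_le_linIdeal_ln W Z a)

end IsGood

end SpecParams

theorem inf_plane_ne_bot {K : Type*} [Field K] {η : Fin 4 → K} {U : Submodule K (Fin 4 → K)}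
    (hU : Module.finrank K U = 2) : U ⊓ plane η ≠ ⊥ := by
  intro h
  have h1 := Submodule.finrank_sup_add_finrank_inf_eq U (plane η)
  have h2 := Submodule.finrank_le (U ⊔ plane η)
  have h3 := three_le_finrank_plane η
  rw [h, finrank_bot] at h1
  rw [Module.finrank_fin_fun] at h2
  omega

theorem sq_le_mul_sup {R : Type*} [CommRing R] {m I J L : Ideal R} (hI : m ≤ I ⊔ L)
    (hJ : m ≤ J ⊔ L) : m ^ 2 ≤ I * J ⊔ L := by
  rw [pow_two]
  refine (Ideal.mul_mono hI hJ).trans ?_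
  rw [Ideal.sup_mul, Ideal.mul_sup]
  exact sup_le (sup_le le_sup_left (Ideal.mul_le_right.trans le_sup_right))
    (Ideal.mul_le_left.trans le_sup_right)

theorem linIdeal_sup_inf_le {K : Type*} [Field K] [Infinite K] (A B P : Submodule K (Fin 4 → K)) :
    linIdeal ((A ⊔ B) ⊓ P) ≤ (linIdeal A ⊓ linIdeal B) ⊔ linIdeal P := by
  have hA : linIdeal (A ⊔ B) ≤ linIdeal A := linIdeal_anti le_sup_left
  have hB : linIdeal (A ⊔ B) ≤ linIdeal B := linIdeal_anti le_sup_right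
  have h := linIdeal_inf_le (A ⊔ B) P
  have h' : linIdeal (A ⊔ B) ≤ linIdeal A ⊓ linIdeal B := le_inf hA hB
  exact h.trans (sup_le_sup_right h' _)

/-! ### The trace and the residual scheme of the limit. -/

namespace SpecParams

variable {q : SpecParams} {b : BType} {K : Type*} [Field K] {η : Fin 4 → K}
  {Y W : Config K (q.LineIdx b) (q.CrossIdx b)} {Z : Set (Fin 4 → K)}

theorem mem_traceScheme (hη : η ≠ 0) [Infinite K] {f : Coord K} : f ∈ traceScheme η W Z ↔
    (∀ a, InPlane (dirLabel a) → f ∈ linIdeal (W.ln a)) ∧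
    (∀ j, f ∈ pointIdeal (sundialPoint W j) ^ 2 ⊔ linIdeal (plane η)) ∧
    (∀ j, f ∈ pointIdeal (W.vertex (.inr (.inr j))) ^ 2 ⊔
      linIdeal (Submodule.span K {W.vertex (.inr (.inr j)), W.arm (.inr (.inr j)) 0,
        W.arm (.inr (.inr j)) 1} ⊓ plane η)) ∧
    (∀ i, f ∈ linIdeal (W.ln (.inl (.inr (.inr i))) ⊓ plane η)) ∧ f ∈ vanishingIdeal K Z := by
  have h : (∀ a, InPlane (dirLabel a) → f ∈ linIdeal (W.ln a)) ↔
      ∀ i, f ∈ vanishingIdeal K (traceLine W i : Set (Fin 4 → K)) := by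
    constructor
    · intro h i
      rw [traceLine_eq]
      exact h _ (inPlane_traceLabel i)
    · intro h a ha
      obtain ⟨i, rfl⟩ := exists_traceLabel ha
      rw [← traceLine_eq]
      exact h i
  rw [h, linIdeal_plane hη]
  simp only [traceScheme, Ideal.mem_inf, Submodule.mem_iInf, and_assoc]
  rfl

theorem crossPlane_eq (W : Config K (q.LineIdx b) (q.CrossIdx b)) (j : q.CrossIdx b) :
    Submodule.span K {W.vertex j, W.arm j 0, W.arm j 1} =
      W.ln (.inr (j, 0)) ⊔ W.ln (.inr (j, 1)) := by
  change _ = Submodule.span K {W.vertex j, W.arm j 0} ⊔ Submodule.span K {W.vertex j, W.arm j 1}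
  rw [← Submodule.span_union]
  congr 1
  ext x
  simp
  tauto

theorem inPlane_half (j : Fin q.h) :
    InPlane (q := q) (b := b) (dirLabel (.inr (.inl j, 0))) := by
  simp [dirLabel, InPlane]

namespace IsGood

theorem half_sup_inf_plane (hW : IsGood η Y Z W) (j : Fin q.h) :
    (W.ln (.inr (.inl j, 0)) ⊔ W.ln (.inr (.inl j, 1))) ⊓ plane η = W.ln (.inr (.inl j, 0)) := by
  have hle : W.ln (.inr (.inl j, 0)) ≤ plane η := hW.ln_le_plane (inPlane_half j)
  have h : W.ln (.inr (.inl j, 1)) = Submodule.span K {W.vertex (.inl j)} ⊔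
      Submodule.span K {W (dirLabel (.inr (.inl j, 1)))} := Submodule.span_insert _ _
  have h' : Submodule.span K {W.vertex (.inl j)} ≤ W.ln (.inr (.inl j, 0)) :=
    Submodule.span_mono (Set.singleton_subset_iff.2 (.inl rfl))
  rw [h, ← sup_assoc, sup_eq_left.2 h', sup_span_inf_plane hle
    (hW.dir_notMem (.inr (.inl j, 1)) (by simp [dirLabel, InPlane]))]

variable [Infinite K]

/-- Each constituent of the prescribed trace is saturated and contains the equation of H, so it need
only contain the ideal of the limit. This holds by vanishing on lines and on Z, by singularity at
sundial points, and at a remaining vertex because both lines of the cross are flat directions. -/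
theorem trace_le (hη : η ≠ 0) (hW : IsGood η Y Z W) (hZ : IsArrangement Z)
    (hZη : ∀ x ∈ Z, x ∈ plane η) :
    trace η ((configFamily (W.segment Y) Z hZ).fiber 0) ≤ traceScheme η W Z := by
  set I := (configFamily (W.segment Y) Z hZ).fiber 0 with hI
  have key : ∀ {T : Ideal (Coord K)}, I ≤ T → linIdeal (plane η) ≤ T → saturation T ≤ T →
      trace η I ≤ T := fun h1 h2 h3 =>
    (saturation_mono (sup_le h1 (by rwa [← linIdeal_plane hη]))).trans h3
  intro f hf
  rw [mem_traceScheme hη]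
  refine ⟨fun a ha => ?_, fun j => ?_, fun j => ?_, fun i => ?_, ?_⟩
  · exact key (hW.fiber_le_ln hZ a) (linIdeal_anti (hW.ln_le_plane ha))
      (saturation_linIdeal_le (hW.ln_ne_bot a)) hf
  · refine key (fun g hg => ?_) le_sup_right (saturation_pointIdeal_sq_sup_le
      (hW.base_mem_of_sundial j) (hW.sundialPoint_ne_zero j)) hf
    exact mem_pointIdeal_sq_sup (U := plane η) (hW.base_mem_of_sundial j)
      (hW.sundialPoint_ne_zero j)
      (fun x hx hx0 => (hW.flatDirs_fiber_of_sundial hZ hg j hx0 hx).1)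
      (fun x hx hx0 => (hW.flatDirs_fiber_of_sundial hZ hg j hx0 hx).2 ▸ le_top)
  · have hv : W.vertex (.inr (.inr j)) ∈ plane η := hW.special.1 _ rfl
    have hv0 : W.vertex (.inr (.inr j)) ≠ 0 := (hW.cross_indep (.inr (.inr j))).ne_zero 0
    have hvS : W.vertex (.inr (.inr j)) ∈ Submodule.span K {W.vertex (.inr (.inr j)),
        W.arm (.inr (.inr j)) 0, W.arm (.inr (.inr j)) 1} := Submodule.subset_span (by simp)
    have hvSη := Submodule.mem_inf.2 ⟨hvS, hv⟩
    refine key (fun g hg => ?_) ((linIdeal_anti inf_le_right).trans le_sup_right)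
      (saturation_pointIdeal_sq_sup_le hvSη hv0) hf
    have hm : ∀ e, Submodule.span K {W.vertex (.inr (.inr j))} ≤ W.ln (.inr (.inr (.inr j), e)) :=
      fun e => Submodule.span_mono (by simp [baseLabel, Config.vertex])
    have hg' : ∀ e, g ∈ linIdeal (W.ln (.inr (.inr (.inr j), e))) := fun e =>
      hW.fiber_le_ln hZ _ hg
    refine mem_pointIdeal_sq_sup hvSη hv0 (fun x hx _ => mem_linIdeal.1 (hg' 0) x (hm 0 hx))
      fun x hx _ => ?_
    rw [crossPlane_eq]
    exact inf_le_left.trans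
      (sup_le (le_flatDirs (hg' 0) (hm 0 hx)) (le_flatDirs (hg' 1) (hm 1 hx)))
  · refine key ((hW.fiber_le_ln hZ _).trans (linIdeal_anti inf_le_left))
      (linIdeal_anti inf_le_right) (saturation_linIdeal_le ?_) hf
    exact inf_plane_ne_bot (hW.finrank_ln _)
  · refine key (configFamily_fiber_le_vanishingIdeal _ hZ 0) ?_ hZ.saturation_le hf
    exact vanishingIdeal_anti_mono hZη

/-- Checked locally against the product of component ideals plus the equation of H. Modulo that
equation each line of a sundial becomes its singular point, so the square of the point ideal lies in
the product of the two lines. At an intersection of lines in H, I ⊓ I' is contained in I * I' plus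
the ideal of their span, which is H. -/
theorem le_trace [IsAlgClosed K] (hη : η ≠ 0) (hW : IsGood η Y Z W) (hZ : IsArrangement Z) :
    traceScheme η W Z ≤ trace η ((configFamily (W.segment Y) Z hZ).fiber 0) := by
  rw [trace, ← linIdeal_plane hη]
  refine le_saturation_of_localIdeal fun p hp f hf => ?_
  obtain ⟨h1, h2, h3, h4, h5⟩ := (mem_traceScheme hη).1 hf
  set I := (configFamily (W.segment Y) Z hZ).fiber 0
  set L := linIdeal (plane η)
  set Q := localIdeal p (I ⊔ L)
  have hL : L ≤ Q := le_sup_right.trans le_localIdeal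
  have hJ : localIdeal p (∏ c, W.compIdeal Z c) ≤ Q :=
    localIdeal_mono ((le_saturation _).trans
      ((hW.saturation_prod_compIdeal_le_fiber hZ).trans le_sup_left))
  have hpt : ∀ j e, pointIdeal (sundialPoint W j) ≤ linIdeal (W.ln (sundialLabel j e)) ⊔ L := by
    intro j e
    rw [← linIdeal_span_singleton, ← hW.ln_sundialLabel_inf_plane j e]
    exact linIdeal_inf_le _ _
  rcases hW.local_cases hZ hp with ⟨c, hc⟩ | ⟨j, hj⟩ | ⟨a, a', haa, ha, ha', hj⟩
  · refine (sup_le (hc.trans hJ) hL : W.compIdeal Z c ⊔ L ≤ Q) ?_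
    rcases c with (i | ⟨j, e⟩ | i) | (j | j | j) | _
    · exact Ideal.mem_sup_left (h1 (.inl (.inl i)) trivial)
    · refine (sup_le ((Ideal.pow_le_self two_ne_zero).trans (hpt j e)) le_sup_right :
        pointIdeal (sundialPoint W j) ^ 2 ⊔ L ≤ _) (h2 j)
    · exact linIdeal_inf_le _ _ (h4 i)
    · have h0 : f ∈ linIdeal (W.ln (.inr (.inl j, 0))) := h1 _ (inPlane_half j)
      rw [← hW.half_sup_inf_plane j] at h0
      exact linIdeal_sup_inf_le _ _ _ h0
    · exact Ideal.mem_sup_left ⟨h1 (.inr (.inr (.inl j), 0)) trivial,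
        h1 (.inr (.inr (.inl j), 1)) trivial⟩
    -- Modulo the equation of H both lines of the cross become the vertex, which accounts for the
    -- square of the point ideal; the ideal of the plane of the cross already vanishes on the cross.
    · have hv : W.vertex (.inr (.inr j)) ∈ plane η := hW.special.1 _ rfl
      have hm : ∀ e, pointIdeal (W.vertex (.inr (.inr j))) ≤
          linIdeal (W.ln (.inr (.inr (.inr j), e))) ⊔ L := fun e => by
        have he := sup_span_inf_plane (U := Submodule.span K {W.vertex (.inr (.inr j))})
          (by simpa using hv) (hW.dir_notMem (.inr (.inr (.inr j), e)) (Fin.succ_ne_zero e))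
        rw [← linIdeal_span_singleton, ← he, ← Submodule.span_insert]
        exact linIdeal_inf_le _ _
      have h3' := h3 j
      rw [crossPlane_eq] at h3'
      exact sup_le ((sq_le_mul_sup (hm 0) (hm 1)).trans (sup_le_sup_right Ideal.mul_le_inf _))
        (linIdeal_sup_inf_le _ _ _) h3'
    · exact Ideal.mem_sup_left h5
  · refine (sup_le (hj.trans hJ) hL : _ ≤ Q) ?_
    exact sup_le (sq_le_mul_sup (hpt j 0) (hpt j 1)) le_sup_right (h2 j)
  · refine (sup_le hL (hj.trans hJ) : _ ≤ Q) ?_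
    have := inf_linIdeal_le _ _ ⟨h1 a ha, h1 a' ha'⟩
    rwa [hW.ln_sup_ln hη haa ha ha'] at this

/-- On a line not in H the equation of H can be cancelled, as the ideal is prime. At an intersection
y of lines in H the product of f with the equation η is singular; its derivative in a direction θ
off H is f(y) η(θ), so f(y) = 0. -/
theorem residual_le (hη : η ≠ 0) (hW : IsGood η Y Z W) (hY : Y.IsNormalized η)
    (hZ : IsArrangement Z) : residual η ((configFamily (W.segment Y) Z hZ).fiber 0) ≤
      (resConfig W).scheme (resStar W) := by
  intro f hf
  rw [residual, Submodule.mem_colon_singleton, smul_eq_mul] at hf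
  rw [Config.mem_scheme_iff_ln]
  refine ⟨fun a => ?_, ?_⟩
  · rw [hW.resConfig_ln]
    refine mem_linIdeal_of_mul_mem (hW.fiber_le_ln hZ _ hf) fun h => ?_
    exact hW.dir_notMem _ (not_inPlane_resLabel a)
      (planeForm_mem_linIdeal.1 h _ (Submodule.subset_span (by simp)))
  · obtain ⟨θ, hθ⟩ := exists_notMem_plane hη
    rw [mem_vanishingIdeal_iff]
    intro x hx
    simp only [resStar, subStar, Set.mem_iUnion] at hx
    obtain ⟨i, i', hii, ho, hx⟩ := hx
    rw [traceLine_eq, traceLine_eq] at hx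
    have hc := compOf_traceLabel_ne (b := b) hii ho
    have hi := inPlane_traceLabel (b := b) i
    have hi' := inPlane_traceLabel (b := b) i'
    refine mem_linIdeal.1 (mem_linIdeal_of_ne_zero (inf_ne_bot_of_le_plane hη (hW.ln_le_plane hi)
      (hW.ln_le_plane hi') (hW.finrank_ln _) (hW.finrank_ln _)) fun y hy hy0 => ?_) x hx
    have h1 := (hW.flatDirs_fiber_of_inPlane hη hY hZ hf hc hi hi' hy0 hy.1 hy.2).2
    have h2 : θ ∈ flatDirs y (f * planeForm η) := h1 ▸ trivial
    have h3 : eval y (planeForm η) = 0 := by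
      rw [eval_planeForm]
      exact hW.ln_le_plane hi hy.1
    rw [mem_flatDirs, dirDeriv_mul, h3, zero_mul, add_zero, dirDeriv_planeForm] at h2
    exact (mul_eq_zero.1 h2).resolve_right hθ

/-- Locally f * g has to lie in the product of the ideals I and I' of two colliding lines. For a
sundial, f is in I(plane) + I * I', and g, which vanishes at the singular point, is in I + I'. For
two lines in H, f vanishes at the intersection, so it is in I + I', and g is in both ideals. -/
theorem le_residual [IsAlgClosed K] (hW : IsGood η Y Z W)
    (hZ : IsArrangement Z) (hZη : ∀ x ∈ Z, x ∈ plane η) :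
    (resConfig W).scheme (resStar W) ≤ residual η ((configFamily (W.segment Y) Z hZ).fiber 0) := by
  intro f hf
  rw [Config.mem_scheme_iff_ln] at hf
  obtain ⟨h1, h2⟩ := hf
  simp only [hW.resConfig_ln] at h1
  rw [residual, Submodule.mem_colon_singleton, smul_eq_mul]
  set g := planeForm η
  have hplane : ∀ {U : Submodule K (Fin 4 → K)}, U ≤ plane η → g ∈ linIdeal U := fun h =>
    planeForm_mem_linIdeal.2 fun x hx => h hx
  have hg : ∀ {a : q.LineIdx b ⊕ q.CrossIdx b × Fin 2}, InPlane (dirLabel a) →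
      f * g ∈ linIdeal (W.ln a) := fun ha =>
    Ideal.mul_mem_left _ _ (hplane (hW.ln_le_plane ha))
  have hf' : ∀ a, f * g ∈ linIdeal (W.ln (resLabel a)) := fun a => Ideal.mul_mem_right _ _ (h1 a)
  refine hW.saturation_prod_compIdeal_le_fiber hZ ?_
  refine le_saturation_of_localIdeal (I := Ideal.span {f * g}) (fun p hp => ?_)
    (Ideal.mem_span_singleton_self _)
  rw [Ideal.span_singleton_le_iff_mem]
  rcases hW.local_cases hZ hp with ⟨c, hc⟩ | ⟨j, hj⟩ | ⟨a, a', haa, ha, ha', hj⟩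
  · refine hc ?_
    rcases c with (i | ⟨j, e⟩ | i) | (j | j | j) | _
    · exact hg (a := .inl (.inl i)) trivial
    · exact hf' (.inr (.inr j, e))
    · exact hf' (.inl (.inl i))
    · exact ⟨hg (a := .inr (.inl j, 0)) (by simp [dirLabel, InPlane]), hf' (.inl (.inr j))⟩
    · exact ⟨hg (a := .inr (.inr (.inl j), 0)) trivial, hg (a := .inr (.inr (.inl j), 1)) trivial⟩
    · exact ⟨hf' (.inr (.inl j, 0)), hf' (.inr (.inl j, 1))⟩
    · exact Ideal.mul_mem_left _ _ (vanishingIdeal_anti_mono hZη (hplane le_rfl))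
  · refine hj ?_
    have hg' : g ∈ linIdeal (W.ln (sundialLabel j 0)) ⊔ linIdeal (W.ln (sundialLabel j 1)) :=
      linIdeal_inf_le _ _ (hplane ((hW.ln_sundialLabel_inf j).trans
        (by simpa using hW.base_mem_of_sundial j)))
    have := Ideal.mul_mem_mul (inf_linIdeal_le _ _
      ⟨h1 (.inr (.inr j, 0)), h1 (.inr (.inr j, 1))⟩) hg'
    refine (?_ : _ ≤ linIdeal _ * linIdeal _) this
    rw [Ideal.sup_mul]
    refine sup_le ?_ Ideal.mul_le_left
    rw [Ideal.mul_sup]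
    refine sup_le ?_ (Ideal.mul_mono_left (linIdeal_anti le_sup_left))
    rw [mul_comm]
    exact Ideal.mul_mono_right (linIdeal_anti le_sup_right)
  · refine hj ?_
    have hfa : f ∈ linIdeal (W.ln a ⊓ W.ln a') := by
      obtain ⟨i, rfl⟩ := exists_traceLabel ha
      obtain ⟨i', rfl⟩ := exists_traceLabel ha'
      refine vanishingIdeal_anti_mono (fun x hx => ?_) h2
      simp only [resStar, subStar, Set.mem_iUnion]
      refine ⟨i, i', fun h => haa (h ▸ rfl), fun j => ⟨?_, ?_⟩, ?_⟩
      · rintro ⟨rfl, rfl⟩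
        exact haa rfl
      · rintro ⟨rfl, rfl⟩
        exact haa rfl
      · rwa [traceLine_eq, traceLine_eq]
    have hga := hplane (hW.ln_le_plane ha)
    have hga' := hplane (hW.ln_le_plane ha')
    obtain ⟨u, hu, v, hv, rfl⟩ := Submodule.mem_sup.1 (linIdeal_inf_le _ _ hfa)
    rw [add_mul]
    refine Ideal.add_mem _ (Ideal.mul_mem_mul hu hga') ?_
    rw [mul_comm v g]
    exact Ideal.mul_mem_mul hga hv

end IsGood

end SpecParams

theorem subStar_comp_equiv {K : Type*} [Field K] {α α' β : Type} (e : α ≃ α')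
    (N : α' → Submodule K (Fin 4 → K)) (o : β → Fin 2 → α') :
    subStar N o = subStar (fun i => N (e i)) fun j f => e.symm (o j f) := by
  ext x
  simp only [subStar, Set.mem_iUnion, Equiv.symm_apply_eq]
  rw [← e.exists_congr_right]
  refine exists_congr fun i => ?_
  rw [← e.exists_congr_right]
  refine exists_congr fun i' => ?_
  rw [Ne, e.injective.eq_iff]

/-! ### The residual scheme is again of type B; existence of specializations. -/

namespace SpecParams

variable {q : SpecParams} {b : BType}

theorem resConfig_dirLabel {K : Type*} [Field K] (W : Config K (q.LineIdx b) (q.CrossIdx b)) (a) :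
    resConfig W (dirLabel a) = W (dirLabel (resLabel a)) := by
  rcases a with (i | j) | ⟨j | j, e⟩
  · rfl
  · rfl
  · rfl
  · fin_cases e <;> rfl

theorem compOf_resLabel_ne {a a' : (Fin (b.L - (q.ℓ + 2 * q.s)) ⊕ Fin q.h) ⊕
    (Fin (b.C - (q.c + q.h)) ⊕ Fin q.s) × Fin 2} (h : compOf a ≠ compOf a') :
    compOf (resLabel (q := q) (b := b) a) ≠ compOf (resLabel a') := by
  rcases a with (i | j) | ⟨j | j, e⟩ <;> rcases a' with (i' | j') | ⟨j' | j', e'⟩ <;>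
    simp_all [compOf, resLabel]

theorem root_resLabel_ne {a a' : (Fin (b.L - (q.ℓ + 2 * q.s)) ⊕ Fin q.h) ⊕
    (Fin (b.C - (q.c + q.h)) ⊕ Fin q.s) × Fin 2} (h : compOf a ≠ compOf a') :
    root (baseLabel (resLabel (q := q) (b := b) a)) ≠ root (baseLabel (resLabel a')) := by
  intro hr
  obtain ⟨j, f, f', -, h1, h2⟩ := sundial_of_root_eq (compOf_resLabel_ne h) hr
  rcases a with (i | j) | ⟨j | j, e⟩ <;> rcases a' with (i' | j') | ⟨j' | j', e'⟩ <;>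
    simp_all [compOf, resLabel]

/-- A component has at most two lines. -/
theorem eq_or_eq_or_eq_of_compOf {ι κ : Type} {a a' a'' : ι ⊕ κ × Fin 2}
    (h : compOf a = compOf a') (h' : compOf a = compOf a'') : a = a' ∨ a = a'' ∨ a' = a'' := by
  rcases a with i | ⟨j, e⟩ <;> rcases a' with i' | ⟨j', e'⟩ <;> rcases a'' with i'' | ⟨j'', e''⟩ <;>
    simp_all [compOf]
  omega

variable {K : Type*} [Field K] {η : Fin 4 → K}
  {Y W : Config K (q.LineIdx b) (q.CrossIdx b)} {Z : Set (Fin 4 → K)}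

namespace IsGood

theorem resConfig_baseLabel (hW : IsGood η Y Z W) (a) :
    resConfig W (baseLabel a) = W (baseLabel (resLabel a)) := by
  rcases a with (i | j) | ⟨j | j, e⟩
  · rfl
  · rfl
  · rfl
  · exact (hW.sundialLabel_base j e).symm

theorem resConfig_isNondegenerate (hW : IsGood η Y Z W) :
    (resConfig W).IsNondegenerate η (resStar W) := by
  refine .of_ln (fun i => ?_) (fun a => ?_) (fun j => ?_) (fun j => ?_) (fun a a' h => ?_)
    fun a x hx hxa => ?_
  · have := hW.line_indep (resLabel (.inl i))
    rwa [← hW.resConfig_baseLabel, ← resConfig_dirLabel W] at this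
  · rw [resConfig_dirLabel]
    exact hW.dir_notMem _ (not_inPlane_resLabel a)
  · rcases j with j | j
    · exact hW.special.1 (.inr (.inr (.inr j), 0)) rfl
    · exact hW.base_mem_of_sundial j
  · rcases j with j | j
    · exact hW.cross_indep (.inr (.inr j))
    · refine linearIndependent_three_iff.2 fun x y z h => ?_
      obtain ⟨h1, h2, h3, -⟩ := linearIndependent_four_iff.1 (hW.sundial_indep j) x y z 0 (by
        rw [zero_smul, add_zero]
        exact h)
      exact ⟨h1, h2, h3⟩
  · rw [hW.resConfig_ln, hW.resConfig_ln]
    exact hW.disjoint _ _ (compOf_resLabel_ne h) (root_resLabel_ne h)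
      fun h => not_inPlane_resLabel _ h.1
  · rw [hW.resConfig_ln] at hxa
    simp only [resStar, subStar, Set.mem_iUnion] at hx
    obtain ⟨i, i', hii, ho, hx⟩ := hx
    rw [traceLine_eq, traceLine_eq] at hx
    by_contra hx0
    rcases hW.eq_or_eq_of_mem_ln hx0 (compOf_traceLabel_ne (b := b) hii ho) hx.1 hx.2 hxa with h | h
    · exact not_inPlane_resLabel a (h ▸ inPlane_traceLabel i)
    · exact not_inPlane_resLabel a (h ▸ inPlane_traceLabel i')

theorem ln_ne (hη : η ≠ 0) (hW : IsGood η Y Z W) {a a' : q.LineIdx b ⊕ q.CrossIdx b × Fin 2}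
    (ha : InPlane (dirLabel a)) (ha' : InPlane (dirLabel a')) (h : a ≠ a') : W.ln a ≠ W.ln a' := by
  intro he
  by_cases hc : compOf a = compOf a'
  · rcases a with i | ⟨j, e⟩ <;> rcases a' with i' | ⟨j', e'⟩ <;> simp [compOf] at hc
    · exact h (by rw [hc])
    · subst hc
      have key : W.ln (.inr (j, 0)) ≠ W.ln (.inr (j, 1)) := fun he => by
        have h1 : W.arm j 1 ∈ W.ln (.inr (j, 0)) := he ▸ Submodule.subset_span (.inr rfl)
        obtain ⟨x, y, hxy⟩ := Submodule.mem_span_pair.1 h1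
        obtain ⟨-, -, h2⟩ := linearIndependent_three_iff.1 (hW.cross_indep j) x y (-1) (by
          change x • W.vertex j + y • W.arm j 0 = _ at hxy
          rw [hxy]
          module)
        exact one_ne_zero (neg_eq_zero.1 h2)
      fin_cases e <;> fin_cases e'
      · exact h rfl
      · exact key he
      · exact key he.symm
      · exact h rfl
  · have h1 := hW.ln_sup_ln hη hc ha ha'
    rw [← he, sup_idem] at h1
    have h2 := three_le_finrank_plane η
    rw [← h1, hW.finrank_ln] at h2
    omega

theorem resStar_isSubStar (hη : η ≠ 0) (hW : IsGood η Y Z W) :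
    IsSubStar η (q.next b).A (q.next b).B (resStar W) := by
  have e : Fin (q.next b).A ≃ q.TraceIdx := (Fintype.equivFinOfCardEq (by
    simp [next]
    omega)).symm
  have hP := fun i => inPlane_traceLabel (b := b) (e i)
  have hinj : ∀ {i i'}, i ≠ i' → traceLabel (b := b) (e i) ≠ traceLabel (e i') := fun h h' =>
    h (e.injective (traceLabel_injective h'))
  refine ⟨fun i => W.ln (traceLabel (e i)), fun j f => e.symm (.inr (.inr (j, f))), fun i => ?_,
    fun i i' h => ?_, fun i i' i'' h1 h2 h3 => ?_, fun p p' h => ?_, ?_⟩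
  · exact ⟨hW.ln_le_plane (hP i), hW.finrank_ln _⟩
  · exact hW.ln_ne hη (hP i) (hP i') (hinj h)
  · rw [eq_bot_iff]
    rintro x ⟨⟨hx, hx'⟩, hx''⟩
    rw [Submodule.mem_bot]
    -- Condition `triple` needs a line whose component differs from those of the other two. One of
    -- three distinct lines always qualifies, since a component has at most two lines.
    by_cases hc : compOf (traceLabel (b := b) (e i)) = compOf (traceLabel (e i'))
    · refine hW.triple _ _ _ (hP i) (hP i'') (hP i') (fun h => ?_) (fun h => ?_) (hinj h1)
        x hx hx'' hx'
      · have := eq_or_eq_or_eq_of_compOf hc h.symm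
        have := hinj h1
        have := hinj h2
        have := hinj h3
        tauto
      · have := eq_or_eq_or_eq_of_compOf hc (hc.trans h.symm)
        have := hinj h1
        have := hinj h2
        have := hinj h3
        tauto
    · by_cases hc' : compOf (traceLabel (b := b) (e i)) = compOf (traceLabel (e i''))
      · exact hW.triple _ _ _ (hP i) (hP i') (hP i'') (Ne.symm hc) (fun h => hc (hc'.trans h.symm))
          (hinj h2) x hx hx' hx''
      · exact hW.triple _ _ _ (hP i') (hP i) (hP i'') hc hc' (hinj h3) x hx' hx hx''
  · exact Sum.inr_injective (Sum.inr_injective (e.symm.injective h))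
  · rw [resStar, funext (traceLine_eq W)]
    exact subStar_comp_equiv e _ _

theorem isB_resConfig (hη : η ≠ 0) (hW : IsGood η Y Z W) :
    IsB η (q.next b) ((resConfig W).scheme (resStar W)) := by
  obtain ⟨Y', h1, h2, -⟩ := hW.resConfig_isNondegenerate.exists_normalized
    (finSumFinEquiv.symm : Fin (q.next b).L ≃ _) (finSumFinEquiv.symm : Fin (q.next b).C ≃ _)
  exact ⟨Y', resStar W, hW.resStar_isSubStar hη, h1, h2.symm⟩

end IsGood

theorem subset_plane_of_isSubStar {A B : ℕ} (h : IsSubStar η A B Z) : ∀ x ∈ Z, x ∈ plane η := by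
  obtain ⟨N, o, hN, -, -, -, rfl⟩ := h
  intro x hx
  simp only [subStar, Set.mem_iUnion] at hx
  obtain ⟨i, j, -, -, hx⟩ := hx
  exact (hN i).1 hx.1

/-- Every scheme `B(L, C, (A, B))` with enough lines and crosses admits specializations with given
parameters, under any condition of generality. -/
theorem exists_isSpecialization [IsAlgClosed K] (hη : η ≠ 0) (hq : q.Fits b) {X : Ideal (Coord K)}
    (hX : IsB η b X) {F : MvPolynomial (Label (q.LineIdx b) (q.CrossIdx b) × Fin 4) K}
    (hF : IsGenerality η F) :
    ∃ (𝓕 : FlatFamily K) (X₁ : Ideal (Coord K)), IsSpecialization η b q F X 𝓕 X₁ := by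
  have : Infinite K := IsAlgClosed.instInfinite
  obtain ⟨Y, Z, hZs, hYn, rfl, hY⟩ := IsB.exists_normalized hq hX
  obtain ⟨τ, _, z, hz, hzZ, hZ'⟩ := hZs.exists_points hη
  have hZ := isArrangement_of_isSubStar hη hZs
  have hZη := subset_plane_of_isSubStar hZs
  have hgood := eventually_isGood hη Y (fun j => sub_mem (hY (sundialLabel j 0)).1
    (hY (sundialLabel j 1)).1) (fun j h => ?_) z hz hZ'
  · obtain ⟨W₀, hW₀, hFW₀⟩ := hF
    obtain ⟨W, hW, hFW⟩ := (hgood.and (eventually_generic_ne_zero (isSpecial_iff.1 hW₀) (value F)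
      (eval_mem_lineRegular F) hFW₀)).exists
    -- W is now both in general position and subject to the prescribed condition F, two general
    -- properties on the same linear space.
    have h1 := Config.segment_evalAt_one W Y
    have hres : residual η ((configFamily (W.segment Y) Z hZ).fiber 0) =
        (resConfig W).scheme (resStar W) :=
      le_antisymm (hW.residual_le hη hY hZ) (hW.le_residual hZ hZη)
    refine ⟨configFamily (W.segment Y) Z hZ, (resConfig W).scheme (resStar W), W.segment Y, Y, W, Z,
      h1.symm, (Config.segment_evalAt_zero W Y).symm, hZs, hYn, rfl, ?_, ?_,
      isSpecial_iff.2 hW.special, hFW, le_antisymm (hW.trace_le hη hZ hZη) (hW.le_trace hη hZ), hres.symm, rfl,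
      hW.isB_resConfig hη⟩
    · have := configFamily_fiber (W.segment Y) hZ (η := η) (a := 1) (by rwa [h1])
      rwa [h1] at this
    · have := eventually_isNondegenerate (η := η) (Z := Z) (W.segment Y) (fun j a => ?_) (a₀ := 1)
        (by rwa [h1]) (fun a h => ?_) z hz hzZ hZ'
      · refine Filter.eventually_cofinite.1 ?_
        filter_upwards [this] with a ha using ⟨ha, configFamily_fiber _ hZ ha⟩
      · rw [Config.segment_evalAt]
        exact add_mem ((isSpecial_iff.2 hW.special).vertex_mem j) (Submodule.smul_mem _ _
          (sub_mem (hYn.vertex_mem j) ((isSpecial_iff.2 hW.special).vertex_mem j)))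
      · rw [h1, mem_plane_iff_dotProduct, (hY a).2] at h
        exact one_ne_zero h
  -- The two base vectors of a pair differ, since the lines of Y to be joined are disjoint and the
  -- vectors nonzero.
  · have hd := hYn.disjoint_ln (a := sundialLabel j 0) (a' := sundialLabel j 1) (by simp [compOf])
    refine (hYn.line_indep (.inr (.inl (j, 0)))).ne_zero 0 (Submodule.disjoint_def.1 hd _
      (Submodule.subset_span (.inl rfl)) ?_)
    exact Submodule.subset_span (.inl (sub_eq_zero.1 h))

end SpecParams

/-! ### The arithmetic of types, and the reduction. -/

/-- The parameters `qs` fit at every step of a sequence of specializations of schemes of type `b`,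
and lead to the type `b'`. -/
def ChainFits : List SpecParams → BType → BType → Prop
  | [], b, b' => b = b'
  | q :: qs, b, b' => q.Fits b ∧ ChainFits qs (q.next b) b'

theorem ChainFits.append {qs qs' : List SpecParams} {b b' b'' : BType} (h : ChainFits qs b b')
    (h' : ChainFits qs' b' b'') : ChainFits (qs ++ qs') b b'' := by
  induction qs generalizing b with
  | nil => exact (show b = b' from h) ▸ h'
  | cons q qs ih => exact ⟨h.1, ih h.2⟩

/-- Specializations exist from every scheme of a given type and under every condition of generality,
so a chain is obstructed only by the numbers of lines and crosses. -/
theorem ChainFits.reducesTo {K : Type*} [Field K] [IsAlgClosed K] {η : Fin 4 → K} (hη : η ≠ 0)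
    {qs : List SpecParams} {b b' : BType} (h : ChainFits qs b b') {X : Ideal (Coord K)}
    (hX : IsB η b X) : ReducesTo η b' qs b X := by
  induction qs generalizing b X with
  | nil => exact ⟨h, hX⟩
  | cons q qs ih =>
    refine ⟨h.1, hX, fun F hF => ?_⟩
    obtain ⟨𝓕, X₁, h𝓕⟩ := SpecParams.exists_isSpecialization hη h.1 hX hF
    refine ⟨𝓕, X₁, h𝓕, ih h.2 ?_⟩
    obtain ⟨Γ, Y, W, Z, -, -, -, -, -, -, -, -, -, -, -, -, hB⟩ := h𝓕
    exact hB

theorem yType_even (n : ℕ) :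
    yType (2 * n) = ⟨2 * (n * n) + 5 * n + 1, 2 * (n * n), 2 * n + 1, n⟩ := by
  rw [yType, if_pos (even_two_mul n)]
  ext
  · exact Nat.div_eq_of_eq_mul_right two_pos (by ring)
  · exact Nat.div_eq_of_eq_mul_right two_pos (by ring)
  · rfl
  · exact Nat.mul_div_cancel_left n two_pos

theorem yType_odd (n : ℕ) :
    yType (2 * n + 1) = ⟨2 * (n * n) + 7 * n + 5, 2 * (n * n) + 2 * n, 2 * n + 2, n + 1⟩ := by
  rw [yType, if_neg (by simp)]
  ext
  · exact Nat.div_eq_of_eq_mul_right two_pos (by ring)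
  · refine Nat.div_eq_of_eq_mul_right two_pos ?_
    rw [Nat.sub_eq_iff_eq_add (Nat.one_le_pow _ _ (by omega))]
    ring
  · rfl
  · exact Nat.div_eq_of_eq_mul_right two_pos (by ring)

theorem exists_chainFits {k : ℕ} (hk : 4 ≤ k) : ∃ q₀ q₁ q₂ : SpecParams,
    ChainFits [q₀, q₁, q₂] (yType k) (yType (k - 1)) := by
  rcases Nat.even_or_odd' k with ⟨n, rfl | rfl⟩
  · obtain ⟨m, rfl⟩ : ∃ m, n = m + 1 := ⟨n - 1, by omega⟩
    -- With n = m + 1 the types after the first two steps are (2n² + 5n, 2n² - n, 2n + 1, 0) and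
    -- (2n² + 5n, 2n² - 2n, 2n, n). The third step needs n of the 2n² - 2n crosses, which fails for
    -- k = 2 and explains the use of k ≥ 4.
    refine ⟨⟨m + 2, 0, m + 1, 0⟩, ⟨0, 0, 0, m + 1⟩, ⟨0, m + 1, 0, m + 1⟩, ?_⟩
    rw [yType_even, show 2 * (m + 1) - 1 = 2 * m + 1 by omega, yType_odd,
      show (m + 1) * (m + 1) = m * m + 2 * m + 1 by ring]
    have : m ≤ m * m := Nat.le_mul_self m
    generalize m * m = P at *
    refine ⟨⟨?_, ?_⟩, ⟨?_, ?_⟩, ⟨?_, ?_⟩, ?_⟩ <;> simp [SpecParams.next, ChainFits] <;> omega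
  -- Here the intermediate types are (2n² + 7n + 3, 2n² + n, 2n + 2, 0) and (2n² + 7n + 2, 2n², 2n +
  -- 1, n).
  · refine ⟨⟨n + 2, 0, n, 0⟩, ⟨1, 0, 0, n⟩, ⟨1, n, 0, n⟩, ?_⟩
    rw [yType_odd, show 2 * n + 1 - 1 = 2 * n by omega, yType_even]
    have : n ≤ n * n := Nat.le_mul_self n
    generalize n * n = P at *
    refine ⟨⟨?_, ?_⟩, ⟨?_, ?_⟩, ⟨?_, ?_⟩, ?_⟩ <;> simp [SpecParams.next, ChainFits] <;> omega

theorem exists_chainFits_yType_three {k : ℕ} (hk : 3 ≤ k) : ∃ qs : List SpecParams,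
    qs.length = 3 * (k - 3) ∧ ChainFits qs (yType k) ⟨14, 4, 4, 2⟩ := by
  induction k, hk using Nat.le_induction with
  | base => exact ⟨[], rfl, yType_odd 1⟩
  | succ k hk ih =>
    obtain ⟨qs, hqs, h⟩ := ih
    obtain ⟨q₀, q₁, q₂, h'⟩ := exists_chainFits (k := k + 1) (by omega)
    exact ⟨[q₀, q₁, q₂] ++ qs, by simp; omega, h'.append h⟩

end

end Postulation

theorem lemma4p1 {K : Type*} [Field K] [IsAlgClosed K] (η : Fin 4 → K) (hη : η ≠ 0) :
    (∀ k : ℕ, 4 ≤ k → ∃ q₀ q₁ q₂ : Postulation.SpecParams,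
      ∀ X : Ideal (Postulation.Coord K), Postulation.IsB η (Postulation.yType k) X →
        Postulation.ReducesTo η (Postulation.yType (k - 1)) [q₀, q₁, q₂]
          (Postulation.yType k) X) ∧
    (∀ k : ℕ, 3 ≤ k → ∃ qs : List Postulation.SpecParams, qs.length = 3 * (k - 3) ∧
      ∀ X : Ideal (Postulation.Coord K), Postulation.IsB η (Postulation.yType k) X →
        Postulation.ReducesTo η ⟨14, 4, 4, 2⟩ qs (Postulation.yType k) X) ∧
    (∀ (b : Postulation.BType) (q : Postulation.SpecParams)
      (F : MvPolynomial (Postulation.Label (q.LineIdx b) (q.CrossIdx b) × Fin 4) K)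
      (X : Ideal (Postulation.Coord K)) (𝓕 : Postulation.FlatFamily K)
      (X₁ : Ideal (Postulation.Coord K)),
      Postulation.SpecParams.IsSpecialization η b q F X 𝓕 X₁ → ∀ n : ℕ,
        Postulation.IsEmptySystem n X₁ →
        Postulation.IsEmptySystemOn η (n + 1) (Postulation.trace η (𝓕.fiber 0)) →
        Postulation.IsEmptySystem (n + 1) (𝓕.fiber 0) ∧
          {a : K | ¬ Postulation.IsEmptySystem (n + 1) (𝓕.fiber a)}.Finite) := by
  have : Infinite K := IsAlgClosed.instInfinite
  refine ⟨fun k hk => ?_, fun k hk => ?_, fun b q F X 𝓕 X₁ h n h1 h2 => h.isEmptySystem hη h1 h2⟩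
  · obtain ⟨q₀, q₁, q₂, h⟩ := Postulation.exists_chainFits hk
    exact ⟨q₀, q₁, q₂, fun X hX => h.reducesTo hη hX⟩
  · obtain ⟨qs, hqs, h⟩ := Postulation.exists_chainFits_yType_three hk
    exact ⟨qs, hqs, fun X hX => h.reducesTo hη hX⟩
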